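/- Let $d\in\mathbb N$, $T>0$, let $(\Omega,\mathcal F,\mathbb P)$ be a probability space carrying a standard $\mathbb R^d$-valued Brownian motion $B=(B_t)_{t\in[0,T]}$, and let $(\mathcal F_t)_{t\in[0,T]}$ be its natural filtration augmented by the $\mathbb P$-negligible sets. Let $b\in L^2_{loc}([0,T]\times\mathbb R^d;\mathbb R^d)$ have distributional divergence (in $x$) $\operatorname{div} b\in L^1([0,T];L^\infty(\mathbb R^d))$, and let $u_0\in L^2(\mathbb R^d)\cap L^\infty(\mathbb R^d)$. For $h\in L^2([0,T];\mathbb R^d)$, the random variable $F=\exp\big(\int_0^T h(s)\cdot dB_s-\tfrac12\int_0^T|h(s)|^2ds\big)$ is called the stochastic exponential of $h$; let $\mathcal X$ be the set of all of these. A process $u\in L^2\cap L^\infty(\Omega\times[0,T]\times\mathbb R^d)$ is called a quasiregular weak solution of $\partial_t u+(b+\tfrac{dB_t}{dt})\cdot\nabla u=0$, $u|_{t=0}=u_0$, if (i) for each $\varphi\in C_c^\infty(\mathbb R^d)$ the process $t\mapsto\int u(t,x)\varphi(x)\,dx$ (defined for almost every $t$) has a continuous modification on $[0,T]$ that is an $(\mathcal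 F_t)$-semimartingale, and, with these modifications used on the left-hand side and as Stratonovich integrands, for all $t\in[0,T]$, $\mathbb P$-almost surely, $$\int u(t,x)\varphi(x)\,dx=\int u_0\varphi\,dx+\int_0^t\!\!\int u\,b\cdot\nabla\varphi\,dx\,ds+\int_0^t\!\!\int \operatorname{div}b\;u\,\varphi\,dx\,ds+\sum_{i=1}^d\int_0^t\Big(\int u(s,x)\,\partial_i\varphi(x)\,dx\Big)\circ dB^i_s ,$$ where the last integrals are Stratonovich integrals; and (ii) for each $F\in\mathcal X$ the function $V=\mathbb E[uF]$ is measurable and (essentially) bounded and belongs to $L^2([0,T];H^1(\mathbb R^d))\cap C([0,T];L^2(\mathbb R^d))$. **Lemma.** Let $u$ be a quasiregular weak solution, let $h\in L^2([0,T];\mathbb R^d)$ and let $F\in\mathcal X$ be the stochastic exponential of $h$. Then $V:=\mathbb E[uF]$ is a weak solution of $$\partial_tV+(b+h)\cdot\nabla V=\tfrac12\Delta V,\qquad V(0)=u_0 ,$$ that is, $V\in L^2([0,T];H^1(\mathbb R^d))\cap C([0,T];L^2(\mathbb R^d))$, $V(0,\cdot)=u_0$ almost everywhere, and for every $\varphi\in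 C_c^\infty(\mathbb R^d)$ and every $t\in[0,T]$ $$\int V(t,x)\varphi\,dx=\int V(0,x)\varphi\,dx+\int_0^t\!\!\int V\,(b\cdot\nabla\varphi+\varphi\operatorname{div}b)\,dx\,ds+\int_0^t\!\!\int V\,h(s)\cdot\nabla\varphi\,dx\,ds-\tfrac12\int_0^t\!\!\int\nabla V\cdot\nabla\varphi\,dx\,ds ,$$ where $V(t,\cdot)$ and $V(0,\cdot)$ denote the values of the representative of $V$ in $C([0,T];L^2(\mathbb R^d))$. -/

import Mathlib

open MeasureTheory ProbabilityTheory Filter Topology Set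
open scoped NNReal ENNReal

/-- The space `ℝ^d` with its Euclidean norm. -/
abbrev Space (d : ℕ) : Type := EuclideanSpace ℝ (Fin d)

/-- Lebesgue measure on the time interval `[0,T]`. -/
noncomputable abbrev timeMeasure (T : ℝ) : Measure ℝ := volume.restrict (Icc 0 T)

/-- Lebesgue measure on `[0,T] × ℝ^d`. -/
noncomputable abbrev timeSpaceMeasure (T : ℝ) (d : ℕ) : Measure (ℝ × Space d) :=
  (timeMeasure T).prod volume

/-- Test functions: the class `C_c^∞(ℝ^d)`. -/
def IsTestFunction {d : ℕ} (φ : Space d → ℝ) : Prop :=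
  ContDiff ℝ (⊤ : ℕ∞) φ ∧ HasCompactSupport φ

/-- The partial derivative `∂_i φ`. For a vector `v`, the number `v · ∇φ(x)` is written
`fderiv ℝ φ x v` below. -/
noncomputable def pderiv {d : ℕ} (i : Fin d) (φ : Space d → ℝ) (x : Space d) : ℝ :=
  fderiv ℝ φ x (EuclideanSpace.single i 1)

section Stochastic

variable {Ω : Type*} [mΩ : MeasurableSpace Ω] {d : ℕ}

/-- The σ-algebra generated by `B_s`, `0 ≤ s ≤ t`. -/
abbrev pastSigma (B : ℝ → Ω → Space d) (t : ℝ) : MeasurableSpace Ω :=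
  ⨆ s ∈ Icc (0 : ℝ) t, MeasurableSpace.comap (B s) inferInstance

/-- `B` (of which only the values at times in `[0,T]` matter) is a standard `d`-dimensional
Brownian motion on `[0,T]`: it starts at `0`, its paths are almost surely continuous, and for
`s ≤ t` the increment `B_t - B_s` is independent of `(B_r)_{r ≤ s}` and has independent centred
Gaussian coordinates of variance `t - s`. -/
structure IsBrownianMotionOn (P : Measure Ω) (T : ℝ) (B : ℝ → Ω → Space d) : Prop where
  measurable : ∀ t ∈ Icc 0 T, Measurable (B t)
  start : ∀ᵐ ω ∂P, B 0 ω = 0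
  continuous : ∀ᵐ ω ∂P, ContinuousOn (fun t => B t ω) (Icc 0 T)
  law : ∀ s t, 0 ≤ s → s ≤ t → t ≤ T →
    HasLaw (fun ω (i : Fin d) => B t ω i - B s ω i)
      (Measure.pi fun _ => gaussianReal 0 (t - s).toNNReal) P
  indep : ∀ s t, 0 ≤ s → s ≤ t → t ≤ T →
    Indep (MeasurableSpace.comap (fun ω => B t ω - B s ω) inferInstance) (pastSigma B s) P

/-- The natural filtration of the Brownian motion on `[0,T]`, augmented by the `P`-negligible
events, and kept constant after time `T`. -/
noncomputable def brownianFiltration (P : Measure Ω) (T : ℝ) (B : ℝ → Ω → Space d) :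
    Filtration ℝ≥0 mΩ where
  seq t := eventuallyMeasurableSpace (pastSigma B (min (t : ℝ) T)) (ae P) ⊓ mΩ
  mono' := by
    intro s t hst
    refine inf_le_inf_right _ ?_
    have h : pastSigma B (min (s : ℝ) T) ≤ pastSigma B (min (t : ℝ) T) :=
      biSup_mono fun r hr => ⟨hr.1, hr.2.trans (min_le_min_right T (NNReal.coe_le_coe.2 hst))⟩
    rintro A ⟨A', hA', hAA'⟩
    exact ⟨A', h _ hA', hAA'⟩
  le' := fun _ => inf_le_right

/-- Continuous local martingales. -/
structure IsContLocalMartingale (P : Measure Ω) (𝓕 : Filtration ℝ≥0 mΩ)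
    (M : ℝ≥0 → Ω → ℝ) : Prop where
  adapted : StronglyAdapted 𝓕 M
  continuous : ∀ᵐ ω ∂P, Continuous fun t => M t ω
  locally_martingale : Locally (fun Y => Martingale Y 𝓕 P) 𝓕 M P

/-- Continuous adapted processes whose paths have finite variation on bounded intervals. -/
structure IsContFiniteVariation (P : Measure Ω) (𝓕 : Filtration ℝ≥0 mΩ)
    (A : ℝ≥0 → Ω → ℝ) : Prop where
  adapted : StronglyAdapted 𝓕 A
  continuous : ∀ᵐ ω ∂P, Continuous fun t => A t ω
  finite_variation : ∀ᵐ ω ∂P, LocallyBoundedVariationOn (fun t => A t ω) univ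

/-- On `[0,T]` the process `X` is a continuous semimartingale: the sum of a continuous local
martingale and a continuous adapted process of finite variation. -/
def IsContSemimartingaleOn (P : Measure Ω) (𝓕 : Filtration ℝ≥0 mΩ) (T : ℝ)
    (X : ℝ → Ω → ℝ) : Prop :=
  ∃ M A : ℝ≥0 → Ω → ℝ, IsContLocalMartingale P 𝓕 M ∧ IsContFiniteVariation P 𝓕 A ∧
    ∀ᵐ ω ∂P, ∀ t : ℝ≥0, (t : ℝ) ≤ T → X t ω = M t ω + A t ω

/-- A partition `0 = t_0 ≤ t_1 ≤ ⋯ ≤ t_N = t` of `[0,t]`. -/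
structure TimePartition (t : ℝ) where
  N : ℕ
  pt : ℕ → ℝ
  mono : Monotone pt
  pt_zero : pt 0 = 0
  pt_last : pt N = t

/-- The partitions `π n` have mesh tending to `0`. -/
def MeshTendstoZero {t : ℝ} (π : ℕ → TimePartition t) : Prop :=
  ∀ δ > 0, ∀ᶠ n in atTop, ∀ k < (π n).N, (π n).pt (k + 1) - (π n).pt k < δ

/-- The symmetric sum `∑ ½ (X_{t_k} + X_{t_{k+1}}) (Z_{t_{k+1}} - Z_{t_k})`. -/
noncomputable def stratonovichSum {t : ℝ} (π : TimePartition t) (X Z : ℝ → Ω → ℝ) (ω : Ω) : ℝ :=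
  ∑ k ∈ Finset.range π.N,
    (X (π.pt k) ω + X (π.pt (k + 1)) ω) / 2 * (Z (π.pt (k + 1)) ω - Z (π.pt k) ω)

/-- `S` is the Stratonovich integral `∫_0^t X ∘ dZ`: the limit in probability of the symmetric
sums along every sequence of partitions of `[0,t]` with mesh tending to `0`. -/
def IsStratonovichIntegral (P : Measure Ω) (t : ℝ) (X Z : ℝ → Ω → ℝ) (S : Ω → ℝ) : Prop :=
  ∀ π : ℕ → TimePartition t, MeshTendstoZero π →
    TendstoInMeasure P (fun n => stratonovichSum (π n) X Z) atTop S

/-- The step function on `[0,T]` equal to `c k` on `(t_k, t_{k+1}]`. -/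
noncomputable def stepFunction {T : ℝ} (π : TimePartition T) (c : ℕ → Space d) (s : ℝ) : Space d :=
  ∑ k ∈ Finset.range π.N, (Ioc (π.pt k) (π.pt (k + 1))).indicator (fun _ => c k) s

/-- The integral `∑ c k · (B_{t_{k+1}} - B_{t_k})` of a step function. -/
noncomputable def stepIntegral {T : ℝ} (π : TimePartition T) (c : ℕ → Space d)
    (B : ℝ → Ω → Space d) (ω : Ω) : ℝ :=
  ∑ k ∈ Finset.range π.N, inner ℝ (c k) (B (π.pt (k + 1)) ω - B (π.pt k) ω)

/-- `I` is the Wiener-Itô integral `∫_0^T h(s) · dB_s` of the deterministic function `h`: the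
limit in `L²(Ω)` of the integrals of step functions that converge to `h` in `L²([0,T]; ℝ^d)`. -/
def IsWienerIntegral (P : Measure Ω) (T : ℝ) (B : ℝ → Ω → Space d) (h : ℝ → Space d)
    (I : Ω → ℝ) : Prop :=
  AEStronglyMeasurable I P ∧
  ∃ (π : ℕ → TimePartition T) (c : ℕ → ℕ → Space d),
    Tendsto (fun n => eLpNorm (fun s => stepFunction (π n) (c n) s - h s) 2 (timeMeasure T))
      atTop (𝓝 0) ∧
    Tendsto (fun n => eLpNorm (fun ω => stepIntegral (π n) (c n) B ω - I ω) 2 P)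
      atTop (𝓝 0)

/-- `F` is the stochastic exponential `exp (∫_0^T h · dB - ½ ∫_0^T |h|² ds)` of
`h ∈ L²([0,T]; ℝ^d)`. -/
def IsStochasticExponential (P : Measure Ω) (T : ℝ) (B : ℝ → Ω → Space d) (h : ℝ → Space d)
    (F : Ω → ℝ) : Prop :=
  MemLp h 2 (timeMeasure T) ∧
  ∃ I : Ω → ℝ, IsWienerIntegral P T B h I ∧
    F =ᵐ[P] fun ω => Real.exp (I ω - 1 / 2 * ∫ s in (0 : ℝ)..T, ‖h s‖ ^ 2)

/-- The space `𝒳` of stochastic exponentials. -/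
def stochasticExponentials (P : Measure Ω) (T : ℝ) (B : ℝ → Ω → Space d) : Set (Ω → ℝ) :=
  {F | ∃ h : ℝ → Space d, IsStochasticExponential P T B h F}

end Stochastic

section Fields

variable {d : ℕ}

/-- `b ∈ L²_loc([0,T] × ℝ^d; ℝ^d)`. -/
def MemL2Loc (T : ℝ) (b : ℝ → Space d → Space d) : Prop :=
  ∀ K : Set (Space d), IsCompact K →
    MemLp (fun p : ℝ × Space d => b p.1 p.2) 2 ((timeMeasure T).prod (volume.restrict K))

/-- The function `g` is the distributional (spatial) divergence of `b` on `[0,T] × ℝ^d`. -/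
def HasWeakDiv (T : ℝ) (b : ℝ → Space d → Space d) (g : ℝ → Space d → ℝ) : Prop :=
  ∀ φ : Space d → ℝ, IsTestFunction φ → ∀ᵐ s ∂timeMeasure T,
    ∫ x, fderiv ℝ φ x (b s x) = - ∫ x, g s x * φ x

/-- `g ∈ L¹([0,T]; L^∞(ℝ^d))`. -/
def MemL1Linfty (T : ℝ) (g : ℝ → Space d → ℝ) : Prop :=
  AEStronglyMeasurable (fun p : ℝ × Space d => g p.1 p.2) (timeSpaceMeasure T d) ∧
  ∃ γ : ℝ → ℝ, Integrable γ (timeMeasure T) ∧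
    ∀ᵐ p ∂timeSpaceMeasure T d, |g p.1 p.2| ≤ γ p.1

/-- `V ∈ L²([0,T]; H¹(ℝ^d))`, with weak gradient `G = ∇V`. -/
structure IsL2H1With (T : ℝ) (V : ℝ → Space d → ℝ) (G : ℝ → Space d → Space d) : Prop where
  memLp : MemLp (fun p : ℝ × Space d => V p.1 p.2) 2 (timeSpaceMeasure T d)
  memLp_grad : MemLp (fun p : ℝ × Space d => G p.1 p.2) 2 (timeSpaceMeasure T d)
  weak_grad : ∀ φ : Space d → ℝ, IsTestFunction φ → ∀ i, ∀ᵐ s ∂timeMeasure T,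
    ∫ x, V s x * pderiv i φ x = - ∫ x, G s x i * φ x

/-- `W` is a representative of `V` in `C([0,T]; L²(ℝ^d))`. -/
structure IsContL2Version (T : ℝ) (V : ℝ → Space d → ℝ)
    (W : ℝ → Lp ℝ 2 (volume : Measure (Space d))) : Prop where
  continuousOn : ContinuousOn W (Icc 0 T)
  eq_ae : ∀ᵐ s ∂timeMeasure T, W s =ᵐ[volume] V s

/-- `V` is a weak solution, in the class `L²([0,T]; H¹) ∩ C([0,T]; L²)`, of
`∂_t V + (b + h) · ∇V = ½ ΔV` on `[0,T] × ℝ^d` with `V(0) = u₀`, where `divb = div b`. -/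
def IsParabolicWeakSolution (T : ℝ) (b : ℝ → Space d → Space d) (divb : ℝ → Space d → ℝ)
    (h : ℝ → Space d) (u₀ : Space d → ℝ) (V : ℝ → Space d → ℝ) : Prop :=
  ∃ (G : ℝ → Space d → Space d) (W : ℝ → Lp ℝ 2 (volume : Measure (Space d))),
    IsL2H1With T V G ∧ IsContL2Version T V W ∧ W 0 =ᵐ[volume] u₀ ∧
    ∀ φ : Space d → ℝ, IsTestFunction φ → ∀ t ∈ Icc 0 T,
      ∫ x, W t x * φ x = (∫ x, W 0 x * φ x)
        + (∫ s in (0 : ℝ)..t, ∫ x, V s x * (fderiv ℝ φ x (b s x) + φ x * divb s x))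
        + (∫ s in (0 : ℝ)..t, ∫ x, V s x * fderiv ℝ φ x (h s))
        - 1 / 2 * ∫ s in (0 : ℝ)..t, ∫ x, fderiv ℝ φ x (G s x)

end Fields

section Solutions

variable {Ω : Type*} [MeasurableSpace Ω] {d : ℕ}

/-- The process `X` is a continuous modification of `t ↦ ∫ u(t,x) φ(x) dx` that is a
semimartingale for the (augmented) Brownian filtration. As `u` is an element of an `L^p` space
over `Ω × [0,T] × ℝ^d`, the process `t ↦ ∫ u(t,x) φ(x) dx` is only determined at almost every
time; `X` is its continuous representative. -/
structure IsSemimartingaleVersion (P : Measure Ω) (T : ℝ) (B : ℝ → Ω → Space d)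
    (u : Ω → ℝ → Space d → ℝ) (φ : Space d → ℝ) (X : ℝ → Ω → ℝ) : Prop where
  continuous : ∀ᵐ ω ∂P, ContinuousOn (fun t => X t ω) (Icc 0 T)
  modification : ∀ᵐ t ∂timeMeasure T, ∀ᵐ ω ∂P, X t ω = ∫ x, u ω t x * φ x
  semimartingale : IsContSemimartingaleOn P (brownianFiltration P T B) T X

/-- The function `V = 𝔼[u F]` of `(t,x)`. -/
noncomputable def meanAgainst (P : Measure Ω) (u : Ω → ℝ → Space d → ℝ) (F : Ω → ℝ)
    (t : ℝ) (x : Space d) : ℝ :=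
  ∫ ω, u ω t x * F ω ∂P

/-- Quasiregular weak solutions of the Cauchy problem
`∂_t u + (b + dB/dt) · ∇u = 0`, `u(0) = u₀` (Stratonovich sense) on `[0,T] × ℝ^d`, where
`divb = div b`. -/
structure IsQuasiregularWeakSolution (P : Measure Ω) (T : ℝ) (B : ℝ → Ω → Space d)
    (b : ℝ → Space d → Space d) (divb : ℝ → Space d → ℝ) (u₀ : Space d → ℝ)
    (u : Ω → ℝ → Space d → ℝ) : Prop where
  memLp_two : MemLp (fun p : Ω × ℝ × Space d => u p.1 p.2.1 p.2.2) 2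
    (P.prod (timeSpaceMeasure T d))
  memLp_top : MemLp (fun p : Ω × ℝ × Space d => u p.1 p.2.1 p.2.2) ∞
    (P.prod (timeSpaceMeasure T d))
  exists_version : ∀ φ : Space d → ℝ, IsTestFunction φ →
    ∃ X : ℝ → Ω → ℝ, IsSemimartingaleVersion P T B u φ X
  equation : ∀ φ : Space d → ℝ, IsTestFunction φ →
    ∀ (X : ℝ → Ω → ℝ) (Y : Fin d → ℝ → Ω → ℝ), IsSemimartingaleVersion P T B u φ X →
    (∀ i, IsSemimartingaleVersion P T B u (pderiv i φ) (Y i)) →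
    ∀ t ∈ Icc 0 T, ∃ S : Fin d → Ω → ℝ,
      (∀ i, IsStratonovichIntegral P t (Y i) (fun s ω => B s ω i) (S i)) ∧
      ∀ᵐ ω ∂P, X t ω = (∫ x, u₀ x * φ x)
        + (∫ s in (0 : ℝ)..t, ∫ x, u ω s x * fderiv ℝ φ x (b s x))
        + (∫ s in (0 : ℝ)..t, ∫ x, divb s x * u ω s x * φ x)
        + ∑ i, S i ω
  mean_bounded : ∀ F ∈ stochasticExponentials P T B,
    MemLp (fun p : ℝ × Space d => meanAgainst P u F p.1 p.2) ∞ (timeSpaceMeasure T d)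
  mean_H1 : ∀ F ∈ stochasticExponentials P T B, ∃ G, IsL2H1With T (meanAgainst P u F) G
  mean_cont : ∀ F ∈ stochasticExponentials P T B, ∃ W, IsContL2Version T (meanAgainst P u F) W

end Solutions

/-! ### Factoring means over an independent increment -/

section Independence

variable {Ω : Type*} {mΩ : MeasurableSpace Ω} {P : Measure Ω}

/-! Pair the equation with a test function φ, multiply by F and take expectations. The drift terms
pass through by Fubini, because u is bounded, and E[F] = 1 preserves the initial term. What remains
is the mean against F of the Stratonovich integrals of Y^i = ∫ u ∂_iφ dx against B^i. Each is an Itô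
integral plus half the covariation of Y^i and B^i. Weighting by F gives B the drift h (Girsanov), so
the Itô integral has mean ∫ E[F Y^i] h_i ds; the sum over i is the term with h·∇φ. For the
covariation, use the equation a second time, now tested against ∂_iφ: the integrand of Y^i against
dB^i is ∫ u ∂_i∂_iφ dx, and the covariation is its time integral. The means add up to ½ ∫∫ V Δφ, and
the weak gradient of V turns this into -½ ∫∫ ∇V·∇φ.

Stratonovich integrals are given only as limits in probability of symmetric sums, so the argument
runs on finite sums along uniform grids. It rests on three results.

Cameron–Martin for one increment (`IsStochasticExponential.integral_mul_increment`): for a step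
function h this is a Gaussian computation with independent increments; the general case is an L²
limit, controlled by bounded exponential moments.

Covariation (`tendstoInMeasure_covariation`): on a coarse grid of n steps, each increment of Y is
approximated by symmetric sums on a finer grid of nm steps. These split into Itô sums and half the
fine products of increments. The Itô sums times coarse increments of B are within O(1/n) in mean
square of a Riemann sum, uniformly in m. The products, like the drift, are tight in total absolute
value and are killed by the smallness of the largest coarse increment of B. The tightness comes from
`IsContSemimartingaleOn.tightSquares`.

Passage to means (`integral_mul_stratonovich`): convergence in probability together with an L² bound
gives weak convergence. The covariation sums have no evident L² bound, so they are exchanged for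
Riemann sums with the same limit in probability. The sum of the Stratonovich integrals is bounded
because the equation expresses it through bounded quantities.

The equation is first obtained for the bounded continuous versions of the pairings, then transferred
to the continuous L² representative W of V. Time 0 of the resulting identity gives W(0) = u₀. -/

theorem indepFun_of_indep_comap {E : Type*} [MeasurableSpace E] {m : MeasurableSpace Ω}
    {D : Ω → E} (hind : Indep (MeasurableSpace.comap D inferInstance) m P)
    {G : Ω → ℝ} (hG : StronglyMeasurable[m] G) {g : E → ℝ} (hg : Measurable g) :
    IndepFun G (fun ω => g (D ω)) P := by
  rw [IndepFun_iff_Indep]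
  refine (indep_of_indep_of_le_left (indep_of_indep_of_le_right hind ?_) ?_).symm
  · exact hG.measurable.comap_le
  · rintro _ ⟨s, hs, rfl⟩
    exact ⟨g ⁻¹' s, hg hs, rfl⟩

/-- The pattern of all later moment computations: G depends on the past m and D is the next
increment. The σ-algebra is kept abstract so as to cover both the augmented filtration and its
restriction to a grid. -/
theorem integral_mul_of_indep_comap {E : Type*} [MeasurableSpace E] {m : MeasurableSpace Ω}
    (hm : m ≤ mΩ) {D : Ω → E} (hD : Measurable[mΩ] D)
    (hind : Indep (MeasurableSpace.comap D inferInstance) m P)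
    {G : Ω → ℝ} (hG : StronglyMeasurable[m] G) {g : E → ℝ} (hg : Measurable g) :
    ∫ ω, G ω * g (D ω) ∂P = (∫ ω, G ω ∂P) * ∫ ω, g (D ω) ∂P :=
  (indepFun_of_indep_comap hind hG hg).integral_fun_mul_eq_mul_integral
    (hG.mono hm).aestronglyMeasurable
    (@Measurable.comp _ _ _ mΩ _ _ _ _ hg hD).aestronglyMeasurable

theorem integrable_mul_of_indep_comap {E : Type*} [MeasurableSpace E] {m : MeasurableSpace Ω}
    {D : Ω → E} (hind : Indep (MeasurableSpace.comap D inferInstance) m P)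
    {G : Ω → ℝ} (hG : StronglyMeasurable[m] G) (hGi : Integrable G P)
    {g : E → ℝ} (hg : Measurable g) (hgi : Integrable (fun ω => g (D ω)) P) :
    Integrable (fun ω => G ω * g (D ω)) P :=
  (indepFun_of_indep_comap hind hG hg).integrable_mul hGi hgi

end Independence

/-! ### Gaussian moments -/

section GaussianMoments

/-- Differentiate the moment generating function exp(vc²/2) at c. -/
theorem integral_id_mul_exp_gaussianReal (v : ℝ≥0) (c : ℝ) :
    ∫ x, x * Real.exp (c * x) ∂gaussianReal 0 v = c * v * Real.exp (v * c ^ 2 / 2) := by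
  have h1 := hasDerivAt_mgf (X := id) (μ := gaussianReal 0 v) (t := c)
    (by simp [integrableExpSet_id_gaussianReal])
  rw [mgf_id_gaussianReal] at h1
  have h2 : HasDerivAt (fun t : ℝ => Real.exp (0 * t + v * t ^ 2 / 2))
      (Real.exp (v * c ^ 2 / 2) * (c * v)) c := by
    have : HasDerivAt (fun t : ℝ => 0 * t + v * t ^ 2 / 2) (c * v) c := by
      have := ((hasDerivAt_pow 2 c).const_mul (v : ℝ)).div_const 2
      refine (this.congr_deriv ?_).congr_of_eventuallyEq ?_
      · norm_num; ring
      · exact Eventually.of_forall fun t => by simp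
    simpa using this.exp
  have := h1.unique h2
  simp only [id] at this
  rw [this]; ring

theorem integral_exp_gaussianReal (v : ℝ≥0) (c : ℝ) :
    ∫ x, Real.exp (c * x) ∂gaussianReal 0 v = Real.exp (v * c ^ 2 / 2) := by
  have := congrFun (mgf_id_gaussianReal (μ := 0) (v := v)) c
  simpa [mgf] using this

/-- The fourth moment of the standard normal law. -/
noncomputable def fourthMoment : ℝ := ∫ x, x ^ 4 ∂gaussianReal 0 1

theorem fourthMoment_nonneg : 0 ≤ fourthMoment := integral_nonneg fun x => by positivity

/-- Scaling by √v from the standard law. Only the order v² matters later; the value of the constant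
is never needed. -/
theorem integral_pow_four_gaussianReal (v : ℝ≥0) :
    ∫ x, x ^ 4 ∂gaussianReal 0 v = fourthMoment * v ^ 2 := by
  have h : (gaussianReal 0 1).map (fun x => Real.sqrt v * x) = gaussianReal 0 v := by
    rw [gaussianReal_map_const_mul]
    congr 1
    · simp
    · ext; simp
  rw [← h, integral_map (by fun_prop) (by fun_prop), fourthMoment, ← integral_mul_const]
  congr with x
  have : Real.sqrt v ^ 4 = (v : ℝ) ^ 2 := by
    rw [show 4 = 2 * 2 by norm_num, pow_mul, Real.sq_sqrt v.coe_nonneg]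
  rw [mul_pow, this]; ring

theorem integral_sq_gaussianReal (v : ℝ≥0) : ∫ x, x ^ 2 ∂gaussianReal 0 v = v := by
  have h := variance_fun_id_gaussianReal (μ := 0) (v := v)
  rw [variance_eq_integral (by fun_prop)] at h
  simpa using h

end GaussianMoments

theorem inner_increment {Ω : Type*} {d : ℕ} (B : ℝ → Ω → Space d) (s t : ℝ) (c : Space d)
    (ω : Ω) : inner ℝ c (B t ω - B s ω) = ∑ j, c j * (B t ω j - B s ω j) := by
  simp [PiLp.inner_apply, mul_comm]

/-! ### Independence and moments of Brownian increments -/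

namespace IsBrownianMotionOn

variable {Ω : Type*} [mΩ : MeasurableSpace Ω] {P : Measure Ω} {d : ℕ} {T : ℝ}
  {B : ℝ → Ω → Space d}

/-- Augmentation costs nothing: an event of the augmented σ-algebra agrees almost surely with one of
the raw past, and independence sees events only up to null sets. -/
theorem indep_increment (hB : IsBrownianMotionOn P T B) {s t : ℝ} (hs : 0 ≤ s) (hst : s ≤ t)
    (htT : t ≤ T) :
    Indep (MeasurableSpace.comap (fun ω => B t ω - B s ω) inferInstance)
      (brownianFiltration P T B s.toNNReal) P := by
  rw [Indep_iff]
  rintro A C hA ⟨⟨C', hC', hCC'⟩, -⟩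
  have hsT : min ((s.toNNReal : ℝ≥0) : ℝ) T = s := by
    rw [Real.coe_toNNReal s hs, min_eq_left (hst.trans htT)]
  rw [hsT] at hC'
  rw [measure_congr hCC', measure_congr ((ae_eq_refl A).inter hCC')]
  exact (Indep_iff _ _ _).1 (hB.indep s t hs hst htT) A C' hA hC'

theorem measurable_filtration (hB : IsBrownianMotionOn P T B) {s t : ℝ} (hs : 0 ≤ s)
    (hst : s ≤ t) (htT : t ≤ T) : Measurable[brownianFiltration P T B t.toNNReal] (B s) := by
  have hmin : min ((t.toNNReal : ℝ≥0) : ℝ) T = t := by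
    rw [Real.coe_toNNReal t (hs.trans hst), min_eq_left htT]
  rw [measurable_iff_comap_le]
  refine le_inf ?_ (hB.measurable s ⟨hs, hst.trans htT⟩).comap_le
  rw [hmin]
  refine le_trans ?_ le_eventuallyMeasurableSpace
  exact le_iSup₂_of_le s ⟨hs, hst⟩ le_rfl

theorem measurable_increment (hB : IsBrownianMotionOn P T B) {s t : ℝ} (hs : 0 ≤ s)
    (hst : s ≤ t) (htT : t ≤ T) : Measurable (fun ω => B t ω - B s ω) :=
  (hB.measurable t ⟨hs.trans hst, htT⟩).sub (hB.measurable s ⟨hs, hst.trans htT⟩)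

theorem hasLaw_coord (hB : IsBrownianMotionOn P T B) {s t : ℝ} (hs : 0 ≤ s)
    (hst : s ≤ t) (htT : t ≤ T) (i : Fin d) :
    HasLaw (fun ω => B t ω i - B s ω i) (gaussianReal 0 (t - s).toNNReal) P := by
  have h := hB.law s t hs hst htT
  have h2 := measurePreserving_eval (fun _ : Fin d => gaussianReal 0 (t - s).toNNReal) i
  refine ⟨(measurable_pi_apply i).comp_aemeasurable h.aemeasurable, ?_⟩
  rw [← h2.map_eq, ← h.map_eq, AEMeasurable.map_map_of_aemeasurable
    (measurable_pi_apply i).aemeasurable h.aemeasurable]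
  rfl

theorem memLp_coord (hB : IsBrownianMotionOn P T B) {s t : ℝ} (hs : 0 ≤ s)
    (hst : s ≤ t) (htT : t ≤ T) (i : Fin d) (p : ℝ≥0∞) (hp : p ≠ ∞) :
    MemLp (fun ω => B t ω i - B s ω i) p P := by
  have h := hB.hasLaw_coord hs hst htT i
  have h2 := memLp_id_gaussianReal' (μ := 0) (v := (t - s).toNNReal) p hp
  rw [← h.map_eq] at h2
  exact (memLp_map_measure_iff (by fun_prop) h.aemeasurable).1 h2

theorem integral_coord (hB : IsBrownianMotionOn P T B) {s t : ℝ} (hs : 0 ≤ s)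
    (hst : s ≤ t) (htT : t ≤ T) (i : Fin d) : ∫ ω, (B t ω i - B s ω i) ∂P = 0 := by
  have h := hB.hasLaw_coord hs hst htT i
  rw [h.integral_eq, integral_id_gaussianReal]

theorem integral_coord_pow_four (hB : IsBrownianMotionOn P T B) {s t : ℝ} (hs : 0 ≤ s)
    (hst : s ≤ t) (htT : t ≤ T) (i : Fin d) :
    ∫ ω, (B t ω i - B s ω i) ^ 4 ∂P = fourthMoment * (t - s) ^ 2 := by
  have h := (hB.hasLaw_coord hs hst htT i).integral_comp (f := fun x : ℝ => x ^ 4) (by fun_prop)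
  simp only [Function.comp_def] at h
  rw [h, integral_pow_four_gaussianReal, Real.coe_toNNReal _ (by linarith)]

theorem integral_coord_sq (hB : IsBrownianMotionOn P T B) {s t : ℝ} (hs : 0 ≤ s)
    (hst : s ≤ t) (htT : t ≤ T) (i : Fin d) :
    ∫ ω, (B t ω i - B s ω i) ^ 2 ∂P = t - s := by
  have h := (hB.hasLaw_coord hs hst htT i).integral_comp (f := fun x : ℝ => x ^ 2) (by fun_prop)
  simp only [Function.comp_def] at h
  rw [h, integral_sq_gaussianReal, Real.coe_toNNReal _ (by linarith)]

theorem integral_coord_mul (hB : IsBrownianMotionOn P T B) {s t : ℝ} (hs : 0 ≤ s)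
    (hst : s ≤ t) (htT : t ≤ T) (i j : Fin d) :
    ∫ ω, (B t ω j - B s ω j) * (B t ω i - B s ω i) ∂P = if j = i then t - s else 0 := by
  split_ifs with hij
  · subst hij
    rw [← hB.integral_coord_sq hs hst htT j]
    congr with ω; ring
  · have h := (hB.law s t hs hst htT).integral_comp (f := fun x : Fin d → ℝ => x j * x i)
      (by fun_prop)
    simp only [Function.comp_def] at h
    rw [h]
    have h2 := (iIndepFun_pi (μ := fun _ : Fin d => gaussianReal 0 (t - s).toNNReal)
      (X := fun _ x => x) (fun _ => by fun_prop)).indepFun hij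
    rw [h2.integral_fun_mul_eq_mul_integral (measurable_pi_apply j).aestronglyMeasurable
      (measurable_pi_apply i).aestronglyMeasurable]
    have h3 := (measurePreserving_eval (fun _ : Fin d => gaussianReal 0 (t - s).toNNReal) j)
    have h4 : ∫ x : Fin d → ℝ, x j ∂(Measure.pi fun _ => gaussianReal 0 (t - s).toNNReal) = 0 := by
      have := integral_map (μ := Measure.pi fun _ => gaussianReal 0 (t - s).toNNReal)
        (φ := Function.eval j) (f := fun x : ℝ => x) (measurable_pi_apply j).aemeasurable
        (by fun_prop)
      rw [h3.map_eq, integral_id_gaussianReal] at this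
      exact this.symm
    rw [h4, zero_mul]

theorem integrable_exp_inner (hB : IsBrownianMotionOn P T B) {s t : ℝ} (hs : 0 ≤ s)
    (hst : s ≤ t) (htT : t ≤ T) (c : Space d) :
    Integrable (fun ω => Real.exp (inner ℝ c (B t ω - B s ω))) P := by
  have h := hB.law s t hs hst htT
  have h2 : Integrable (fun x : Fin d → ℝ => ∏ j, Real.exp (c j * x j))
      (Measure.pi fun _ => gaussianReal 0 (t - s).toNNReal) :=
    Integrable.fintype_prod (f := fun j x => Real.exp (c j * x))
      fun j => integrable_exp_mul_gaussianReal (c j)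
  rw [← h.map_eq] at h2
  have h3 := h2.comp_aemeasurable h.aemeasurable
  refine h3.congr (ae_of_all _ fun ω => ?_)
  simp only [Function.comp_def, inner_increment, Real.exp_sum]

theorem integral_exp_inner (hB : IsBrownianMotionOn P T B) {s t : ℝ} (hs : 0 ≤ s)
    (hst : s ≤ t) (htT : t ≤ T) (c : Space d) :
    ∫ ω, Real.exp (inner ℝ c (B t ω - B s ω)) ∂P = Real.exp (‖c‖ ^ 2 * (t - s) / 2) := by
  have h := (hB.law s t hs hst htT).integral_comp
    (f := fun x : Fin d → ℝ => ∏ j, Real.exp (c j * x j))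
    (Measurable.aestronglyMeasurable (by fun_prop))
  simp only [Function.comp_def, integral_fintype_prod_eq_prod (fun j x => Real.exp (c j * x)),
    integral_exp_gaussianReal] at h
  simp only [inner_increment, Real.exp_sum]
  rw [h, ← Real.exp_sum, Real.coe_toNNReal _ (by linarith), EuclideanSpace.norm_sq_eq]
  congr 1
  simp only [Real.norm_eq_abs, sq_abs]
  rw [Finset.sum_mul, Finset.sum_div]
  exact Finset.sum_congr rfl fun j _ => by ring

theorem memLp_exp_inner (hB : IsBrownianMotionOn P T B) {s t : ℝ} (hs : 0 ≤ s)
    (hst : s ≤ t) (htT : t ≤ T) (c : Space d) :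
    MemLp (fun ω => Real.exp (inner ℝ c (B t ω - B s ω))) 2 P := by
  rw [memLp_two_iff_integrable_sq (hB.integrable_exp_inner hs hst htT c).1]
  refine (hB.integrable_exp_inner hs hst htT ((2 : ℝ) • c)).congr (ae_of_all _ fun ω => ?_)
  simp only [← Real.exp_nat_mul, inner_smul_left]
  simp

theorem integrable_coord_mul_exp_inner (hB : IsBrownianMotionOn P T B) {s t : ℝ} (hs : 0 ≤ s)
    (hst : s ≤ t) (htT : t ≤ T) (c : Space d) (i : Fin d) :
    Integrable (fun ω => (B t ω i - B s ω i) * Real.exp (inner ℝ c (B t ω - B s ω))) P :=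
  (hB.memLp_coord hs hst htT i 2 (by simp)).integrable_mul (hB.memLp_exp_inner hs hst htT c)

/-- Girsanov for a single Gaussian step: the weight exp(c·ξ) shifts the mean of ξ_i by c_i(t - s).
-/
theorem integral_coord_mul_exp_inner (hB : IsBrownianMotionOn P T B) {s t : ℝ} (hs : 0 ≤ s)
    (hst : s ≤ t) (htT : t ≤ T) (c : Space d) (i : Fin d) :
    ∫ ω, (B t ω i - B s ω i) * Real.exp (inner ℝ c (B t ω - B s ω)) ∂P
      = c i * (t - s) * Real.exp (‖c‖ ^ 2 * (t - s) / 2) := by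
  -- The factor x_i is absorbed into the i-th factor, so that the integral over the product measure
  -- splits.
  have key : ∀ x : Fin d → ℝ, x i * ∏ j, Real.exp (c j * x j)
      = ∏ j, (if j = i then x j * Real.exp (c j * x j) else Real.exp (c j * x j)) := by
    intro x
    have : ∀ j, (if j = i then x j * Real.exp (c j * x j) else Real.exp (c j * x j))
        = (if j = i then x j else 1) * Real.exp (c j * x j) := fun j => by split_ifs <;> simp
    simp only [this, Finset.prod_mul_distrib, Finset.prod_ite_eq', Finset.mem_univ, if_true]
  have h := (hB.law s t hs hst htT).integral_comp
    (f := fun x : Fin d → ℝ => x i * ∏ j, Real.exp (c j * x j)) (by fun_prop)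
  simp only [Function.comp_def, key, integral_fintype_prod_eq_prod
    (fun j (x : ℝ) => if j = i then x * Real.exp (c j * x) else Real.exp (c j * x))] at h
  have h2 : ∀ j, ∫ x, (if j = i then x * Real.exp (c j * x) else Real.exp (c j * x))
      ∂gaussianReal 0 (t - s).toNNReal
      = (if j = i then c j * (t - s) else 1) * Real.exp ((t - s) * c j ^ 2 / 2) := by
    intro j
    split_ifs
    · rw [integral_id_mul_exp_gaussianReal, Real.coe_toNNReal _ (by linarith)]
    · rw [integral_exp_gaussianReal, Real.coe_toNNReal _ (by linarith), one_mul]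
  simp only [h2, Finset.prod_mul_distrib, Finset.prod_ite_eq', Finset.mem_univ, if_true] at h
  simp only [← key] at h
  simp only [inner_increment, Real.exp_sum]
  rw [h, ← Real.exp_sum, EuclideanSpace.norm_sq_eq]
  congr 2
  simp only [Real.norm_eq_abs, sq_abs]
  rw [Finset.sum_mul, Finset.sum_div]
  exact Finset.sum_congr rfl fun j _ => by ring

end IsBrownianMotionOn

/-! ### L² tools and convergence of exponentials -/

section Auxiliary

variable {Ω : Type*} {mΩ : MeasurableSpace Ω} {P : Measure Ω}

theorem eLpNorm_two_eq_ofReal_sqrt {E : Type*} [NormedAddCommGroup E] {f : Ω → E}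
    (hf : MemLp f 2 P) : eLpNorm f 2 P = ENNReal.ofReal (√(∫ ω, ‖f ω‖ ^ 2 ∂P)) := by
  rw [hf.eLpNorm_eq_integral_rpow_norm (by simp) (by simp), Real.sqrt_eq_rpow]
  norm_num

theorem abs_integral_mul_le {f g : Ω → ℝ} (hf : MemLp f 2 P) (hg : MemLp g 2 P) :
    |∫ ω, f ω * g ω ∂P| ≤ √(∫ ω, f ω ^ 2 ∂P) * √(∫ ω, g ω ^ 2 ∂P) := by
  have h := integral_mul_norm_le_Lp_mul_Lq (μ := P) (f := f) (g := g) (p := 2) (q := 2)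
    (Real.holderConjugate_iff.2 ⟨by norm_num, by norm_num⟩) (by simpa using hf) (by simpa using hg)
  refine (abs_integral_le_integral_abs).trans ?_
  simp only [abs_mul]
  refine h.trans (le_of_eq ?_)
  rw [Real.sqrt_eq_rpow, Real.sqrt_eq_rpow]
  norm_num

theorem tendsto_integral_norm_sq {E : Type*} [NormedAddCommGroup E] {f : ℕ → Ω → E} {g : Ω → E}
    (hf : ∀ n, MemLp (f n) 2 P) (hg : MemLp g 2 P)
    (h : Tendsto (fun n => eLpNorm (fun ω => f n ω - g ω) 2 P) atTop (𝓝 0)) :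
    Tendsto (fun n => ∫ ω, ‖f n ω‖ ^ 2 ∂P) atTop (𝓝 (∫ ω, ‖g ω‖ ^ 2 ∂P)) := by
  have h1 := ((Lp.tendsto_Lp_iff_tendsto_eLpNorm'' f hf g hg).2 h).norm.pow 2
  have h2 : ∀ {f : Ω → E} (hf : MemLp f 2 P), ‖hf.toLp f‖ ^ 2 = ∫ ω, ‖f ω‖ ^ 2 ∂P := by
    intro f hf
    rw [Lp.norm_toLp, eLpNorm_two_eq_ofReal_sqrt hf, ENNReal.toReal_ofReal (Real.sqrt_nonneg _),
      Real.sq_sqrt (integral_nonneg fun _ => by positivity)]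
  simpa only [h2] using h1

theorem abs_exp_sub_exp_le (a b : ℝ) :
    |Real.exp a - Real.exp b| ≤ |a - b| * (Real.exp a + Real.exp b) := by
  wlog hab : b ≤ a generalizing a b
  · have := this b a (le_of_not_ge hab)
    rwa [abs_sub_comm, abs_sub_comm a b, add_comm (Real.exp a)]
  rw [abs_of_nonneg (sub_nonneg.2 (Real.exp_le_exp.2 hab)), abs_of_nonneg (sub_nonneg.2 hab)]
  have h1 : Real.exp b = Real.exp a * Real.exp (b - a) := by rw [← Real.exp_add]; ring_nf
  have h2 := Real.add_one_le_exp (b - a)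
  have h3 := Real.exp_pos a
  have h4 := Real.exp_pos b
  nlinarith [mul_nonneg (sub_nonneg.2 hab) h4.le]

/-- Fatou along an almost surely convergent subsequence. -/
theorem integrable_exp_four_of_tendsto [IsFiniteMeasure P] {J : ℕ → Ω → ℝ} {I : Ω → ℝ} {K : ℝ}
    (hJ : ∀ n, MemLp (J n) 2 P) (hI : AEStronglyMeasurable I P)
    (hJI : Tendsto (fun n => eLpNorm (fun ω => J n ω - I ω) 2 P) atTop (𝓝 0))
    (hint : ∀ n, Integrable (fun ω => Real.exp (4 * J n ω)) P)
    (hK : ∀ n, ∫ ω, Real.exp (4 * J n ω) ∂P ≤ K) :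
    Integrable (fun ω => Real.exp (4 * I ω)) P ∧ ∫ ω, Real.exp (4 * I ω) ∂P ≤ K := by
  obtain ⟨ns, -, hns⟩ := (tendstoInMeasure_of_tendsto_eLpNorm (by simp)
    (fun n => (hJ n).1) hI hJI).exists_seq_tendsto_ae
  have hae : ∀ᵐ ω ∂P, Tendsto (fun n => Real.exp (4 * J (ns n) ω)) atTop
      (𝓝 (Real.exp (4 * I ω))) := by
    filter_upwards [hns] with ω hω
    exact (Real.continuous_exp.tendsto _).comp (hω.const_mul 4)
  have hK0 : 0 ≤ K := (integral_nonneg fun _ => (Real.exp_pos _).le).trans (hK 0)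
  have hb := Lp.eLpNorm_le_of_ae_tendsto (p := 1) (C := ENNReal.ofReal K) (f := fun n ω =>
      Real.exp (4 * J (ns n) ω))
    (Eventually.of_forall fun n => by
      rw [eLpNorm_one_eq_lintegral_enorm, ← ofReal_integral_norm_eq_lintegral_enorm (hint (ns n))]
      refine ENNReal.ofReal_le_ofReal ?_
      simpa using hK (ns n)) (fun n => (hint (ns n)).1) hae
  have hm : AEStronglyMeasurable (fun ω => Real.exp (4 * I ω)) P :=
    Real.continuous_exp.comp_aestronglyMeasurable (hI.const_mul 4)
  have hi : Integrable (fun ω => Real.exp (4 * I ω)) P :=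
    memLp_one_iff_integrable.1 ⟨hm, hb.trans_lt ENNReal.ofReal_lt_top⟩
  refine ⟨hi, ?_⟩
  rw [eLpNorm_one_eq_lintegral_enorm, ← ofReal_integral_norm_eq_lintegral_enorm hi] at hb
  have := (ENNReal.ofReal_le_ofReal_iff hK0).1 hb
  simpa using this

/-- By |e^a - e^b| ≤ |a - b|(e^a + e^b) and Cauchy–Schwarz, the error is at most the L² distance of
J_n and I times the L² norm of (e^{J_n} + e^I)|g|, which the fourth moments control. -/
theorem tendsto_integral_exp_mul [IsFiniteMeasure P] {J : ℕ → Ω → ℝ} {I g : Ω → ℝ} {K : ℝ}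
    (hJ : ∀ n, MemLp (J n) 2 P) (hI : AEStronglyMeasurable I P)
    (hJI : Tendsto (fun n => eLpNorm (fun ω => J n ω - I ω) 2 P) atTop (𝓝 0))
    (hint : ∀ n, Integrable (fun ω => Real.exp (4 * J n ω)) P)
    (hK : ∀ n, ∫ ω, Real.exp (4 * J n ω) ∂P ≤ K)
    (hg : AEStronglyMeasurable g P) (hg4 : Integrable (fun ω => g ω ^ 4) P) :
    Tendsto (fun n => ∫ ω, Real.exp (J n ω) * g ω ∂P) atTop
      (𝓝 (∫ ω, Real.exp (I ω) * g ω ∂P)) := by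
  obtain ⟨hI4, hI4K⟩ := integrable_exp_four_of_tendsto hJ hI hJI hint hK
  have hpt : ∀ a g : ℝ, (Real.exp a * g) ^ 2 ≤ (Real.exp (4 * a) + g ^ 4) := by
    intro a g
    have : Real.exp (4 * a) = (Real.exp a ^ 2) ^ 2 := by
      rw [← pow_mul, ← Real.exp_nat_mul]; norm_num
    rw [this]
    nlinarith [sq_nonneg (Real.exp a ^ 2 - g ^ 2), sq_nonneg (Real.exp a * g)]
  have hmem : ∀ {J : Ω → ℝ}, AEStronglyMeasurable J P →
      Integrable (fun ω => Real.exp (4 * J ω)) P →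
      MemLp (fun ω => Real.exp (J ω) * g ω) 2 P := by
    intro J hJm hJi
    have hm : AEStronglyMeasurable (fun ω => Real.exp (J ω) * g ω) P :=
      (Real.continuous_exp.comp_aestronglyMeasurable hJm).mul hg
    rw [memLp_two_iff_integrable_sq hm]
    refine (hJi.add hg4).mono' (hm.pow 2) (ae_of_all _ fun ω => ?_)
    rw [Real.norm_eq_abs, abs_of_nonneg (sq_nonneg _)]
    exact hpt _ _
  -- This bounds the second moment of (e^{J_n} + e^I)|g|, by (x + y)² ≤ 2x² + 2y² and (e^a g)² ≤
  -- e^{4a} + g⁴.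
  set C : ℝ := 2 * (K + K) + 4 * ∫ ω, g ω ^ 4 ∂P
  have hlim : ∀ᶠ n in atTop, MemLp (fun ω => J n ω - I ω) 2 P := by
    filter_upwards [hJI.eventually_lt_const (u := 1) (by simp)] with n hn
    exact ⟨(hJ n).1.sub hI, hn.trans ENNReal.one_lt_top⟩
  have hIm : MemLp I 2 P := by
    obtain ⟨n, hn⟩ := hlim.exists
    have := (hJ n).sub hn
    refine this.ae_eq (ae_of_all _ fun ω => ?_)
    simp
  have hsq := tendsto_integral_norm_sq (f := fun n ω => J n ω - I ω) (g := fun _ => (0 : ℝ))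
    (fun n => (hJ n).sub hIm) MemLp.zero (by simpa using hJI)
  simp only [norm_zero, Real.norm_eq_abs, sq_abs] at hsq
  rw [tendsto_iff_norm_sub_tendsto_zero]
  have hbound : ∀ n, ‖∫ ω, Real.exp (J n ω) * g ω ∂P - ∫ ω, Real.exp (I ω) * g ω ∂P‖
      ≤ √(∫ ω, (J n ω - I ω) ^ 2 ∂P) * √C := by
    intro n
    have m1 := hmem (hJ n).1 (hint n)
    have m2 := hmem hI hI4
    have m3 : MemLp (fun ω => Real.exp (J n ω) * |g ω| + Real.exp (I ω) * |g ω|) 2 P := by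
      refine (m1.norm.add m2.norm).ae_eq (ae_of_all _ fun ω => ?_)
      simp
    have m4 := ((hJ n).sub hIm).norm
    rw [← integral_sub (m1.integrable (by norm_num)) (m2.integrable (by norm_num))]
    refine (norm_integral_le_integral_norm _).trans ?_
    have h1 := (le_abs_self _).trans (abs_integral_mul_le m4 m3)
    refine (integral_mono_of_nonneg (ae_of_all _ fun ω => norm_nonneg _)
      (m4.integrable_mul m3) (ae_of_all _ fun ω => ?_)).trans (h1.trans ?_)
    · simp only [Pi.sub_apply, Real.norm_eq_abs, Pi.mul_apply]
      rw [← sub_mul, abs_mul, ← add_mul, ← mul_assoc]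
      exact mul_le_mul_of_nonneg_right (abs_exp_sub_exp_le _ _) (abs_nonneg _)
    · simp only [Pi.sub_apply, Real.norm_eq_abs, sq_abs]
      gcongr
      have h3 : ∫ ω, (Real.exp (J n ω) * |g ω| + Real.exp (I ω) * |g ω|) ^ 2 ∂P
          ≤ ∫ ω, (2 * (Real.exp (4 * J n ω) + Real.exp (4 * I ω)) + 4 * g ω ^ 4) ∂P := by
        refine integral_mono_of_nonneg (ae_of_all _ fun ω => by positivity)
          ((((hint n).add hI4).const_mul 2).add (hg4.const_mul 4)) (ae_of_all _ fun ω => ?_)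
        have e1 := hpt (J n ω) |g ω|
        have e2 := hpt (I ω) |g ω|
        have e3 : |g ω| ^ 4 = g ω ^ 4 := by
          rw [show (4 : ℕ) = 2 * 2 by norm_num, pow_mul, sq_abs, pow_mul]
        rw [e3] at e1 e2
        simp only
        nlinarith [sq_nonneg (Real.exp (J n ω) * |g ω| - Real.exp (I ω) * |g ω|)]
      refine h3.trans ?_
      rw [integral_add (f := fun ω => 2 * (Real.exp (4 * J n ω) + Real.exp (4 * I ω)))
        (((hint n).add hI4).const_mul 2) (hg4.const_mul 4), integral_const_mul, integral_const_mul, integral_add (hint n) hI4]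
      simp only [C]
      gcongr
      exact hK n
  refine squeeze_zero (fun _ => norm_nonneg _) hbound ?_
  have := (hsq.sqrt).mul_const (√C)
  simpa using this

end Auxiliary

/-! ### Exponentials of sums of increments -/

namespace IsBrownianMotionOn

variable {Ω : Type*} [mΩ : MeasurableSpace Ω] {P : Measure Ω} {d : ℕ} {T : ℝ}
  {B : ℝ → Ω → Space d}

/-- The sum `∑ c k · (B_{p (k+1)} - B_{p k})` along an increasing sequence of times. -/
noncomputable def incrementSum (B : ℝ → Ω → Space d) (p : ℕ → ℝ) (c : ℕ → Space d) (N : ℕ)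
    (ω : Ω) : ℝ :=
  ∑ k ∈ Finset.range N, inner ℝ (c k) (B (p (k + 1)) ω - B (p k) ω)

theorem stronglyMeasurable_incrementSum (hB : IsBrownianMotionOn P T B) {p : ℕ → ℝ}
    (hp : Monotone p) (hp0 : 0 ≤ p 0) (c : ℕ → Space d) {N : ℕ} (hpN : p N ≤ T) :
    StronglyMeasurable[brownianFiltration P T B (p N).toNNReal] (incrementSum B p c N) := by
  refine Measurable.stronglyMeasurable ?_
  refine Finset.measurable_fun_sum _ fun k hk => ?_
  have hk' : k + 1 ≤ N := Finset.mem_range.1 hk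
  have m1 := hB.measurable_filtration (hp0.trans (hp (Nat.zero_le (k+1)))) (hp hk') hpN
  have m2 := hB.measurable_filtration (hp0.trans (hp (Nat.zero_le k)))
    (hp ((Nat.le_succ k).trans hk')) hpN
  exact (m1.sub m2).const_inner

/-- Peel off the last increment: it is independent of G and of all earlier increments. The times
need only be monotone, because the clamped partitions used below repeat points. -/
theorem integral_mul_exp_incrementSum (hB : IsBrownianMotionOn P T B) {p : ℕ → ℝ}
    (hp : Monotone p) (hp0 : 0 ≤ p 0) (c : ℕ → Space d) {N : ℕ} (hpN : p N ≤ T) {G : Ω → ℝ}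
    (hG : StronglyMeasurable[brownianFiltration P T B (p 0).toNNReal] G) (hGi : Integrable G P) :
    Integrable (fun ω => G ω * Real.exp (incrementSum B p c N ω)) P ∧
    ∫ ω, G ω * Real.exp (incrementSum B p c N ω) ∂P = (∫ ω, G ω ∂P) *
      Real.exp ((∑ k ∈ Finset.range N, ‖c k‖ ^ 2 * (p (k + 1) - p k)) / 2) := by
  induction N with
  | zero => simpa [incrementSum] using hGi
  | succ N ih =>
    have hle := hp (Nat.le_succ N)
    obtain ⟨ih1, ih2⟩ := ih (hle.trans hpN)
    have hpN0 := hp0.trans (hp (Nat.zero_le N))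
    have hm : StronglyMeasurable[brownianFiltration P T B (p N).toNNReal]
        (fun ω => G ω * Real.exp (incrementSum B p c N ω)) :=
      (hG.mono ((brownianFiltration P T B).mono (Real.toNNReal_le_toNNReal
        (hp (Nat.zero_le N))))).mul (Real.continuous_exp.comp_stronglyMeasurable
        (hB.stronglyMeasurable_incrementSum hp hp0 c (hle.trans hpN)))
    have hind := hB.indep_increment hpN0 hle hpN
    have hg : Measurable (fun x : Space d => Real.exp (inner ℝ (c N) x)) := by fun_prop
    have e : ∀ ω, G ω * Real.exp (incrementSum B p c (N + 1) ω)
        = (G ω * Real.exp (incrementSum B p c N ω)) *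
          Real.exp (inner ℝ (c N) (B (p (N + 1)) ω - B (p N) ω)) := by
      intro ω
      rw [incrementSum, Finset.sum_range_succ, Real.exp_add, mul_assoc]; rfl
    simp only [e]
    refine ⟨integrable_mul_of_indep_comap hind hm ih1 hg
      (hB.integrable_exp_inner hpN0 hle hpN (c N)), ?_⟩
    rw [integral_mul_of_indep_comap ((brownianFiltration P T B).le _)
      (hB.measurable_increment hpN0 hle hpN) hind hm hg, ih2, hB.integral_exp_inner hpN0 hle hpN,
      mul_assoc, ← Real.exp_add, Finset.sum_range_succ, add_div]

/-- Split the total increment at p N. The old part meets an independent exponential factor; the last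
increment picks up the Gaussian shift c_i Δ. Iterating gives the drift sum. -/
theorem integral_mul_exp_incrementSum_mul (hB : IsBrownianMotionOn P T B) {p : ℕ → ℝ}
    (hp : Monotone p) (hp0 : 0 ≤ p 0) (c : ℕ → Space d) {N : ℕ} (hpN : p N ≤ T) {G : Ω → ℝ}
    (hG : StronglyMeasurable[brownianFiltration P T B (p 0).toNNReal] G) (hGi : Integrable G P)
    (i : Fin d) :
    Integrable (fun ω => G ω * Real.exp (incrementSum B p c N ω) * (B (p N) ω i - B (p 0) ω i)) P ∧
    ∫ ω, G ω * Real.exp (incrementSum B p c N ω) * (B (p N) ω i - B (p 0) ω i) ∂P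
      = (∫ ω, G ω * Real.exp (incrementSum B p c N ω) ∂P) *
      ∑ k ∈ Finset.range N, c k i * (p (k + 1) - p k) := by
  induction N with
  | zero => simp
  | succ N ih =>
    have hle := hp (Nat.le_succ N)
    obtain ⟨ih1, ih2⟩ := ih (hle.trans hpN)
    have hpN0 := hp0.trans (hp (Nat.zero_le N))
    have hm1 : StronglyMeasurable[brownianFiltration P T B (p N).toNNReal]
        (fun ω => G ω * Real.exp (incrementSum B p c N ω)) :=
      (hG.mono ((brownianFiltration P T B).mono (Real.toNNReal_le_toNNReal
        (hp (Nat.zero_le N))))).mul (Real.continuous_exp.comp_stronglyMeasurable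
        (hB.stronglyMeasurable_incrementSum hp hp0 c (hle.trans hpN)))
    have hcoord : ∀ i : Fin d, Measurable fun x : Space d => x i := fun i => by fun_prop
    have hm2 : StronglyMeasurable[brownianFiltration P T B (p N).toNNReal]
        (fun ω => G ω * Real.exp (incrementSum B p c N ω) * (B (p N) ω i - B (p 0) ω i)) := by
      refine hm1.mul (Measurable.stronglyMeasurable ?_)
      exact ((hcoord i).comp (hB.measurable_filtration hpN0 le_rfl (hle.trans hpN))).sub
        ((hcoord i).comp (hB.measurable_filtration hp0 (hp (Nat.zero_le N)) (hle.trans hpN)))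
    obtain ⟨hi1, -⟩ := hB.integral_mul_exp_incrementSum hp hp0 c (hle.trans hpN) hG hGi
    obtain ⟨-, he⟩ := hB.integral_mul_exp_incrementSum hp hp0 c hpN hG hGi
    have hind := hB.indep_increment hpN0 hle hpN
    have hD := hB.measurable_increment hpN0 hle hpN
    have hg : Measurable (fun x : Space d => Real.exp (inner ℝ (c N) x)) := by fun_prop
    have hg2 : Measurable (fun x : Space d => x i * Real.exp (inner ℝ (c N) x)) := by fun_prop
    have e : ∀ ω, G ω * Real.exp (incrementSum B p c (N + 1) ω) * (B (p (N + 1)) ω i - B (p 0) ω i)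
        = (G ω * Real.exp (incrementSum B p c N ω) * (B (p N) ω i - B (p 0) ω i)) *
          Real.exp (inner ℝ (c N) (B (p (N + 1)) ω - B (p N) ω)) +
          (G ω * Real.exp (incrementSum B p c N ω)) * ((B (p (N + 1)) ω - B (p N) ω) i *
          Real.exp (inner ℝ (c N) (B (p (N + 1)) ω - B (p N) ω))) := by
      intro ω
      rw [incrementSum, Finset.sum_range_succ, Real.exp_add]
      simp only [PiLp.sub_apply, incrementSum]
      ring
    have j1 := integrable_mul_of_indep_comap hind hm2 ih1 hg
      (hB.integrable_exp_inner hpN0 hle hpN (c N))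
    have j2 := integrable_mul_of_indep_comap hind hm1 hi1 hg2
      (hB.integrable_coord_mul_exp_inner hpN0 hle hpN (c N) i)
    simp only [e]
    refine ⟨j1.add j2, ?_⟩
    rw [integral_add j1 j2, integral_mul_of_indep_comap ((brownianFiltration P T B).le _) hD hind
      hm2 hg, integral_mul_of_indep_comap ((brownianFiltration P T B).le _) hD hind hm1 hg2, ih2,
      hB.integral_exp_inner hpN0 hle hpN]
    have h3 := hB.integral_coord_mul_exp_inner hpN0 hle hpN (c N) i
    simp only [PiLp.sub_apply]
    rw [h3, he, (hB.integral_mul_exp_incrementSum hp hp0 c (hle.trans hpN) hG hGi).2,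
      Finset.sum_range_succ, Finset.sum_range_succ, add_div, Real.exp_add]
    ring

end IsBrownianMotionOn

/-! ### Partitions and step functions -/

theorem TimePartition.pt_nonneg {t : ℝ} (π : TimePartition t) (k : ℕ) : 0 ≤ π.pt k :=
  π.pt_zero ▸ π.mono (Nat.zero_le k)

theorem TimePartition.pt_le {t : ℝ} (π : TimePartition t) {k : ℕ} (hk : k ≤ π.N) : π.pt k ≤ t :=
  (π.mono hk).trans_eq π.pt_last

/-- The intervals (t_k, t_{k+1}] are disjoint, so at most one term is nonzero at each s. -/
theorem norm_stepFunction_sq {d : ℕ} {T : ℝ} (π : TimePartition T) (c : ℕ → Space d) (s : ℝ) :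
    ‖stepFunction π c s‖ ^ 2 = ∑ k ∈ Finset.range π.N,
      (Ioc (π.pt k) (π.pt (k + 1))).indicator (fun _ => ‖c k‖ ^ 2) s := by
  by_cases h : ∃ k ∈ Finset.range π.N, s ∈ Ioc (π.pt k) (π.pt (k + 1))
  · obtain ⟨k, hk, hs⟩ := h
    have hne : ∀ j, j ≠ k → s ∉ Ioc (π.pt j) (π.pt (j + 1)) := fun j hj hsj =>
      (Set.disjoint_left.1 (π.mono.pairwise_disjoint_on_Ioc_succ hj) hsj) hs
    rw [stepFunction, Finset.sum_eq_single_of_mem k hk, Finset.sum_eq_single_of_mem k hk,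
      indicator_of_mem hs, indicator_of_mem hs]
    · intro j _ hj; exact indicator_of_notMem (hne j hj) _
    · intro j _ hj; exact indicator_of_notMem (hne j hj) _
  · push Not at h
    rw [stepFunction, Finset.sum_eq_zero, Finset.sum_eq_zero]
    · simp
    · intro k hk; exact indicator_of_notMem (h k hk) _
    · intro k hk; exact indicator_of_notMem (h k hk) _

theorem memLp_stepFunction {d : ℕ} {T : ℝ} (π : TimePartition T) (c : ℕ → Space d) (p : ℝ≥0∞) :
    MemLp (stepFunction π c) p (timeMeasure T) := by
  unfold stepFunction
  exact memLp_finsetSum _ fun k _ => (memLp_const _).indicator measurableSet_Ioc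

theorem integral_indicator_Ioc {s t x y r : ℝ} (hst : s ≤ t) (hxy : x ≤ y) :
    ∫ u in s..t, (Ioc x y).indicator (fun _ => r) u
      = r * (max s (min t y) - max s (min t x)) := by
  rw [intervalIntegral.integral_of_le hst, setIntegral_indicator measurableSet_Ioc,
    setIntegral_const, Ioc_inter_Ioc, Measure.real, Real.volume_Ioc, ENNReal.toReal_ofReal',
    smul_eq_mul, mul_comm]
  congr 1
  rcases le_total s x with h1 | h1 <;> rcases le_total t x with h2 | h2 <;>
  rcases le_total s y with h3 | h3 <;> rcases le_total t y with h4 | h4 <;>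
  simp only [max_def, min_def] <;> split_ifs <;> linarith

theorem integral_norm_stepFunction_sq {d : ℕ} {T : ℝ} (hT : 0 ≤ T) (π : TimePartition T)
    (c : ℕ → Space d) :
    ∫ s in (0 : ℝ)..T, ‖stepFunction π c s‖ ^ 2
      = ∑ k ∈ Finset.range π.N, ‖c k‖ ^ 2 * (π.pt (k + 1) - π.pt k) := by
  simp only [norm_stepFunction_sq]
  rw [intervalIntegral.integral_finsetSum]
  · refine Finset.sum_congr rfl fun k hk => ?_
    have hk : k + 1 ≤ π.N := Finset.mem_range.1 hk
    rw [integral_indicator_Ioc hT (π.mono (Nat.le_succ k)), min_eq_right (π.pt_le hk),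
      min_eq_right (π.pt_le (Nat.le_of_succ_le hk)), max_eq_right (π.pt_nonneg _),
      max_eq_right (π.pt_nonneg _)]
  · intro k _
    rw [intervalIntegrable_iff, IntegrableOn, uIoc]
    exact (integrable_const _).indicator measurableSet_Ioc

theorem integral_stepFunction_coord {d : ℕ} {T : ℝ} (π : TimePartition T)
    (c : ℕ → Space d) {s t : ℝ} (hst : s ≤ t) (i : Fin d) :
    ∫ u in s..t, stepFunction π c u i
      = ∑ k ∈ Finset.range π.N, c k i *
        (max s (min t (π.pt (k + 1))) - max s (min t (π.pt k))) := by
  have : ∀ u, stepFunction π c u i = ∑ k ∈ Finset.range π.N,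
      (Ioc (π.pt k) (π.pt (k + 1))).indicator (fun _ => c k i) u := by
    intro u
    have : stepFunction π c u i = EuclideanSpace.proj (𝕜 := ℝ) i (stepFunction π c u) := rfl
    rw [this, stepFunction, map_sum]
    refine Finset.sum_congr rfl fun k _ => ?_
    by_cases h : u ∈ Ioc (π.pt k) (π.pt (k + 1)) <;> simp [h]
  simp only [this]
  rw [intervalIntegral.integral_finsetSum]
  · refine Finset.sum_congr rfl fun k hk => ?_
    rw [integral_indicator_Ioc hst (π.mono (Nat.le_succ k))]
  · intro k _
    rw [intervalIntegrable_iff, IntegrableOn, uIoc]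
    exact (integrable_const _).indicator measurableSet_Ioc

/-! ### Exponentials of step integrals and their Cameron–Martin formula -/

namespace IsBrownianMotionOn

variable {Ω : Type*} [mΩ : MeasurableSpace Ω] {P : Measure Ω} {d : ℕ} {T : ℝ}
  {B : ℝ → Ω → Space d}

/-- Clamping the partition points to [0,s], [s,t] and [t,T] separates past, present and future
without refining the partition or splitting into cases. -/
theorem stepIntegral_split {Ω : Type*} {d : ℕ} {T : ℝ} (B : ℝ → Ω → Space d)
    (π : TimePartition T) (c : ℕ → Space d) {s t : ℝ} (hs : 0 ≤ s) (hst : s ≤ t) (ω : Ω) :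
    stepIntegral π c B ω =
      incrementSum B (fun k => max 0 (min s (π.pt k))) c π.N ω +
      incrementSum B (fun k => max s (min t (π.pt k))) c π.N ω +
      incrementSum B (fun k => max t (min T (π.pt k))) c π.N ω := by
  simp only [stepIntegral, incrementSum]
  rw [← Finset.sum_add_distrib, ← Finset.sum_add_distrib]
  refine Finset.sum_congr rfl fun k hk => ?_
  rw [← inner_add_right, ← inner_add_right]
  congr 1
  -- One of the three clamped times is x, and the other two are the endpoints s and t facing it. The
  -- surplus B_s + B_t does not depend on x and drops out of increments.
  have key : ∀ x, 0 ≤ x → x ≤ T → B x ω = B (max 0 (min s x)) ω + B (max s (min t x)) ω +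
      B (max t (min T x)) ω - B s ω - B t ω := by
    intro x h0 hT
    rw [max_eq_right (le_min hs h0), min_eq_right hT]
    rcases le_total x s with h1 | h1
    · rw [min_eq_right h1, min_eq_right (h1.trans hst), max_eq_left h1,
        max_eq_left (h1.trans hst)]
      abel
    · rcases le_total x t with h2 | h2
      · rw [min_eq_left h1, min_eq_right h2, max_eq_right h1, max_eq_left h2]
        abel
      · rw [min_eq_left h1, min_eq_left h2, max_eq_right hst, max_eq_right h2]
        abel
  have hk : k + 1 ≤ π.N := Finset.mem_range.1 hk
  rw [key _ (π.pt_nonneg (k + 1)) (π.pt_le hk),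
    key _ (π.pt_nonneg k) (π.pt_le (Nat.le_of_succ_le hk))]
  abel

theorem integral_exp_stepIntegral (hB : IsBrownianMotionOn P T B) (hT : 0 ≤ T)
    [IsProbabilityMeasure P] (π : TimePartition T) (c : ℕ → Space d) :
    Integrable (fun ω => Real.exp (stepIntegral π c B ω)) P ∧
    ∫ ω, Real.exp (stepIntegral π c B ω) ∂P
      = Real.exp ((∫ s in (0 : ℝ)..T, ‖stepFunction π c s‖ ^ 2) / 2) := by
  have h := hB.integral_mul_exp_incrementSum π.mono (π.pt_nonneg 0) c (N := π.N) (π.pt_le le_rfl)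
    (G := fun _ => 1) stronglyMeasurable_const (integrable_const _)
  rw [integral_norm_stepFunction_sq hT]
  simpa [incrementSum, stepIntegral] using h

/-- The exponential moment formula for the coefficients 4c: the exponent is 4²/2 = 8 times the
squared norm. -/
theorem integral_exp_four_stepIntegral (hB : IsBrownianMotionOn P T B) (hT : 0 ≤ T)
    [IsProbabilityMeasure P] (π : TimePartition T) (c : ℕ → Space d) :
    Integrable (fun ω => Real.exp (4 * stepIntegral π c B ω)) P ∧
    ∫ ω, Real.exp (4 * stepIntegral π c B ω) ∂P
      = Real.exp (8 * ∫ s in (0 : ℝ)..T, ‖stepFunction π c s‖ ^ 2) := by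
  have h := hB.integral_exp_stepIntegral hT π (fun k => (4 : ℝ) • c k)
  have e1 : ∀ ω, stepIntegral π (fun k => (4 : ℝ) • c k) B ω = 4 * stepIntegral π c B ω := by
    intro ω
    simp only [stepIntegral, Finset.mul_sum, inner_smul_left]
    simp
  have e2 : ∀ s, ‖stepFunction π (fun k => (4 : ℝ) • c k) s‖ ^ 2
      = 16 * ‖stepFunction π c s‖ ^ 2 := by
    intro s
    rw [norm_stepFunction_sq, norm_stepFunction_sq, Finset.mul_sum]
    refine Finset.sum_congr rfl fun k _ => ?_
    by_cases h : s ∈ Ioc (π.pt k) (π.pt (k + 1))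
    · simp [h, norm_smul, mul_pow]; norm_num
    · simp [h]
  simp only [e1, e2] at h
  refine ⟨h.1, h.2.trans ?_⟩
  rw [intervalIntegral.integral_const_mul]
  congr 1; ring

/-- The past factor is absorbed into the weight, the present one produces the drift integral of the
step function over [s,t], and the future one contributes the same constant to both sides. -/
theorem integral_exp_stepIntegral_mul (hB : IsBrownianMotionOn P T B)
    [IsProbabilityMeasure P] (π : TimePartition T) (c : ℕ → Space d) {s t : ℝ} (hs : 0 ≤ s)
    (hst : s ≤ t) (htT : t ≤ T) {G : Ω → ℝ} {C : ℝ}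
    (hG : StronglyMeasurable[brownianFiltration P T B s.toNNReal] G) (hGC : ∀ ω, |G ω| ≤ C)
    (i : Fin d) :
    ∫ ω, Real.exp (stepIntegral π c B ω) * (G ω * (B t ω i - B s ω i)) ∂P
      = (∫ ω, Real.exp (stepIntegral π c B ω) * G ω ∂P) * ∫ u in s..t, stepFunction π c u i := by
  set p₁ : ℕ → ℝ := fun k => max 0 (min s (π.pt k)) with hp₁
  set p₂ : ℕ → ℝ := fun k => max s (min t (π.pt k)) with hp₂
  set p₃ : ℕ → ℝ := fun k => max t (min T (π.pt k)) with hp₃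
  have m₁ : Monotone p₁ := fun a b h => max_le_max le_rfl (min_le_min le_rfl (π.mono h))
  have m₂ : Monotone p₂ := fun a b h => max_le_max le_rfl (min_le_min le_rfl (π.mono h))
  have m₃ : Monotone p₃ := fun a b h => max_le_max le_rfl (min_le_min le_rfl (π.mono h))
  have a₁ : p₁ 0 = 0 := by simp [hp₁, π.pt_zero, hs]
  have z₁ : p₁ π.N = s := by simp [hp₁, π.pt_last, hs, hst.trans htT]
  have a₂ : p₂ 0 = s := by simp [hp₂, π.pt_zero, hs, hs.trans hst]
  have z₂ : p₂ π.N = t := by simp [hp₂, π.pt_last, hst, htT]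
  have a₃ : p₃ 0 = t := by simp [hp₃, π.pt_zero, hs.trans hst, hs.trans (hst.trans htT)]
  have z₃ : p₃ π.N = T := by simp [hp₃, π.pt_last, htT]
  have r₁ := hB.integral_mul_exp_incrementSum m₁ a₁.ge c (N := π.N)
    (z₁.le.trans (hst.trans htT)) (G := fun _ => 1) stronglyMeasurable_const (integrable_const _)
  have s₁ := hB.stronglyMeasurable_incrementSum m₁ a₁.ge c (N := π.N)
    (z₁.le.trans (hst.trans htT))
  rw [z₁] at s₁
  -- H is integrable and known at time s, so it can serve as the weight for the sums over [s,t]. It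
  -- need not be bounded.
  set H : Ω → ℝ := fun ω => G ω * Real.exp (incrementSum B p₁ c π.N ω) with hH
  have hHm : StronglyMeasurable[brownianFiltration P T B s.toNNReal] H :=
    hG.mul (Real.continuous_exp.comp_stronglyMeasurable s₁)
  have hHi : Integrable H P := by
    have := r₁.1
    simp only [one_mul] at this
    exact this.bdd_mul (hG.mono ((brownianFiltration P T B).le _)).aestronglyMeasurable
      (ae_of_all _ hGC)
  rw [← a₂] at hHm
  have i₂ := hB.integral_mul_exp_incrementSum m₂ (hs.trans a₂.ge) c (N := π.N) (z₂.le.trans htT)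
    hHm hHi
  have j₂ := hB.integral_mul_exp_incrementSum_mul m₂ (hs.trans a₂.ge) c (N := π.N)
    (z₂.le.trans htT) hHm hHi i
  have s₂ := hB.stronglyMeasurable_incrementSum m₂ (hs.trans a₂.ge) c (N := π.N)
    (z₂.le.trans htT)
  rw [z₂] at s₂
  rw [a₂, z₂] at j₂
  rw [a₂] at hHm
  have hH2 : StronglyMeasurable[brownianFiltration P T B t.toNNReal]
      (fun ω => H ω * Real.exp (incrementSum B p₂ c π.N ω)) :=
    (hHm.mono ((brownianFiltration P T B).mono (Real.toNNReal_le_toNNReal hst))).mul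
      (Real.continuous_exp.comp_stronglyMeasurable s₂)
  have hcoord : Measurable fun x : Space d => x i := by fun_prop
  have hH3 : StronglyMeasurable[brownianFiltration P T B t.toNNReal]
      (fun ω => H ω * Real.exp (incrementSum B p₂ c π.N ω) * (B t ω i - B s ω i)) :=
    hH2.mul (Measurable.stronglyMeasurable
      ((hcoord.comp (hB.measurable_filtration (hs.trans hst) le_rfl htT)).sub
        (hcoord.comp (hB.measurable_filtration hs hst htT))))
  have hH2' : StronglyMeasurable[brownianFiltration P T B (p₃ 0).toNNReal]
      (fun ω => H ω * Real.exp (incrementSum B p₂ c π.N ω)) := by rwa [a₃]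
  have hH3' : StronglyMeasurable[brownianFiltration P T B (p₃ 0).toNNReal]
      (fun ω => H ω * Real.exp (incrementSum B p₂ c π.N ω) * (B t ω i - B s ω i)) := by rwa [a₃]
  have i₃ := hB.integral_mul_exp_incrementSum m₃ ((hs.trans hst).trans a₃.ge) c (N := π.N) z₃.le
    hH2' i₂.1
  have j₃ := hB.integral_mul_exp_incrementSum m₃ ((hs.trans hst).trans a₃.ge) c (N := π.N) z₃.le
    hH3' j₂.1
  have e : ∀ ω, Real.exp (stepIntegral π c B ω) = Real.exp (incrementSum B p₁ c π.N ω) *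
      Real.exp (incrementSum B p₂ c π.N ω) * Real.exp (incrementSum B p₃ c π.N ω) := by
    intro ω
    rw [stepIntegral_split B π c hs hst, Real.exp_add, Real.exp_add]
  have e1 : ∫ ω, Real.exp (stepIntegral π c B ω) * (G ω * (B t ω i - B s ω i)) ∂P
      = ∫ ω, H ω * Real.exp (incrementSum B p₂ c π.N ω) * (B t ω i - B s ω i) *
        Real.exp (incrementSum B p₃ c π.N ω) ∂P := by
    congr with ω; rw [e]; simp only [hH]; ring
  have e2 : ∫ ω, Real.exp (stepIntegral π c B ω) * G ω ∂P
      = ∫ ω, H ω * Real.exp (incrementSum B p₂ c π.N ω) *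
        Real.exp (incrementSum B p₃ c π.N ω) ∂P := by
    congr with ω; rw [e]; simp only [hH]; ring
  rw [e1, e2, j₃.2, i₃.2, j₂.2, integral_stepFunction_coord π c hst]
  ring

theorem memLp_stepIntegral (hB : IsBrownianMotionOn P T B) (π : TimePartition T)
    (c : ℕ → Space d) : MemLp (stepIntegral π c B) 2 P := by
  unfold stepIntegral
  refine memLp_finsetSum _ fun k hk => ?_
  have hk : k + 1 ≤ π.N := Finset.mem_range.1 hk
  simp only [inner_increment]
  exact memLp_finsetSum _ fun i _ => (hB.memLp_coord (π.pt_nonneg k) (π.mono (Nat.le_succ k))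
    (π.pt_le hk) i 2 (by simp)).const_mul _

end IsBrownianMotionOn

/-! ### Stochastic exponentials of square integrable functions -/

namespace IsStochasticExponential

variable {Ω : Type*} [mΩ : MeasurableSpace Ω] {P : Measure Ω} [IsProbabilityMeasure P] {d : ℕ}
  {T : ℝ} {B : ℝ → Ω → Space d} {h : ℝ → Space d} {F : Ω → ℝ}

/-- `F` is a constant multiple of the exponential of an `L²`-limit of step integrals with bounded
exponential moments, along which step functions converge to `h`. -/
theorem exists_approximation (hF : IsStochasticExponential P T B h F) (hT : 0 ≤ T)
    (hB : IsBrownianMotionOn P T B) :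
    ∃ (I : Ω → ℝ) (π : ℕ → TimePartition T) (c : ℕ → ℕ → Space d) (K : ℝ),
      AEStronglyMeasurable I P ∧
      (F =ᵐ[P] fun ω => Real.exp (-(1 / 2 * ∫ s in (0 : ℝ)..T, ‖h s‖ ^ 2)) * Real.exp (I ω)) ∧
      Tendsto (fun n => eLpNorm (fun s => stepFunction (π n) (c n) s - h s) 2 (timeMeasure T))
        atTop (𝓝 0) ∧
      Tendsto (fun n => ∫ s in (0 : ℝ)..T, ‖stepFunction (π n) (c n) s‖ ^ 2) atTop
        (𝓝 (∫ s in (0 : ℝ)..T, ‖h s‖ ^ 2)) ∧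
      Tendsto (fun n => eLpNorm (fun ω => stepIntegral (π n) (c n) B ω - I ω) 2 P)
        atTop (𝓝 0) ∧
      ∀ n, ∫ ω, Real.exp (4 * stepIntegral (π n) (c n) B ω) ∂P ≤ K := by
  obtain ⟨hh, I, ⟨hI, π, c, hπ, hπI⟩, hFI⟩ := hF
  have hsq := tendsto_integral_norm_sq (fun n => memLp_stepFunction (π n) (c n) 2) hh hπ
  have e : ∀ f : ℝ → Space d, ∫ s, ‖f s‖ ^ 2 ∂timeMeasure T = ∫ s in (0 : ℝ)..T, ‖f s‖ ^ 2 := by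
    intro f
    rw [intervalIntegral.integral_of_le hT, timeMeasure, integral_Icc_eq_integral_Ioc]
  simp only [e] at hsq
  obtain ⟨M, hM⟩ := hsq.bddAbove_range
  -- A convergent sequence of squared norms is bounded by some M, and the fourth exponential moment
  -- is exp(8‖·‖²).
  refine ⟨I, π, c, Real.exp (8 * M), hI, ?_, hπ, hsq, hπI, fun n => ?_⟩
  · filter_upwards [hFI] with ω hω
    rw [hω, ← Real.exp_add]
    congr 1; ring
  · rw [(hB.integral_exp_four_stepIntegral hT (π n) (c n)).2]
    exact Real.exp_le_exp.2 (mul_le_mul_of_nonneg_left (hM (mem_range_self n)) (by norm_num))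

theorem memLp_two (hF : IsStochasticExponential P T B h F) (hT : 0 ≤ T)
    (hB : IsBrownianMotionOn P T B) : MemLp F 2 P := by
  obtain ⟨I, π, c, K, hI, hFI, -, -, hπI, hK⟩ := hF.exists_approximation hT hB
  have hi := (integrable_exp_four_of_tendsto (fun n => hB.memLp_stepIntegral (π n) (c n)) hI hπI
    (fun n => (hB.integral_exp_four_stepIntegral hT (π n) (c n)).1) hK).1
  rw [memLp_congr_ae hFI]
  refine MemLp.const_mul ?_ _
  have hm : AEStronglyMeasurable (fun ω => Real.exp (I ω)) P :=
    Real.continuous_exp.comp_aestronglyMeasurable hI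
  rw [memLp_two_iff_integrable_sq hm]
  refine (hi.add (integrable_const 1)).mono' (hm.pow 2) (ae_of_all _ fun ω => ?_)
  have : Real.exp (4 * I ω) = (Real.exp (I ω) ^ 2) ^ 2 := by
    rw [← pow_mul, ← Real.exp_nat_mul]; norm_num
  simp only [Pi.add_apply]
  rw [this, Real.norm_eq_abs, abs_of_nonneg (sq_nonneg _)]
  nlinarith [sq_nonneg (Real.exp (I ω) ^ 2 - 1)]

/-- The step integrals have exponential mean exp(½‖step‖²); in the limit this is exactly compensated
by the normalising factor of F. -/
theorem integral_eq_one (hF : IsStochasticExponential P T B h F) (hT : 0 ≤ T)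
    (hB : IsBrownianMotionOn P T B) : ∫ ω, F ω ∂P = 1 := by
  obtain ⟨I, π, c, K, hI, hFI, -, hsq, hπI, hK⟩ := hF.exists_approximation hT hB
  have h1 := tendsto_integral_exp_mul (fun n => hB.memLp_stepIntegral (π n) (c n)) hI hπI
    (fun n => (hB.integral_exp_four_stepIntegral hT (π n) (c n)).1) hK
    (g := fun _ => 1) aestronglyMeasurable_const (integrable_const _)
  simp only [mul_one, (hB.integral_exp_stepIntegral hT _ _).2] at h1
  have h2 := (Real.continuous_exp.tendsto _).comp (hsq.div_const 2)
  have h3 := tendsto_nhds_unique h1 h2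
  rw [integral_congr_ae hFI, integral_const_mul, h3, ← Real.exp_add]
  simp; ring

/-- The Cameron–Martin formula for one increment. -/
theorem integral_mul_increment (hF : IsStochasticExponential P T B h F) (hT : 0 ≤ T)
    (hB : IsBrownianMotionOn P T B) {s t : ℝ} (hs : 0 ≤ s)
    (hst : s ≤ t) (htT : t ≤ T) {G : Ω → ℝ} {C : ℝ}
    (hG : StronglyMeasurable[brownianFiltration P T B s.toNNReal] G) (hGC : ∀ ω, |G ω| ≤ C)
    (i : Fin d) :
    ∫ ω, F ω * (G ω * (B t ω i - B s ω i)) ∂P = (∫ ω, F ω * G ω ∂P) * ∫ u in s..t, h u i := by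
  obtain ⟨I, π, c, K, hI, hFI, hπ, -, hπI, hK⟩ := hF.exists_approximation hT hB
  have hGm := (hG.mono ((brownianFiltration P T B).le _)).aestronglyMeasurable (μ := P)
  have hD := hB.memLp_coord hs hst htT i 4 (by simp)
  have hGD4 : Integrable (fun ω => (G ω * (B t ω i - B s ω i)) ^ 4) P := by
    have h1 : Integrable (fun ω => (B t ω i - B s ω i) ^ 4) P := by
      have := hD.integrable_norm_pow (p := 4) (by norm_num)
      refine this.congr (ae_of_all _ fun ω => ?_)
      simp only [Real.norm_eq_abs]
      rw [show (4 : ℕ) = 2 * 2 by norm_num, pow_mul, sq_abs, pow_mul]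
    simp only [mul_pow]
    refine h1.bdd_mul (hGm.pow 4) (c := C ^ 4) (ae_of_all _ fun ω => ?_)
    simp only [norm_pow, Real.norm_eq_abs]
    exact pow_le_pow_left₀ (abs_nonneg _) (hGC ω) 4
  have l1 := tendsto_integral_exp_mul (fun n => hB.memLp_stepIntegral (π n) (c n)) hI hπI
    (fun n => (hB.integral_exp_four_stepIntegral hT (π n) (c n)).1) hK
    (g := fun ω => G ω * (B t ω i - B s ω i)) (hGm.mul hD.1) hGD4
  have l2 := tendsto_integral_exp_mul (fun n => hB.memLp_stepIntegral (π n) (c n)) hI hπI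
    (fun n => (hB.integral_exp_four_stepIntegral hT (π n) (c n)).1) hK (g := G) hGm
    ((integrable_const (C ^ 4)).mono' (hGm.pow 4) (ae_of_all _ fun ω => by
      simp only [norm_pow, Real.norm_eq_abs]
      exact pow_le_pow_left₀ (abs_nonneg _) (hGC ω) 4))
  -- On the finite interval [0,T], L² convergence implies L¹ convergence, hence convergence of the
  -- integral over [s,t].
  have l3 : Tendsto (fun n => ∫ u in s..t, stepFunction (π n) (c n) u i) atTop
      (𝓝 (∫ u in s..t, h u i)) := by
    have hL1 : Tendsto (fun n => eLpNorm
        ((fun u => stepFunction (π n) (c n) u i) - fun u => h u i) 1 (timeMeasure T))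
        atTop (𝓝 0) := by
      have hb : ∀ n, eLpNorm ((fun u => stepFunction (π n) (c n) u i) - fun u => h u i) 1
          (timeMeasure T) ≤ eLpNorm (fun s => stepFunction (π n) (c n) s - h s) 2 (timeMeasure T)
            * timeMeasure T univ ^ (1 / (1 : ℝ≥0∞).toReal - 1 / (2 : ℝ≥0∞).toReal) := by
        intro n
        have hm := ((memLp_stepFunction (π n) (c n) 2).sub hF.1).1
        refine le_trans (eLpNorm_mono fun u => ?_)
          (eLpNorm_le_eLpNorm_mul_rpow_measure_univ (by norm_num) hm)
        exact PiLp.norm_apply_le (stepFunction (π n) (c n) u - h u) i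
      refine tendsto_of_tendsto_of_tendsto_of_le_of_le tendsto_const_nhds ?_
        (fun _ => zero_le) hb
      have := ENNReal.Tendsto.mul_const hπ (b := timeMeasure T univ ^
        (1 / (1 : ℝ≥0∞).toReal - 1 / (2 : ℝ≥0∞).toReal))
        (Or.inr (ENNReal.rpow_ne_top_of_nonneg (by norm_num) (measure_ne_top _ _)))
      simpa using this
    have hproj : ∀ {f : ℝ → Space d} {p}, MemLp f p (timeMeasure T) →
        MemLp (fun u => f u i) p (timeMeasure T) := fun hf =>
      hf.mono ((EuclideanSpace.proj (𝕜 := ℝ) i).continuous.comp_aestronglyMeasurable hf.1)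
        (ae_of_all _ fun u => PiLp.norm_apply_le _ i)
    have := tendsto_setIntegral_of_L1' (μ := timeMeasure T) (fun u => h u i) (hproj hF.1).1
      (Eventually.of_forall fun n => memLp_one_iff_integrable.1
        (hproj (memLp_stepFunction (π n) (c n) 1))) hL1 (Ioc s t)
    simp only [timeMeasure, Measure.restrict_restrict measurableSet_Ioc] at this
    have hsub : Ioc s t ⊆ Icc 0 T := fun x hx => ⟨hs.trans hx.1.le, hx.2.trans htT⟩
    rw [inter_eq_left.2 hsub] at this
    simpa only [intervalIntegral.integral_of_le hst] using this
  have l4 := tendsto_nhds_unique l1 ((l2.mul l3).congr fun n =>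
    (hB.integral_exp_stepIntegral_mul (π n) (c n) hs hst htT hG hGC i).symm)
  have e : ∀ g : Ω → ℝ, ∫ ω, F ω * g ω ∂P =
      Real.exp (-(1 / 2 * ∫ s in (0 : ℝ)..T, ‖h s‖ ^ 2)) * ∫ ω, Real.exp (I ω) * g ω ∂P := by
    intro g
    rw [← integral_const_mul]
    refine integral_congr_ae ?_
    filter_upwards [hFI] with ω hω
    rw [hω, mul_assoc]
  rw [e, e G, l4, mul_assoc]

end IsStochasticExponential

/-! ### Convergence in probability through the Ky Fan metric -/

section SmallInProbability

variable {Ω : Type*} {mΩ : MeasurableSpace Ω} {P : Measure Ω} [IsFiniteMeasure P]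

/-- The random variable `f` has distance at most `ε` to `0` in the Ky Fan metric. -/
def SmallInProb (P : Measure Ω) (ε : ℝ) (f : Ω → ℝ) : Prop := P.real {ω | ε < |f ω|} ≤ ε

theorem SmallInProb.mono {ε δ : ℝ} {f : Ω → ℝ} (hf : SmallInProb P ε f) (h : ε ≤ δ) :
    SmallInProb P δ f :=
  (measureReal_mono fun _ hω => h.trans_lt hω).trans (le_trans hf h)

theorem SmallInProb.add {ε δ : ℝ} {f g : Ω → ℝ} (hf : SmallInProb P ε f)
    (hg : SmallInProb P δ g) : SmallInProb P (ε + δ) (fun ω => f ω + g ω) := by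
  refine (measureReal_mono (s₂ := {ω | ε < |f ω|} ∪ {ω | δ < |g ω|}) fun ω hω => ?_).trans
    ((measureReal_union_le _ _).trans (add_le_add hf hg))
  by_contra hcon
  simp only [mem_union, mem_ofPred_eq, not_or, not_lt] at hcon hω
  linarith [abs_add_le (f ω) (g ω)]

theorem SmallInProb.of_abs_le {ε : ℝ} {f g : Ω → ℝ} (hg : SmallInProb P ε g)
    (h : ∀ᵐ ω ∂P, |f ω| ≤ |g ω|) : SmallInProb P ε f := by
  refine le_trans ?_ hg
  refine ENNReal.toReal_mono (measure_ne_top _ _) (measure_mono_ae ?_)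
  filter_upwards [h] with ω hω h'
  exact lt_of_lt_of_le h' hω

theorem SmallInProb.congr {ε : ℝ} {f g : Ω → ℝ} (hg : SmallInProb P ε g)
    (h : f =ᵐ[P] g) : SmallInProb P ε f :=
  hg.of_abs_le (h.mono fun _ hω => by rw [hω])

theorem SmallInProb.sum {ι : Type*} {s : Finset ι} {ε : ℝ} {f : ι → Ω → ℝ}
    (hf : ∀ i ∈ s, SmallInProb P ε (f i)) :
    SmallInProb P (s.card * ε) (fun ω => ∑ i ∈ s, f i ω) := by
  classical
  induction s using Finset.induction_on with
  | empty => simp [SmallInProb]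
  | insert i s hi ih =>
    have h1 := (hf i (Finset.mem_insert_self i s)).add
      (ih fun j hj => hf j (Finset.mem_insert_of_mem hj))
    simp only [Finset.sum_insert hi]
    refine h1.mono (le_of_eq ?_)
    rw [Finset.card_insert_of_notMem hi]; push_cast; ring

theorem SmallInProb.mul {ε δ K : ℝ} {f g : Ω → ℝ} (hf : P.real {ω | K < |f ω|} ≤ ε)
    (hg : SmallInProb P δ g) (hK : 0 ≤ K) (hδ : δ ≤ ε) (hKδ : K * δ ≤ ε) :
    SmallInProb P (ε + ε) (fun ω => f ω * g ω) := by
  refine (measureReal_mono (s₂ := {ω | K < |f ω|} ∪ {ω | δ < |g ω|}) fun ω hω => ?_).trans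
    ((measureReal_union_le _ _).trans (add_le_add hf (le_trans hg hδ)))
  by_contra hcon
  simp only [mem_union, mem_ofPred_eq, not_or, not_lt, abs_mul] at hcon hω
  have := mul_le_mul hcon.1 hcon.2 (abs_nonneg _) hK
  have : 0 ≤ ε := le_trans measureReal_nonneg hf
  linarith

/-- A single ε measures both the size of the error and the probability of exceeding it, so error
budgets simply add. -/
theorem tendstoInMeasure_iff_small {f : ℕ → Ω → ℝ} {g : Ω → ℝ} :
    TendstoInMeasure P f atTop g ↔
      ∀ ε > 0, ∀ᶠ n in atTop, SmallInProb P ε (fun ω => f n ω - g ω) := by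
  rw [tendstoInMeasure_iff_measureReal_norm]
  simp only [Real.norm_eq_abs]
  constructor
  · intro h ε hε
    filter_upwards [(h ε hε).eventually_lt_const hε] with n hn
    refine (measureReal_mono (s₂ := {ω | ε ≤ |f n ω - g ω|}) fun ω hω => ?_).trans hn.le
    simp only [mem_ofPred_eq] at hω ⊢
    exact hω.le
  · intro h ε hε
    rw [Metric.tendsto_atTop]
    intro δ hδ
    obtain ⟨N, hN⟩ := eventually_atTop.1 (h (min (ε / 2) (δ / 2)) (by positivity))
    refine ⟨N, fun n hn => ?_⟩
    rw [Real.dist_0_eq_abs, abs_of_nonneg measureReal_nonneg]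
    refine lt_of_le_of_lt ((measureReal_mono fun ω hω => ?_).trans (hN n hn))
      ((min_le_right _ _).trans_lt (by linarith))
    have h1 : ε ≤ |f n ω - g ω| := hω
    exact ((min_le_left _ _).trans_lt (by linarith : ε / 2 < ε)).trans_le h1

theorem measureReal_lt_le_of_integral_le {g : Ω → ℝ} {c K : ℝ} (hg0 : ∀ ω, 0 ≤ g ω)
    (hgi : Integrable g P) (hc : ∫ ω, g ω ∂P ≤ c) (hK : 0 < K) :
    P.real {ω | K < g ω} ≤ c / K := by
  rw [le_div_iff₀ hK, mul_comm]
  refine le_trans ?_ ((mul_meas_ge_le_integral_of_nonneg (ae_of_all _ hg0) hgi K).trans hc)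
  refine mul_le_mul_of_nonneg_left (measureReal_mono fun ω hω => ?_) hK.le
  simp only [mem_ofPred_eq] at hω ⊢
  exact hω.le

/-- Chebyshev: ε³/ε² = ε. -/
theorem small_of_integral_sq_le {f : Ω → ℝ} {ε : ℝ} (hε : 0 < ε) (hf : MemLp f 2 P)
    (h : ∫ ω, f ω ^ 2 ∂P ≤ ε ^ 3) : SmallInProb P ε f := by
  have h1 := measureReal_lt_le_of_integral_le (fun ω => sq_nonneg (f ω)) hf.integrable_sq h
    (K := ε ^ 2) (by positivity)
  rw [show ε ^ 3 / ε ^ 2 = ε by field_simp] at h1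
  refine le_trans (measureReal_mono fun ω hω => ?_) h1
  have h2 : ε < |f ω| := hω
  have := pow_lt_pow_left₀ h2 hε.le (two_ne_zero)
  rwa [sq_abs] at this

/-- The events that some f_i exceeds n decrease to a null event. Countability of the index makes
them measurable. -/
theorem exists_bound_of_countable {ι : Type*} [Countable ι] {f : ι → Ω → ℝ}
    (hf : ∀ i, Measurable (f i)) (hb : ∀ᵐ ω ∂P, BddAbove (range fun i => f i ω)) {ε : ℝ}
    (hε : 0 < ε) : ∃ K > 0, P.real {ω | ∃ i, K < f i ω} ≤ ε := by
  have hm : ∀ n : ℕ, MeasurableSet {ω | ∃ i, (n : ℝ) < f i ω} := fun n => by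
    simp only [ofPred_exists]
    exact MeasurableSet.iUnion fun i => measurableSet_lt measurable_const (hf i)
  have hanti : Antitone fun n : ℕ => {ω | ∃ i, (n : ℝ) < f i ω} := by
    rintro a b hab ω ⟨i, hi⟩
    exact ⟨i, (Nat.cast_le.2 hab).trans_lt hi⟩
  have h0 : P (⋂ n : ℕ, {ω | ∃ i, (n : ℝ) < f i ω}) = 0 := by
    refine measure_mono_null ?_ hb
    rintro ω hω ⟨M, hM⟩
    obtain ⟨n, hn⟩ := exists_nat_gt M
    obtain ⟨i, hi⟩ := mem_iInter.1 hω n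
    exact absurd (hM (mem_range_self i)) (not_le.2 (hn.trans hi))
  have ht := tendsto_measure_iInter_atTop (μ := P) (fun n => (hm n).nullMeasurableSet) hanti
    ⟨0, measure_ne_top _ _⟩
  rw [h0] at ht
  have ht2 := (ENNReal.tendsto_toReal ENNReal.zero_ne_top).comp ht
  obtain ⟨n, hn⟩ := ((ht2.eventually_lt_const (u := ε) (by simpa using hε)).and
    (eventually_gt_atTop 0)).exists
  exact ⟨n, Nat.cast_pos.2 hn.2, hn.1.le⟩

theorem exists_bound_single {f : Ω → ℝ} (hf : Measurable f) {ε : ℝ}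
    (hε : 0 < ε) : ∃ K > 0, P.real {ω | K < |f ω|} ≤ ε := by
  obtain ⟨K, hK, h⟩ := exists_bound_of_countable (P := P) (f := fun (_ : Unit) ω => |f ω|)
    (fun _ => hf.abs) (ae_of_all _ fun ω => (finite_range _).bddAbove) hε
  exact ⟨K, hK, by simpa using h⟩

end SmallInProbability

/-! ### Orthogonality of independent centred innovations -/

section Orthogonality

variable {Ω : Type*} {mΩ : MeasurableSpace Ω} {P : Measure Ω}

/-- Discrete Itô isometry: the cross terms vanish because ξ_N is centred and independent of
everything known at time N, and the diagonal terms factor for the same reason. -/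
theorem integral_sum_mul_sq (ℱ : Filtration ℕ mΩ) {a ξ : ℕ → Ω → ℝ} {N : ℕ}
    (ha : ∀ k < N, StronglyMeasurable[ℱ k] (a k)) (ha2 : ∀ k < N, MemLp (a k) 2 P)
    (hξ : ∀ k < N, StronglyMeasurable[ℱ (k + 1)] (ξ k)) (hξ2 : ∀ k < N, MemLp (ξ k) 2 P)
    (hξ0 : ∀ k < N, ∫ ω, ξ k ω ∂P = 0)
    (hind : ∀ k < N, Indep (MeasurableSpace.comap (ξ k) inferInstance) (ℱ k) P) :
    StronglyMeasurable[ℱ N] (fun ω => ∑ k ∈ Finset.range N, a k ω * ξ k ω) ∧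
    MemLp (fun ω => ∑ k ∈ Finset.range N, a k ω * ξ k ω) 2 P ∧
    ∫ ω, (∑ k ∈ Finset.range N, a k ω * ξ k ω) ^ 2 ∂P
      = ∑ k ∈ Finset.range N, (∫ ω, a k ω ^ 2 ∂P) * ∫ ω, ξ k ω ^ 2 ∂P := by
  induction N with
  | zero => simp [stronglyMeasurable_const]
  | succ N ih =>
    obtain ⟨i1, i2, i3⟩ := ih (fun k hk => ha k (hk.trans N.lt_succ_self))
      (fun k hk => ha2 k (hk.trans N.lt_succ_self)) (fun k hk => hξ k (hk.trans N.lt_succ_self))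
      (fun k hk => hξ2 k (hk.trans N.lt_succ_self)) (fun k hk => hξ0 k (hk.trans N.lt_succ_self))
      (fun k hk => hind k (hk.trans N.lt_succ_self))
    have hN := N.lt_succ_self
    have haN := ha N hN
    have hξm : Measurable[mΩ] (ξ N) := ((hξ N hN).mono (ℱ.le _)).measurable
    have e2 : ∀ G : Ω → ℝ, StronglyMeasurable[ℱ N] G → ∫ ω, G ω * ξ N ω ^ 2 ∂P
        = (∫ ω, G ω ∂P) * ∫ ω, ξ N ω ^ 2 ∂P := fun G hG =>
      integral_mul_of_indep_comap (ℱ.le N) hξm (hind N hN) hG (g := fun x : ℝ => x ^ 2)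
        (by fun_prop)
    have e1 : ∀ G : Ω → ℝ, StronglyMeasurable[ℱ N] G → ∫ ω, G ω * ξ N ω ∂P = 0 := fun G hG => by
      have := integral_mul_of_indep_comap (ℱ.le N) hξm (hind N hN) hG (g := fun x : ℝ => x)
        (by fun_prop)
      rw [this, hξ0 N hN, mul_zero]
    have hsqi : Integrable (fun ω => a N ω ^ 2 * ξ N ω ^ 2) P :=
      integrable_mul_of_indep_comap (hind N hN) (haN.pow 2) (ha2 N hN).integrable_sq
        (g := fun x : ℝ => x ^ 2) (by fun_prop) (hξ2 N hN).integrable_sq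
    have hprod : MemLp (fun ω => a N ω * ξ N ω) 2 P := by
      rw [memLp_two_iff_integrable_sq (f := fun ω => a N ω * ξ N ω)
        ((ha2 N hN).1.mul (hξ2 N hN).1)]
      exact hsqi.congr (ae_of_all _ fun ω => by simp [mul_pow])
    simp only [Finset.sum_range_succ]
    refine ⟨(i1.mono (ℱ.mono N.le_succ)).add ((haN.mono (ℱ.mono N.le_succ)).mul (hξ N hN)),
      i2.add hprod, ?_⟩
    have hcross : Integrable (fun ω => (∑ k ∈ Finset.range N, a k ω * ξ k ω) *
        (a N ω * ξ N ω)) P := i2.integrable_mul hprod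
    have hsum : Integrable (fun ω => (∑ k ∈ Finset.range N, a k ω * ξ k ω) ^ 2 +
        2 * ((∑ k ∈ Finset.range N, a k ω * ξ k ω) * (a N ω * ξ N ω))) P :=
      i2.integrable_sq.add (hcross.const_mul 2)
    have e : ∀ ω, (∑ k ∈ Finset.range N, a k ω * ξ k ω + a N ω * ξ N ω) ^ 2 =
        (∑ k ∈ Finset.range N, a k ω * ξ k ω) ^ 2 +
        2 * ((∑ k ∈ Finset.range N, a k ω * ξ k ω) * (a N ω * ξ N ω)) +
        a N ω ^ 2 * ξ N ω ^ 2 := fun ω => by ring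
    simp only [e]
    rw [integral_add hsum hsqi,
      integral_add i2.integrable_sq (hcross.const_mul 2), integral_const_mul, i3,
      e2 (fun ω => a N ω ^ 2) (haN.pow 2)]
    have h0 : ∫ ω, (∑ k ∈ Finset.range N, a k ω * ξ k ω) * (a N ω * ξ N ω) ∂P = 0 := by
      simp only [← mul_assoc]
      exact e1 _ (i1.mul haN)
    rw [h0]; simp

end Orthogonality

/-! ### Products of sums over blocks of a grid -/

section Blocks

/-- Splitting a product of block sums by the order of the two indices. -/
theorem sum_mul_sum_eq (f g : ℕ → ℝ) (a m : ℕ) :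
    (∑ r ∈ Finset.range m, f (a + r)) * (∑ r ∈ Finset.range m, g (a + r)) =
      ∑ r ∈ Finset.range m, (f (a + r) * g (a + r) +
        f (a + r) * (∑ l ∈ Finset.range r, g (a + l)) +
        (∑ l ∈ Finset.range r, f (a + l)) * g (a + r)) := by
  induction m with
  | zero => simp
  | succ m ih =>
    rw [Finset.sum_range_succ, Finset.sum_range_succ, Finset.sum_range_succ, ← ih]
    ring

theorem sum_range_mul_eq (F : ℕ → ℝ) (n m : ℕ) :
    ∑ q ∈ Finset.range (n * m), F q
      = ∑ k ∈ Finset.range n, ∑ r ∈ Finset.range m, F (k * m + r) := by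
  induction n with
  | zero => simp
  | succ n ih =>
    rw [Finset.sum_range_succ, ← ih, Nat.succ_mul, Finset.sum_range_add]

/-- The block containing q starts at `q / m * m`, and q has position `q % m` in it. Each
off-diagonal term pairs the value at q with the partial sum over its block strictly before q; this
is what makes it an Itô sum. -/
theorem sum_block_mul_block (f g : ℕ → ℝ) (n m : ℕ) :
    ∑ k ∈ Finset.range n, (∑ r ∈ Finset.range m, f (k * m + r)) *
        (∑ r ∈ Finset.range m, g (k * m + r)) =
      ∑ q ∈ Finset.range (n * m), f q * g q +
      ∑ q ∈ Finset.range (n * m), f q * (∑ l ∈ Finset.range (q % m), g (q / m * m + l)) +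
      ∑ q ∈ Finset.range (n * m), (∑ l ∈ Finset.range (q % m), f (q / m * m + l)) * g q := by
  rw [← Finset.sum_add_distrib, ← Finset.sum_add_distrib, sum_range_mul_eq]
  refine Finset.sum_congr rfl fun k _ => ?_
  rw [sum_mul_sum_eq]
  refine Finset.sum_congr rfl fun r hr => ?_
  have hr := Finset.mem_range.1 hr
  have h1 : (k * m + r) % m = r := by
    rw [mul_comm, Nat.mul_add_mod, Nat.mod_eq_of_lt hr]
  have h2 : (k * m + r) / m = k := by
    rw [mul_comm, Nat.mul_add_div (by omega), Nat.div_eq_of_lt hr, add_zero]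
  rw [h1, h2]

end Blocks

/-- The `q`-th point of the uniform grid of `[0,t]` with `N` steps. -/
noncomputable def gridPt (t : ℝ) (N q : ℕ) : ℝ := q * (t / N)

/-! ### Uniform grids -/

section Grid

variable {t : ℝ}

theorem gridPt_mono (ht : 0 ≤ t) (N : ℕ) : Monotone (gridPt t N) := fun a b hab =>
  mul_le_mul_of_nonneg_right (Nat.cast_le.2 hab) (by positivity)

theorem gridPt_zero (N : ℕ) : gridPt t N 0 = 0 := by simp [gridPt]

theorem gridPt_nonneg (ht : 0 ≤ t) (N q : ℕ) : 0 ≤ gridPt t N q := by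
  unfold gridPt; positivity

theorem gridPt_last {N : ℕ} (hN : 0 < N) : gridPt t N N = t := by
  have : (N : ℝ) ≠ 0 := by positivity
  unfold gridPt; field_simp

theorem gridPt_le (ht : 0 ≤ t) {N q : ℕ} (hq : q ≤ N) : gridPt t N q ≤ t := by
  rcases Nat.eq_zero_or_pos N with rfl | hN
  · simpa [gridPt] using ht
  · exact (gridPt_mono ht N hq).trans_eq (gridPt_last hN)

theorem gridPt_succ_sub (N q : ℕ) : gridPt t N (q + 1) - gridPt t N q = t / N := by
  unfold gridPt; push_cast; ring

theorem gridPt_mul (n k : ℕ) {m : ℕ} (hm : 0 < m) : gridPt t (n * m) (k * m) = gridPt t n k := by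
  have : (m : ℝ) ≠ 0 := by positivity
  unfold gridPt
  rcases Nat.eq_zero_or_pos n with rfl | hn
  · simp
  · have : (n : ℝ) ≠ 0 := by positivity
    push_cast; field_simp

end Grid

/-! ### Truncated quadratic variation of a martingale -/

section Martingale

variable {Ω : Type*} {mΩ : MeasurableSpace Ω} {P : Measure Ω} [IsProbabilityMeasure P]

/-- Truncation to `[-l, l]`. -/
noncomputable def truncate (l x : ℝ) : ℝ := max (-l) (min l x)

theorem continuous_truncate (l : ℝ) : Continuous (truncate l) := by unfold truncate; fun_prop

theorem abs_truncate_le {l : ℝ} (hl : 0 ≤ l) (x : ℝ) : |truncate l x| ≤ l :=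
  abs_le.2 ⟨le_max_left _ _, max_le (by linarith) (min_le_left _ _)⟩

theorem truncate_eq_self {l x : ℝ} (h : |x| ≤ l) : truncate l x = x := by
  rw [truncate, min_eq_right (abs_le.1 h).2, max_eq_right (abs_le.1 h).1]

/-- The Huber function, equal to `x²` on `[-l, l]` and of linear growth outside. -/
noncomputable def huber (l x : ℝ) : ℝ := 2 * truncate l x * x - truncate l x ^ 2

theorem huber_nonneg {l : ℝ} (hl : 0 ≤ l) (x : ℝ) : 0 ≤ huber l x := by
  unfold huber truncate
  rcases le_total l x with h | h
  · rw [min_eq_left h, max_eq_right (by linarith)]; nlinarith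
  · rw [min_eq_right h]
    rcases le_total (-l) x with h' | h'
    · rw [max_eq_right h']; nlinarith
    · rw [max_eq_left h']; nlinarith

theorem huber_le {l : ℝ} (hl : 0 ≤ l) (x : ℝ) : huber l x ≤ 2 * l * |x| := by
  have h1 : truncate l x * x ≤ l * |x| := by
    refine (le_abs_self _).trans ?_
    rw [abs_mul]
    exact mul_le_mul_of_nonneg_right (abs_truncate_le hl x) (abs_nonneg _)
  unfold huber
  nlinarith [sq_nonneg (truncate l x)]

/-- The Huber function is convex with derivative twice the truncation, so its gap above the tangent
line is nonnegative. For arguments in [-l, l] the gap is the squared increment. It thus replaces the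
square for martingales that are only integrable. -/
theorem huber_convex {l : ℝ} (hl : 0 ≤ l) (x y : ℝ) :
    0 ≤ huber l y - huber l x - 2 * truncate l x * (y - x) := by
  have hx := abs_le.1 (abs_truncate_le hl x)
  unfold huber
  generalize truncate l x = c at *
  unfold truncate
  rcases le_total l y with h | h
  · rw [min_eq_left h, max_eq_right (by linarith)]; nlinarith [sq_nonneg (l - c)]
  · rw [min_eq_right h]
    rcases le_total (-l) y with h' | h'
    · rw [max_eq_right h']; nlinarith [sq_nonneg (y - c)]
    · rw [max_eq_left h']; nlinarith [sq_nonneg (-l - c)]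

theorem huber_remainder {l x y : ℝ} (hx : |x| ≤ l) (hy : |y| ≤ l) :
    huber l y - huber l x - 2 * truncate l x * (y - x) = (y - x) ^ 2 := by
  unfold huber
  rw [truncate_eq_self hx, truncate_eq_self hy]; ring

theorem integral_mul_martingale {ι : Type*} [Preorder ι] {ℱ : Filtration ι mΩ} {N : ι → Ω → ℝ}
    (hN : Martingale N ℱ P) {s t : ι} (hst : s ≤ t) {G : Ω → ℝ} {C : ℝ}
    (hG : StronglyMeasurable[ℱ s] G) (hGC : ∀ ω, |G ω| ≤ C) :
    Integrable (fun ω => G ω * (N t ω - N s ω)) P ∧ ∫ ω, G ω * (N t ω - N s ω) ∂P = 0 := by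
  have hGm := (hG.mono (ℱ.le s)).aestronglyMeasurable (μ := P)
  have hi : ∀ r, Integrable (G * N r) P := fun r =>
    (hN.integrable r).bdd_mul hGm (ae_of_all _ hGC)
  have h1 := condExp_mul_of_stronglyMeasurable_left (μ := P) hG (hi t) (hN.integrable t)
  have h2 : ∫ ω, (G * N t) ω ∂P = ∫ ω, (G * N s) ω ∂P := by
    rw [← integral_condExp (ℱ.le s), integral_congr_ae h1]
    refine integral_congr_ae ?_
    filter_upwards [hN.2 s t hst] with ω hω
    simp [hω]
  have e : ∀ ω, G ω * (N t ω - N s ω) = (G * N t) ω - (G * N s) ω := fun ω => by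
    simp [mul_sub]
  simp only [e]
  exact ⟨(hi t).sub (hi s), by rw [integral_sub (hi t) (hi s), h2, sub_self]⟩

/-- The truncated quadratic variation of a martingale along a partition. -/
theorem integral_truncated_sum_sq_le {ι : Type*} [Preorder ι] {ℱ : Filtration ι mΩ}
    {N : ι → Ω → ℝ} (hN : Martingale N ℱ P) {p : ℕ → ι} (hp : Monotone p) {l : ℝ} (hl : 0 ≤ l)
    (n : ℕ) :
    Integrable (fun ω => ∑ k ∈ Finset.range n, (huber l (N (p (k + 1)) ω) - huber l (N (p k) ω)
      - 2 * truncate l (N (p k) ω) * (N (p (k + 1)) ω - N (p k) ω))) P ∧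
    ∫ ω, ∑ k ∈ Finset.range n, (huber l (N (p (k + 1)) ω) - huber l (N (p k) ω)
      - 2 * truncate l (N (p k) ω) * (N (p (k + 1)) ω - N (p k) ω)) ∂P
      ≤ 2 * l * ∫ ω, |N (p n) ω| ∂P := by
  have hh : ∀ r, Integrable (fun ω => huber l (N r ω)) P := fun r => by
    refine ((hN.integrable r).norm.const_mul (2 * l)).mono' ?_ (ae_of_all _ fun ω => ?_)
    · have hc : Continuous (huber l) := by
        have := continuous_truncate l
        unfold huber; fun_prop
      exact hc.comp_aestronglyMeasurable (hN.integrable r).1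
    · rw [Real.norm_eq_abs, abs_of_nonneg (huber_nonneg hl _)]
      exact huber_le hl _
  have hd : ∀ k, Integrable (fun ω => 2 * truncate l (N (p k) ω) *
        (N (p (k + 1)) ω - N (p k) ω)) P ∧
      ∫ ω, 2 * truncate l (N (p k) ω) * (N (p (k + 1)) ω - N (p k) ω) ∂P = 0 := fun k => by
    refine integral_mul_martingale hN (hp k.le_succ) (C := 2 * l)
      (((continuous_truncate l).comp_stronglyMeasurable (hN.1 (p k))).const_mul 2) fun ω => ?_
    rw [abs_mul, abs_two]
    exact mul_le_mul_of_nonneg_left (abs_truncate_le hl _) (by norm_num)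
  have hi : ∀ k, Integrable (fun ω => huber l (N (p (k + 1)) ω) - huber l (N (p k) ω)
      - 2 * truncate l (N (p k) ω) * (N (p (k + 1)) ω - N (p k) ω)) P := fun k =>
    ((hh _).sub (hh _)).sub (hd k).1
  refine ⟨integrable_finsetSum _ fun k _ => hi k, ?_⟩
  rw [integral_finsetSum _ fun k _ => hi k]
  have : ∀ k, ∫ ω, (huber l (N (p (k + 1)) ω) - huber l (N (p k) ω)
      - 2 * truncate l (N (p k) ω) * (N (p (k + 1)) ω - N (p k) ω)) ∂P
      = ∫ ω, huber l (N (p (k + 1)) ω) ∂P - ∫ ω, huber l (N (p k) ω) ∂P := fun k => by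
    rw [integral_sub (f := fun ω => huber l (N (p (k + 1)) ω) - huber l (N (p k) ω))
      ((hh _).sub (hh _)) (hd k).1, (hd k).2, sub_zero, integral_sub (hh _) (hh _)]
  simp only [this]
  -- The martingale terms have mean zero, so the means of the gaps telescope to a difference of
  -- Huber means. The Huber function grows at most linearly, hence a bound by E|N|.
  rw [Finset.sum_range_sub fun k => ∫ ω, huber l (N (p k) ω) ∂P, ← integral_const_mul]
  have h0 : 0 ≤ ∫ ω, huber l (N (p 0) ω) ∂P := integral_nonneg fun ω => huber_nonneg hl _
  have h1 : ∫ ω, huber l (N (p n) ω) ∂P ≤ ∫ ω, 2 * l * |N (p n) ω| ∂P :=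
    integral_mono (hh _) ((hN.integrable _).norm.const_mul _) fun ω => huber_le hl _
  linarith

end Martingale

theorem integral_abs_martingale_mono {Ω : Type*} {mΩ : MeasurableSpace Ω} {P : Measure Ω}
    {ι : Type*} [Preorder ι] {ℱ : Filtration ι mΩ}
    {N : ι → Ω → ℝ} (hN : Martingale N ℱ P) {s t : ι} (hst : s ≤ t) :
    ∫ ω, |N s ω| ∂P ≤ ∫ ω, |N t ω| ∂P := by
  refine le_trans (le_of_eq ?_) (integral_abs_condExp_le (m := ℱ s) (N t))
  refine integral_congr_ae ?_
  filter_upwards [hN.2 s t hst] with ω hω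
  rw [hω]

/-! ### Tightness of sums of squared increments of a semimartingale -/

section Tightness

variable {Ω : Type*} {mΩ : MeasurableSpace Ω} {P : Measure Ω} [IsProbabilityMeasure P]

/-- The sums of squared increments of `X` along the uniform grids of `[0,t]` are tight. -/
def TightSquares (P : Measure Ω) (t : ℝ) (X : ℝ → Ω → ℝ) : Prop :=
  ∀ ε > 0, ∃ K > 0, ∀ N : ℕ, P.real {ω | K < ∑ q ∈ Finset.range N,
    (X (gridPt t N (q + 1)) ω - X (gridPt t N q) ω) ^ 2} ≤ ε

/-- The variation on [0,t] bounds the sums along all grids simultaneously. -/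
theorem IsContFiniteVariation.exists_bound {𝓕 : Filtration ℝ≥0 mΩ} {A : ℝ≥0 → Ω → ℝ}
    (hA : IsContFiniteVariation P 𝓕 A) {t : ℝ} (ht : 0 ≤ t) {ε : ℝ} (hε : 0 < ε) :
    ∃ K > 0, P.real {ω | ∃ N : ℕ, K < ∑ q ∈ Finset.range N,
      |A (gridPt t N (q + 1)).toNNReal ω - A (gridPt t N q).toNNReal ω|} ≤ ε := by
  have hAm : ∀ s, Measurable (A s) := fun s => ((hA.adapted s).mono (𝓕.le s)).measurable
  refine exists_bound_of_countable (fun N => ?_) ?_ hε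
  · exact Finset.measurable_fun_sum _ fun q _ => ((hAm _).sub (hAm _)).abs
  · filter_upwards [hA.finite_variation] with ω hω
    have hv := hω 0 t.toNNReal (mem_univ _) (mem_univ _)
    rw [univ_inter] at hv
    refine ⟨(eVariationOn (fun s => A s ω) (Icc 0 t.toNNReal)).toReal, ?_⟩
    rintro _ ⟨N, rfl⟩
    -- Capping the index at N keeps the infinite monotone sequence inside [0,t].
    set p : ℕ → ℝ≥0 := fun q => (gridPt t N (min q N)).toNNReal with hp
    have hpm : Monotone p := fun a b hab =>
      Real.toNNReal_le_toNNReal (gridPt_mono ht N (min_le_min_right N hab))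
    have h1 := eVariationOn.sum_le (f := fun s => A s ω) (s := Icc 0 t.toNNReal) (n := N) hpm
      (fun q => ⟨zero_le, Real.toNNReal_le_toNNReal (gridPt_le ht (min_le_right _ _))⟩)
    have h2 := ENNReal.toReal_mono hv h1
    rw [ENNReal.toReal_sum (fun _ _ => edist_ne_top _ _)] at h2
    refine le_trans (le_of_eq (Finset.sum_congr rfl fun q hq => ?_)) h2
    have hq := Finset.mem_range.1 hq
    rw [← dist_edist, Real.dist_eq]
    simp only [hp, min_eq_left hq.le, min_eq_left (Nat.succ_le_of_lt hq)]

theorem IsContLocalMartingale.exists_bound {𝓕 : Filtration ℝ≥0 mΩ} {M : ℝ≥0 → Ω → ℝ}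
    (hM : IsContLocalMartingale P 𝓕 M) {t : ℝ} (ht : 0 ≤ t) {ε : ℝ} (hε : 0 < ε) :
    ∃ K > 0, P.real {ω | ∃ x : ℕ × ℕ, K < |M (gridPt t x.1 (min x.2 x.1)).toNNReal ω|} ≤ ε := by
  have hMm : ∀ s, Measurable (M s) := fun s => ((hM.adapted s).mono (𝓕.le s)).measurable
  refine exists_bound_of_countable (fun x => (hMm _).abs) ?_ hε
  filter_upwards [hM.continuous] with ω hω
  obtain ⟨C, hC⟩ := (isCompact_Icc (a := 0) (b := t.toNNReal)).exists_bound_of_continuousOn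
    hω.continuousOn
  refine ⟨C, ?_⟩
  rintro _ ⟨x, rfl⟩
  exact hC _ ⟨zero_le, Real.toNNReal_le_toNNReal (gridPt_le ht (min_le_right _ _))⟩

/-- Stop at a localizing time that exceeds t with high probability; on that event the stopped
process agrees with M on [0,t]. -/
theorem IsContLocalMartingale.exists_martingale {𝓕 : Filtration ℝ≥0 mΩ} {M : ℝ≥0 → Ω → ℝ}
    (hM : IsContLocalMartingale P 𝓕 M) (t : ℝ≥0) {ε : ℝ} (hε : 0 < ε) :
    ∃ N : ℝ≥0 → Ω → ℝ, Martingale N 𝓕 P ∧ P.real {ω | ∃ s ≤ t, N s ω ≠ M s ω} ≤ ε := by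
  obtain ⟨τ, hτ, hN⟩ := hM.locally_martingale
  have hmeas : ∀ n, MeasurableSet {ω | τ n ω ≤ t} := fun n =>
    𝓕.le _ _ (hτ.isStoppingTime n t)
  have hlim : Tendsto (fun n => P {ω | τ n ω ≤ t}) atTop (𝓝 (P ∅)) := by
    refine tendsto_measure_of_ae_tendsto_indicator_of_isFiniteMeasure atTop
      MeasurableSet.empty hmeas ?_
    filter_upwards [hτ.tendsto_top] with ω hω
    have h1 : ∀ᶠ n in atTop, (t : WithTop ℝ≥0) < τ n ω :=
      (tendsto_order.1 hω).1 _ (WithTop.coe_lt_top t)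
    filter_upwards [h1] with n hn
    exact iff_of_false (not_le.2 hn) (notMem_empty ω)
  rw [measure_empty] at hlim
  have hlim2 := (ENNReal.tendsto_toReal ENNReal.zero_ne_top).comp hlim
  obtain ⟨n, hn⟩ := (hlim2.eventually_lt_const (u := ε) (by simpa using hε)).exists
  refine ⟨_, hN n, (measureReal_mono fun ω hω => ?_).trans hn.le⟩
  obtain ⟨s, hs, hne⟩ := hω
  by_contra hcon
  simp only [mem_ofPred_eq, not_le] at hcon
  refine hne ?_
  have hsτ : (s : WithTop ℝ≥0) ≤ τ n ω := (WithTop.coe_le_coe.2 hs).trans hcon.le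
  have hb : ω ∈ {ω | ⊥ < τ n ω} := lt_of_le_of_lt bot_le hcon
  simp only [stoppedProcess, min_eq_left hsτ, WithTop.untopA, WithTop.untopD_coe]
  exact indicator_of_mem hb _

/-- Outside four events of probability at most ε/4, M stays in [-l, l] on the grids, agrees with a
true martingale, has small truncated quadratic variation, and A has variation at most V. There (x +
y)² ≤ 2x² + 2y² gives the bound 2L + 2V². -/
theorem IsContSemimartingaleOn.tightSquares {𝓕 : Filtration ℝ≥0 mΩ} {T : ℝ} {X : ℝ → Ω → ℝ}
    (hX : IsContSemimartingaleOn P 𝓕 T X) {t : ℝ} (ht : 0 ≤ t) (htT : t ≤ T) :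
    TightSquares P t X := by
  obtain ⟨M, A, hM, hA, hXMA⟩ := hX
  intro ε hε
  have hε4 : 0 < ε / 4 := by positivity
  obtain ⟨V, hV, hV'⟩ := hA.exists_bound ht hε4
  obtain ⟨l, hl, hl'⟩ := hM.exists_bound ht hε4
  obtain ⟨N, hN, hN'⟩ := hM.exists_martingale t.toNNReal hε4
  set a := ∫ ω, |N t.toNNReal ω| ∂P with ha
  have ha0 : 0 ≤ a := integral_nonneg fun _ => abs_nonneg _
  -- Chosen so that Markov's inequality gives 2la/L ≤ ε/4; the 1 keeps L positive when a = 0.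
  set L : ℝ := (2 * l * a + 1) / (ε / 4) with hL
  have hL0 : 0 < L := by positivity
  refine ⟨2 * L + 2 * V ^ 2, by positivity, fun n => ?_⟩
  set p : ℕ → ℝ≥0 := fun q => (gridPt t n (min q n)).toNNReal with hp
  have hpm : Monotone p := fun a b hab =>
    Real.toNNReal_le_toNNReal (gridPt_mono ht n (min_le_min_right n hab))
  have hpt : ∀ q, p q ≤ t.toNNReal := fun q =>
    Real.toNNReal_le_toNNReal (gridPt_le ht (min_le_right _ _))
  obtain ⟨hQi, hQ⟩ := integral_truncated_sum_sq_le hN hpm hl.le n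
  have hQ' := hQ.trans (mul_le_mul_of_nonneg_left (integral_abs_martingale_mono hN (hpt n))
    (by positivity))
  have hmark := measureReal_lt_le_of_integral_le (fun ω => Finset.sum_nonneg fun k _ =>
    huber_convex hl.le (N (p k) ω) (N (p (k + 1)) ω)) hQi hQ' hL0
  have hmark' : 2 * l * a / L ≤ ε / 4 := by
    rw [div_le_iff₀ hL0, hL, mul_div_cancel₀ _ hε4.ne']
    linarith
  set E₁ := {ω | L < ∑ k ∈ Finset.range n, (huber l (N (p (k + 1)) ω) - huber l (N (p k) ω)
      - 2 * truncate l (N (p k) ω) * (N (p (k + 1)) ω - N (p k) ω))}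
  set E₂ := {ω | ∃ N : ℕ, V < ∑ q ∈ Finset.range N,
      |A (gridPt t N (q + 1)).toNNReal ω - A (gridPt t N q).toNNReal ω|}
  set E₃ := {ω | ∃ x : ℕ × ℕ, l < |M (gridPt t x.1 (min x.2 x.1)).toNNReal ω|}
  set E₄ := {ω | ∃ s ≤ t.toNNReal, N s ω ≠ M s ω}
  have hsub : ∀ᵐ ω ∂P, ω ∈ {ω | 2 * L + 2 * V ^ 2 < ∑ q ∈ Finset.range n,
      (X (gridPt t n (q + 1)) ω - X (gridPt t n q) ω) ^ 2} → ω ∈ (E₁ ∪ E₂) ∪ (E₃ ∪ E₄) := by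
    filter_upwards [hXMA] with ω hω hbig
    by_contra hcon
    simp only [mem_union, not_or] at hcon
    obtain ⟨⟨h1, h2⟩, h3, h4⟩ := hcon
    simp only [E₁, E₂, E₃, E₄, mem_ofPred_eq, not_exists, not_lt, not_and, not_not] at h1 h2 h3 h4
    have hMl : ∀ q, |M (p q) ω| ≤ l := fun q => h3 (n, q)
    have hNM : ∀ q, N (p q) ω = M (p q) ω := fun q => h4 _ (hpt q)
    have hpq : ∀ q ≤ n, p q = (gridPt t n q).toNNReal := fun q hq => by
      simp only [hp, min_eq_left hq]
    have hXp : ∀ q ≤ n, X (gridPt t n q) ω = M (p q) ω + A (p q) ω := fun q hq => by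
      have h5 := hω (p q) (by
        rw [hpq q hq, Real.coe_toNNReal _ (gridPt_nonneg ht n q)]
        exact (gridPt_le ht hq).trans htT)
      rwa [hpq q hq, Real.coe_toNNReal _ (gridPt_nonneg ht n q), ← hpq q hq] at h5
    have hMsum : ∑ k ∈ Finset.range n, (M (p (k + 1)) ω - M (p k) ω) ^ 2 ≤ L := by
      refine le_trans (le_of_eq (Finset.sum_congr rfl fun k _ => ?_)) h1
      rw [hNM, hNM, huber_remainder (hMl _) (hMl _)]
    have hAsum : ∑ k ∈ Finset.range n, (A (p (k + 1)) ω - A (p k) ω) ^ 2 ≤ V ^ 2 := by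
      have h6 : ∑ k ∈ Finset.range n, |A (p (k + 1)) ω - A (p k) ω| ≤ V := by
        refine le_trans (le_of_eq (Finset.sum_congr rfl fun k hk => ?_)) (h2 n)
        have hk := Finset.mem_range.1 hk
        rw [hpq k hk.le, hpq (k + 1) hk]
      have h7 := Finset.sum_sq_le_sq_sum_of_nonneg (s := Finset.range n)
        (f := fun k => |A (p (k + 1)) ω - A (p k) ω|) (fun _ _ => abs_nonneg _)
      simp only [sq_abs] at h7
      exact h7.trans (pow_le_pow_left₀ (Finset.sum_nonneg fun _ _ => abs_nonneg _) h6 2)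
    have hX2 : ∑ q ∈ Finset.range n, (X (gridPt t n (q + 1)) ω - X (gridPt t n q) ω) ^ 2
        ≤ ∑ q ∈ Finset.range n, (2 * (M (p (q + 1)) ω - M (p q) ω) ^ 2 +
          2 * (A (p (q + 1)) ω - A (p q) ω) ^ 2) := by
      refine Finset.sum_le_sum fun q hq => ?_
      have hq := Finset.mem_range.1 hq
      rw [hXp q hq.le, hXp (q + 1) hq]
      nlinarith [sq_nonneg ((M (p (q + 1)) ω - M (p q) ω) - (A (p (q + 1)) ω - A (p q) ω))]
    rw [Finset.sum_add_distrib, ← Finset.mul_sum, ← Finset.mul_sum] at hX2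
    have hbig' := hbig.trans_le hX2
    linarith
  have hle : P.real {ω | 2 * L + 2 * V ^ 2 < ∑ q ∈ Finset.range n,
      (X (gridPt t n (q + 1)) ω - X (gridPt t n q) ω) ^ 2} ≤ P.real ((E₁ ∪ E₂) ∪ (E₃ ∪ E₄)) :=
    ENNReal.toReal_mono (measure_ne_top _ _) (measure_mono_ae hsub)
  have u1 := measureReal_union_le (μ := P) (E₁ ∪ E₂) (E₃ ∪ E₄)
  have u2 := measureReal_union_le (μ := P) E₁ E₂
  have u3 := measureReal_union_le (μ := P) E₃ E₄
  linarith

end Tightness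

/-! ### Riemann sums against an integrable weight -/

section Riemann

/-- Uniform continuity of y suffices, and g need only be integrable. It is used with g = h_i for the
Itô term and with g = 1 for ordinary Riemann sums. -/
theorem tendsto_riemann_sum {t : ℝ} (ht : 0 ≤ t) {y g : ℝ → ℝ} (hy : ContinuousOn y (Icc 0 t))
    (hg : IntervalIntegrable g volume 0 t) :
    Tendsto (fun n : ℕ => ∑ k ∈ Finset.range n,
      y (gridPt t n k) * ∫ s in gridPt t n k..gridPt t n (k + 1), g s) atTop
      (𝓝 (∫ s in (0 : ℝ)..t, y s * g s)) := by
  have hyg : IntervalIntegrable (fun s => y s * g s) volume 0 t :=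
    hg.continuousOn_mul (by rwa [uIcc_of_le ht])
  have huc := isCompact_Icc.uniformContinuousOn_of_continuous hy
  set J := ∫ s in (0 : ℝ)..t, |g s| with hJ
  have hJ0 : 0 ≤ J := intervalIntegral.integral_nonneg ht fun _ _ => abs_nonneg _
  rw [Metric.tendsto_atTop]
  intro ε hε
  obtain ⟨δ, hδ, huc⟩ := Metric.uniformContinuousOn_iff.1 huc (ε / (J + 1)) (by positivity)
  obtain ⟨N, hN⟩ := exists_nat_gt (t / δ)
  refine ⟨N + 1, fun n hn => ?_⟩
  have hn0 : 0 < n := by omega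
  have hnpos : (0 : ℝ) < n := Nat.cast_pos.2 hn0
  have hmesh : t / n < δ := by
    rw [div_lt_iff₀ hnpos]
    rw [div_lt_iff₀ hδ] at hN
    have : (N : ℝ) ≤ n := by exact_mod_cast (by omega : N ≤ n)
    nlinarith
  have hsubI : ∀ k < n, uIcc (gridPt t n k) (gridPt t n (k + 1)) ⊆ uIcc 0 t := fun k hk => by
    rw [uIcc_of_le (gridPt_mono ht n k.le_succ), uIcc_of_le ht]
    exact Icc_subset_Icc (gridPt_nonneg ht n k) (gridPt_le ht hk)
  have hsum : ∀ f : ℝ → ℝ, IntervalIntegrable f volume 0 t → ∫ s in (0 : ℝ)..t, f s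
      = ∑ k ∈ Finset.range n, ∫ s in gridPt t n k..gridPt t n (k + 1), f s := fun f hf => by
    rw [intervalIntegral.sum_integral_adjacent_intervals fun k hk => hf.mono_set (hsubI k hk),
      gridPt_zero, gridPt_last hn0]
  rw [hsum _ hyg, Real.dist_eq, ← Finset.sum_sub_distrib]
  have hterm : ∀ k ∈ Finset.range n, |y (gridPt t n k) *
      (∫ s in gridPt t n k..gridPt t n (k + 1), g s) -
      ∫ s in gridPt t n k..gridPt t n (k + 1), y s * g s| ≤
      ε / (J + 1) * ∫ s in gridPt t n k..gridPt t n (k + 1), |g s| := by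
    intro k hk
    have hk := Finset.mem_range.1 hk
    have hle := gridPt_mono ht n k.le_succ
    have i1 := hg.mono_set (hsubI k hk)
    have i2 := hyg.mono_set (hsubI k hk)
    rw [← intervalIntegral.integral_const_mul, ← intervalIntegral.integral_sub (i1.const_mul _) i2,
      ← intervalIntegral.integral_const_mul]
    refine (intervalIntegral.abs_integral_le_integral_abs hle).trans ?_
    refine intervalIntegral.integral_mono_on hle ((i1.const_mul _).sub i2).abs
      (i1.abs.const_mul _) fun s hs => ?_
    rw [← sub_mul, abs_mul]
    refine mul_le_mul_of_nonneg_right ?_ (abs_nonneg _)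
    have h1 : gridPt t n k ∈ Icc 0 t := ⟨gridPt_nonneg ht n k, gridPt_le ht hk.le⟩
    have h2 : s ∈ Icc 0 t := ⟨h1.1.trans hs.1, hs.2.trans (gridPt_le ht hk)⟩
    have h3 := huc _ h1 s h2 (by
      rw [Real.dist_eq, abs_sub_comm, abs_of_nonneg (by linarith [hs.1])]
      have := gridPt_succ_sub (t := t) n k
      linarith [hs.2])
    exact h3.le
  refine (Finset.abs_sum_le_sum_abs _ _).trans_lt ((Finset.sum_le_sum hterm).trans_lt ?_)
  rw [← Finset.mul_sum, ← hsum _ hg.abs, ← hJ, div_mul_eq_mul_div, div_lt_iff₀ (by positivity)]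
  nlinarith

end Riemann

/-! ### Algebra of limits in probability -/

section TendstoInMeasureAlgebra

variable {Ω : Type*} {mΩ : MeasurableSpace Ω} {P : Measure Ω} [IsFiniteMeasure P]

theorem tendstoInMeasure_add {f f' : ℕ → Ω → ℝ} {g g' : Ω → ℝ} (h : TendstoInMeasure P f atTop g)
    (h' : TendstoInMeasure P f' atTop g') :
    TendstoInMeasure P (fun n ω => f n ω + f' n ω) atTop (fun ω => g ω + g' ω) := by
  rw [tendstoInMeasure_iff_small] at *
  intro ε hε
  filter_upwards [h (ε / 2) (by positivity), h' (ε / 2) (by positivity)] with n h1 h2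
  refine ((h1.add h2).mono (by linarith)).congr (ae_of_all _ fun ω => ?_)
  simp only; ring

theorem tendstoInMeasure_mul_const {f : ℕ → Ω → ℝ} {g c : Ω → ℝ}
    (h : TendstoInMeasure P f atTop g) (hc : Measurable c) :
    TendstoInMeasure P (fun n ω => f n ω * c ω) atTop (fun ω => g ω * c ω) := by
  rw [tendstoInMeasure_iff_small] at *
  intro ε hε
  obtain ⟨K, hK, hcK⟩ := exists_bound_single (P := P) hc (ε := ε / 2) (by positivity)
  filter_upwards [h (min (ε / 2) (ε / 2 / K)) (by positivity)] with n hn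
  refine ((hn.mul hcK hK.le (min_le_left _ _) ?_).mono (by linarith)).congr
    (ae_of_all _ fun ω => ?_)
  · refine (mul_le_mul_of_nonneg_left (min_le_right _ _) hK.le).trans (le_of_eq ?_)
    field_simp
  · simp only; ring

theorem tendstoInMeasure_sub {f f' : ℕ → Ω → ℝ} {g g' : Ω → ℝ} (h : TendstoInMeasure P f atTop g)
    (h' : TendstoInMeasure P f' atTop g') :
    TendstoInMeasure P (fun n ω => f n ω - f' n ω) atTop (fun ω => g ω - g' ω) := by
  have h2 := tendstoInMeasure_add h
    (tendstoInMeasure_mul_const h' (c := fun _ => (-1 : ℝ)) measurable_const)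
  simpa [sub_eq_add_neg] using h2

theorem tendstoInMeasure_sum {ι : Type*} {s : Finset ι} {f : ι → ℕ → Ω → ℝ} {g : ι → Ω → ℝ}
    (h : ∀ i ∈ s, TendstoInMeasure P (f i) atTop (g i)) :
    TendstoInMeasure P (fun n ω => ∑ i ∈ s, f i n ω) atTop (fun ω => ∑ i ∈ s, g i ω) := by
  classical
  induction s using Finset.induction_on with
  | empty =>
    rw [tendstoInMeasure_iff_small]
    intro ε hε
    exact Eventually.of_forall fun n => by simp [SmallInProb, not_lt.2 hε.le, hε.le]
  | insert i s hi ih =>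
    simp only [Finset.sum_insert hi]
    exact tendstoInMeasure_add (h i (Finset.mem_insert_self i s))
      (ih fun j hj => h j (Finset.mem_insert_of_mem hj))

/-- Off both exceptional events, |∑ u_k v_k| ≤ (∑ |u_k|) max |v_k| ≤ Kδ. -/
theorem SmallInProb.sum_mul {n : ℕ} {ε δ K : ℝ} {u v : ℕ → Ω → ℝ}
    (hu : P.real {ω | K < ∑ k ∈ Finset.range n, |u k ω|} ≤ ε)
    (hv : P.real {ω | ∃ k < n, δ < |v k ω|} ≤ ε) (hδ : 0 ≤ δ) (hKδ : K * δ ≤ ε) :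
    SmallInProb P (ε + ε) (fun ω => ∑ k ∈ Finset.range n, u k ω * v k ω) := by
  refine (measureReal_mono (s₂ := {ω | K < ∑ k ∈ Finset.range n, |u k ω|} ∪
    {ω | ∃ k < n, δ < |v k ω|}) fun ω hω => ?_).trans
    ((measureReal_union_le _ _).trans (add_le_add hu hv))
  by_contra hcon
  simp only [mem_union, mem_ofPred_eq, not_or, not_lt, not_exists, not_and] at hcon hω
  have h0 : 0 ≤ ε := le_trans measureReal_nonneg hu
  have h1 : |∑ k ∈ Finset.range n, u k ω * v k ω| ≤ (∑ k ∈ Finset.range n, |u k ω|) * δ := by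
    refine (Finset.abs_sum_le_sum_abs _ _).trans ?_
    rw [Finset.sum_mul]
    refine Finset.sum_le_sum fun k hk => ?_
    rw [abs_mul]
    exact mul_le_mul_of_nonneg_left (hcon.2 k (Finset.mem_range.1 hk)) (abs_nonneg _)
  have h2 := mul_le_mul_of_nonneg_right hcon.1 hδ
  linarith

end TendstoInMeasureAlgebra

/-! ### Itô sums along a grid -/

section BrownianGrid

variable {Ω : Type*} [mΩ : MeasurableSpace Ω] {P : Measure Ω} {d : ℕ} {T : ℝ}
  {B : ℝ → Ω → Space d}

/-- The augmented Brownian filtration along the uniform grid of `[0,t]`. -/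
noncomputable def gridFiltration (P : Measure Ω) (T : ℝ) (B : ℝ → Ω → Space d) {t : ℝ}
    (ht : 0 ≤ t) (N : ℕ) : Filtration ℕ mΩ where
  seq q := brownianFiltration P T B (gridPt t N q).toNNReal
  mono' _ _ h := (brownianFiltration P T B).mono (Real.toNNReal_le_toNNReal (gridPt_mono ht N h))
  le' _ := (brownianFiltration P T B).le _

/-- The increments of the `i`-th coordinate of `B` along the uniform grid of `[0,t]`. -/
noncomputable def gridIncr (B : ℝ → Ω → Space d) (t : ℝ) (N : ℕ) (i : Fin d) (q : ℕ) (ω : Ω) : ℝ :=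
  B (gridPt t N (q + 1)) ω i - B (gridPt t N q) ω i

/-- Bounded continuous adapted processes on `[0,T]`. -/
structure IsBoundedAdapted (P : Measure Ω) (T : ℝ) (B : ℝ → Ω → Space d) (C : ℝ)
    (Y : ℝ → Ω → ℝ) : Prop where
  adapted : ∀ t ∈ Icc 0 T, StronglyMeasurable[brownianFiltration P T B t.toNNReal] (Y t)
  bounded : ∀ t ω, |Y t ω| ≤ C
  continuous : ∀ᵐ ω ∂P, ContinuousOn (fun t => Y t ω) (Icc 0 T)

variable {t : ℝ} {N : ℕ}

theorem IsBoundedAdapted.measurable {C : ℝ} {Y : ℝ → Ω → ℝ} (hY : IsBoundedAdapted P T B C Y)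
    (ht : t ∈ Icc 0 T) : Measurable (Y t) :=
  ((hY.adapted t ht).mono ((brownianFiltration P T B).le _)).measurable

theorem IsBoundedAdapted.memLp [IsFiniteMeasure P] {C : ℝ} {Y : ℝ → Ω → ℝ}
    (hY : IsBoundedAdapted P T B C Y) (ht : t ∈ Icc 0 T) (p : ℝ≥0∞) : MemLp (Y t) p P :=
  MemLp.of_bound (hY.measurable ht).aestronglyMeasurable C (ae_of_all _ fun ω => hY.bounded t ω)

theorem gridPt_mem (ht : 0 ≤ t) (htT : t ≤ T) {q : ℕ} (hq : q ≤ N) : gridPt t N q ∈ Icc 0 T :=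
  ⟨gridPt_nonneg ht N q, (gridPt_le ht hq).trans htT⟩

namespace IsBrownianMotionOn

theorem stronglyMeasurable_gridIncr (hB : IsBrownianMotionOn P T B) (ht : 0 ≤ t) (htT : t ≤ T)
    (i : Fin d) {q : ℕ} (hq : q < N) :
    StronglyMeasurable[gridFiltration P T B ht N (q + 1)] (gridIncr B t N i q) := by
  have hcoord : Measurable fun x : Space d => x i := by fun_prop
  have hT' := (gridPt_mem (T := T) ht htT hq).2
  exact Measurable.stronglyMeasurable
    ((hcoord.comp (hB.measurable_filtration (gridPt_nonneg ht N _) le_rfl hT')).sub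
      (hcoord.comp (hB.measurable_filtration (gridPt_nonneg ht N _)
        (gridPt_mono ht N q.le_succ) hT')))

theorem indep_gridIncr_pair (hB : IsBrownianMotionOn P T B) (ht : 0 ≤ t) (htT : t ≤ T)
    {g : Space d → ℝ} (hg : Measurable g) {q : ℕ} (hq : q < N) :
    Indep (MeasurableSpace.comap
      (fun ω => g (B (gridPt t N (q + 1)) ω - B (gridPt t N q) ω)) inferInstance)
      (gridFiltration P T B ht N q) P := by
  refine indep_of_indep_of_le_left (hB.indep_increment (gridPt_nonneg ht N q)
    (gridPt_mono ht N q.le_succ) (gridPt_mem (T := T) ht htT hq).2) ?_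
  rintro _ ⟨s, hs, rfl⟩
  exact ⟨g ⁻¹' s, hg hs, rfl⟩

theorem memLp_gridIncr (hB : IsBrownianMotionOn P T B) (ht : 0 ≤ t) (htT : t ≤ T)
    (i : Fin d) {q : ℕ} (hq : q < N) (p : ℝ≥0∞) (hp : p ≠ ∞) : MemLp (gridIncr B t N i q) p P :=
  hB.memLp_coord (gridPt_nonneg ht N q) (gridPt_mono ht N q.le_succ)
    (gridPt_mem (T := T) ht htT hq).2 i p hp

theorem integral_gridIncr_sq (hB : IsBrownianMotionOn P T B) (ht : 0 ≤ t) (htT : t ≤ T)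
    (i : Fin d) {q : ℕ} (hq : q < N) : ∫ ω, gridIncr B t N i q ω ^ 2 ∂P = t / N := by
  unfold gridIncr
  rw [hB.integral_coord_sq (gridPt_nonneg ht N q) (gridPt_mono ht N q.le_succ)
    (gridPt_mem (T := T) ht htT hq).2 i, gridPt_succ_sub]

/-- Second moments of Itô sums. -/
theorem integral_ito_sum_sq_le (hB : IsBrownianMotionOn P T B) (ht : 0 ≤ t) (htT : t ≤ T)
    (i : Fin d) {a r : ℕ} (har : a + r ≤ N) {w : ℕ → Ω → ℝ} {c : ℝ}
    (hw : ∀ q < N, StronglyMeasurable[gridFiltration P T B ht N q] (w q))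
    (hw2 : ∀ q < N, MemLp (w q) 2 P) (hwc : ∀ q < N, ∫ ω, w q ω ^ 2 ∂P ≤ c) :
    StronglyMeasurable[gridFiltration P T B ht N (a + r)]
      (fun ω => ∑ l ∈ Finset.range r, w (a + l) ω * gridIncr B t N i (a + l) ω) ∧
    MemLp (fun ω => ∑ l ∈ Finset.range r, w (a + l) ω * gridIncr B t N i (a + l) ω) 2 P ∧
    ∫ ω, (∑ l ∈ Finset.range r, w (a + l) ω * gridIncr B t N i (a + l) ω) ^ 2 ∂P
      ≤ c * (r * (t / N)) := by
  have hlt : ∀ l < r, a + l < N := fun l hl => by omega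
  let ℱ : Filtration ℕ mΩ := ⟨fun l => gridFiltration P T B ht N (a + l),
    fun x y hxy => (gridFiltration P T B ht N).mono (by omega),
    fun l => (gridFiltration P T B ht N).le _⟩
  obtain ⟨h1, h2, h3⟩ := integral_sum_mul_sq (P := P) ℱ (a := fun l => w (a + l))
    (ξ := fun l => gridIncr B t N i (a + l)) (N := r)
    (fun l hl => hw _ (hlt l hl)) (fun l hl => hw2 _ (hlt l hl))
    (fun l hl => hB.stronglyMeasurable_gridIncr ht htT i (hlt l hl))
    (fun l hl => hB.memLp_gridIncr ht htT i (hlt l hl) 2 (by simp))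
    (fun l hl => hB.integral_coord (gridPt_nonneg ht N _) (gridPt_mono ht N (a + l).le_succ)
      (gridPt_mem (T := T) ht htT (hlt l hl)).2 i)
    (fun l hl => hB.indep_gridIncr_pair ht htT (g := fun x => x i) (by fun_prop) (hlt l hl))
  refine ⟨h1, h2, h3.trans_le ?_⟩
  have h4 : ∀ l ∈ Finset.range r, (∫ ω, w (a + l) ω ^ 2 ∂P) *
      ∫ ω, gridIncr B t N i (a + l) ω ^ 2 ∂P ≤ c * (t / N) := fun l hl => by
    have hl := hlt l (Finset.mem_range.1 hl)
    rw [hB.integral_gridIncr_sq ht htT i hl]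
    exact mul_le_mul_of_nonneg_right (hwc _ hl) (by positivity)
  refine (Finset.sum_le_sum h4).trans (le_of_eq ?_)
  rw [Finset.sum_const, Finset.card_range, nsmul_eq_mul]; ring

/-- The products of increments minus their means, weighted by an adapted process. -/
theorem integral_weighted_covariation_sq_le [IsProbabilityMeasure P]
    (hB : IsBrownianMotionOn P T B) (ht : 0 ≤ t) (htT : t ≤ T)
    (i j : Fin d) {C : ℝ} {Z : ℝ → Ω → ℝ} (hZ : IsBoundedAdapted P T B C Z) :
    MemLp (fun ω => ∑ q ∈ Finset.range N, Z (gridPt t N q) ω *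
      (gridIncr B t N j q ω * gridIncr B t N i q ω - if j = i then t / N else 0)) 2 P ∧
    ∫ ω, (∑ q ∈ Finset.range N, Z (gridPt t N q) ω *
      (gridIncr B t N j q ω * gridIncr B t N i q ω - if j = i then t / N else 0)) ^ 2 ∂P
      ≤ N * (C ^ 2 * ((2 * fourthMoment + 2) * (t / N) ^ 2)) := by
  set κ : ℝ := if j = i then t / N else 0 with hκ
  have hκ2 : κ ^ 2 ≤ (t / N) ^ 2 := by
    rw [hκ]; split_ifs
    · exact le_rfl
    · rw [zero_pow two_ne_zero]; positivity
  have h4i : ∀ (i : Fin d), ∀ q < N, Integrable (fun ω => gridIncr B t N i q ω ^ 4) P :=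
    fun i q hq => by
      refine ((hB.memLp_gridIncr ht htT i hq 4 (by simp)).integrable_norm_pow
        (p := 4) (by norm_num)).congr (ae_of_all _ fun ω => ?_)
      simp only [Real.norm_eq_abs]
      rw [show (4 : ℕ) = 2 * 2 by norm_num, pow_mul, sq_abs, pow_mul]
  have h4 : ∀ (i : Fin d), ∀ q < N, ∫ ω, gridIncr B t N i q ω ^ 4 ∂P
      = fourthMoment * (t / N) ^ 2 := fun i q hq => by
    unfold gridIncr
    rw [hB.integral_coord_pow_four (gridPt_nonneg ht N q) (gridPt_mono ht N q.le_succ)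
      (gridPt_mem (T := T) ht htT hq).2 i, gridPt_succ_sub]
  have hpi : ∀ q < N, Integrable (fun ω => gridIncr B t N j q ω * gridIncr B t N i q ω) P :=
    fun q hq => (hB.memLp_gridIncr ht htT j hq 2 (by simp)).integrable_mul
      (hB.memLp_gridIncr ht htT i hq 2 (by simp))
  have hξm : ∀ q < N, AEStronglyMeasurable
      (fun ω => gridIncr B t N j q ω * gridIncr B t N i q ω - κ) P := fun q hq =>
    ((hpi q hq).1.sub aestronglyMeasurable_const)
  -- Crude domination of the centred product by fourth powers. With Gaussian fourth moments it gives
  -- the constant `2 * fourthMoment + 2`.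
  have hpt : ∀ x y : ℝ, (x * y - κ) ^ 2 ≤ x ^ 4 + y ^ 4 + 2 * (t / N) ^ 2 := fun x y => by
    nlinarith [sq_nonneg (x * y + κ), sq_nonneg (x ^ 2 - y ^ 2)]
  have hdom : ∀ q < N, Integrable (fun ω => gridIncr B t N j q ω ^ 4 +
      gridIncr B t N i q ω ^ 4 + 2 * (t / N) ^ 2) P := fun q hq =>
    ((h4i j q hq).add (h4i i q hq)).add (integrable_const _)
  have hξ2 : ∀ q < N, MemLp (fun ω => gridIncr B t N j q ω * gridIncr B t N i q ω - κ) 2 P :=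
    fun q hq => by
      rw [memLp_two_iff_integrable_sq (hξm q hq)]
      refine (hdom q hq).mono' ((hξm q hq).pow 2) (ae_of_all _ fun ω => ?_)
      rw [Real.norm_eq_abs, abs_of_nonneg (sq_nonneg _)]
      exact hpt _ _
  have hξ4 : ∀ q < N, ∫ ω, (gridIncr B t N j q ω * gridIncr B t N i q ω - κ) ^ 2 ∂P
      ≤ (2 * fourthMoment + 2) * (t / N) ^ 2 := fun q hq => by
    refine (integral_mono (hξ2 q hq).integrable_sq (hdom q hq) fun ω => hpt _ _).trans
      (le_of_eq ?_)
    rw [integral_add (f := fun ω => gridIncr B t N j q ω ^ 4 + gridIncr B t N i q ω ^ 4)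
      ((h4i j q hq).add (h4i i q hq)) (integrable_const _),
      integral_add (h4i j q hq) (h4i i q hq), h4 j q hq, h4 i q hq]
    simp
    ring
  obtain ⟨-, h2, h3⟩ := integral_sum_mul_sq (P := P) (gridFiltration P T B ht N)
    (a := fun q => Z (gridPt t N q))
    (ξ := fun q ω => gridIncr B t N j q ω * gridIncr B t N i q ω - κ) (N := N)
    (fun q hq => hZ.adapted _ (gridPt_mem ht htT hq.le))
    (fun q hq => hZ.memLp (gridPt_mem ht htT hq.le) 2)
    (fun q hq => ((hB.stronglyMeasurable_gridIncr ht htT j hq).mul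
      (hB.stronglyMeasurable_gridIncr ht htT i hq)).sub stronglyMeasurable_const)
    hξ2 (fun q hq => by
      rw [integral_sub (hpi q hq) (integrable_const _)]
      have := hB.integral_coord_mul (gridPt_nonneg ht N q) (gridPt_mono ht N q.le_succ)
        (gridPt_mem (T := T) ht htT hq).2 i j
      rw [gridPt_succ_sub, ← hκ] at this
      unfold gridIncr
      rw [this]; simp)
    (fun q hq => hB.indep_gridIncr_pair ht htT (g := fun x => x j * x i - κ) (by fun_prop) hq)
  refine ⟨h2, h3.trans_le ?_⟩
  have h5 : ∀ q ∈ Finset.range N, (∫ ω, Z (gridPt t N q) ω ^ 2 ∂P) *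
      ∫ ω, (gridIncr B t N j q ω * gridIncr B t N i q ω - κ) ^ 2 ∂P
      ≤ C ^ 2 * ((2 * fourthMoment + 2) * (t / N) ^ 2) := fun q hq => by
    have hq := Finset.mem_range.1 hq
    refine mul_le_mul ?_ (hξ4 q hq) (integral_nonneg fun _ => sq_nonneg _) (sq_nonneg _)
    have h6 : ∫ ω, Z (gridPt t N q) ω ^ 2 ∂P ≤ ∫ _, C ^ 2 ∂P :=
      integral_mono (hZ.memLp (gridPt_mem ht htT hq.le) 2).integrable_sq (integrable_const _)
        fun ω => by
          simp only
          rw [← sq_abs]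
          exact pow_le_pow_left₀ (abs_nonneg _) (hZ.bounded _ _) 2
    simpa using h6
  refine (Finset.sum_le_sum h5).trans (le_of_eq ?_)
  rw [Finset.sum_const, Finset.card_range, nsmul_eq_mul]

end IsBrownianMotionOn

end BrownianGrid

/-! ### Two-scale estimates for Brownian increments -/

namespace IsBrownianMotionOn

variable {Ω : Type*} [mΩ : MeasurableSpace Ω] {P : Measure Ω} [IsProbabilityMeasure P] {d : ℕ}
  {T : ℝ} {B : ℝ → Ω → Space d} {t : ℝ} {N : ℕ}

/-- A partial block lasts no longer than a coarse step, so the Itô isometry bounds its second moment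
by c² t/n, whatever m is. Its terms precede q, so it may be used as an adapted integrand at q. -/
theorem integral_partial_block_sq_le (hB : IsBrownianMotionOn P T B) (ht : 0 ≤ t) (htT : t ≤ T)
    (i : Fin d) {n m : ℕ} (hn : 0 < n) (hm : 0 < m) {w : ℕ → Ω → ℝ} {c : ℝ}
    (hw : ∀ q < n * m, StronglyMeasurable[gridFiltration P T B ht (n * m) q] (w q))
    (hwc : ∀ q < n * m, ∀ ω, |w q ω| ≤ c) {q : ℕ} (hq : q < n * m) :
    StronglyMeasurable[gridFiltration P T B ht (n * m) q]
      (fun ω => ∑ l ∈ Finset.range (q % m), w (q / m * m + l) ω *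
        gridIncr B t (n * m) i (q / m * m + l) ω) ∧
    MemLp (fun ω => ∑ l ∈ Finset.range (q % m), w (q / m * m + l) ω *
        gridIncr B t (n * m) i (q / m * m + l) ω) 2 P ∧
    ∫ ω, (∑ l ∈ Finset.range (q % m), w (q / m * m + l) ω *
        gridIncr B t (n * m) i (q / m * m + l) ω) ^ 2 ∂P ≤ c ^ 2 * (t / n) := by
  have hqm : q / m * m + q % m = q := Nat.div_add_mod' q m
  have hw2 : ∀ q < n * m, MemLp (w q) 2 P := fun q hq =>
    MemLp.of_bound ((hw q hq).mono ((gridFiltration P T B ht (n * m)).le q)).aestronglyMeasurable c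
      (ae_of_all _ fun ω => hwc q hq ω)
  obtain ⟨h1, h2, h3⟩ := hB.integral_ito_sum_sq_le ht htT i (a := q / m * m) (r := q % m)
    (N := n * m) (by omega) hw hw2 (c := c ^ 2) fun q hq => by
      have : ∫ ω, w q ω ^ 2 ∂P ≤ ∫ _, c ^ 2 ∂P :=
        integral_mono (hw2 q hq).integrable_sq (integrable_const _) fun ω => by
          simp only
          rw [← sq_abs]
          exact pow_le_pow_left₀ (abs_nonneg _) (hwc q hq ω) 2
      simpa using this
  rw [hqm] at h1
  refine ⟨h1, h2, h3.trans ?_⟩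
  refine mul_le_mul_of_nonneg_left ?_ (sq_nonneg c)
  have hm' : (0 : ℝ) < m := Nat.cast_pos.2 hm
  have hn' : (0 : ℝ) < n := Nat.cast_pos.2 hn
  have h4 : ((q % m : ℕ) : ℝ) ≤ m := Nat.cast_le.2 (Nat.mod_lt q hm).le
  refine (mul_le_mul_of_nonneg_right h4 (by positivity)).trans (le_of_eq ?_)
  push_cast
  field_simp

/-- The sums over the blocks of a coarse grid of products of an Itô sum on the fine grid with an
increment of `B` are close to their compensator, uniformly in the fine grid. -/
theorem integral_block_covariation_sq_le (hB : IsBrownianMotionOn P T B) (ht : 0 ≤ t)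
    (htT : t ≤ T) (i j : Fin d) {n m : ℕ} (hn : 0 < n) (hm : 0 < m) {C : ℝ} (hC : 0 ≤ C)
    {Z : ℝ → Ω → ℝ} (hZ : IsBoundedAdapted P T B C Z) :
    MemLp (fun ω => ∑ k ∈ Finset.range n,
      (∑ r ∈ Finset.range m, Z (gridPt t (n * m) (k * m + r)) ω *
        gridIncr B t (n * m) j (k * m + r) ω) *
      (∑ r ∈ Finset.range m, gridIncr B t (n * m) i (k * m + r) ω) -
      ∑ q ∈ Finset.range (n * m), Z (gridPt t (n * m) q) ω *
        (if j = i then t / (n * m : ℕ) else 0)) 2 P ∧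
    ∫ ω, (∑ k ∈ Finset.range n,
      (∑ r ∈ Finset.range m, Z (gridPt t (n * m) (k * m + r)) ω *
        gridIncr B t (n * m) j (k * m + r) ω) *
      (∑ r ∈ Finset.range m, gridIncr B t (n * m) i (k * m + r) ω) -
      ∑ q ∈ Finset.range (n * m), Z (gridPt t (n * m) q) ω *
        (if j = i then t / (n * m : ℕ) else 0)) ^ 2 ∂P
      ≤ 3 * (C ^ 2 * (2 * fourthMoment + 4) * t ^ 2) / n := by
  set κ : ℝ := if j = i then t / (n * m : ℕ) else 0 with hκ
  have hm' : (0 : ℝ) < m := Nat.cast_pos.2 hm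
  have hn' : (0 : ℝ) < n := Nat.cast_pos.2 hn
  have hm1 : (1 : ℝ) ≤ m := Nat.one_le_cast.2 hm
  set N := n * m with hN
  have hNpos : 0 < N := Nat.mul_pos hn hm
  have hNt : (N : ℝ) * (t / N) = t := by
    have : (0 : ℝ) < N := Nat.cast_pos.2 hNpos
    field_simp
  have hZm : ∀ q < N, StronglyMeasurable[gridFiltration P T B ht N q] (Z (gridPt t N q)) :=
    fun q hq => hZ.adapted _ (gridPt_mem ht htT hq.le)
  set G : ℕ → Ω → ℝ := fun q ω => ∑ l ∈ Finset.range (q % m), 1 *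
        gridIncr B t N i (q / m * m + l) ω with hG
  set Φ : ℕ → Ω → ℝ := fun q ω => ∑ l ∈ Finset.range (q % m), Z (gridPt t N (q / m * m + l)) ω *
        gridIncr B t N j (q / m * m + l) ω with hΦ
  have fG := fun q (hq : q < N) => hB.integral_partial_block_sq_le ht htT i hn hm (w := fun _ _ => 1) (c := 1)
    (fun _ _ => stronglyMeasurable_const) (fun _ _ _ => by simp) hq
  have fΦ := fun q (hq : q < N) => hB.integral_partial_block_sq_le ht htT j hn hm
    (w := fun q => Z (gridPt t N q)) hZm (fun q _ ω => hZ.bounded _ ω) hq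
  have gZ : ∀ q < N, MemLp (fun ω => Z (gridPt t N q) ω * G q ω) 2 P ∧
      ∫ ω, (Z (gridPt t N q) ω * G q ω) ^ 2 ∂P ≤ C ^ 2 * (t / n) := fun q hq => by
    obtain ⟨g1, g2, g3⟩ := fG q hq
    have hmem : MemLp (fun ω => Z (gridPt t N q) ω * G q ω) 2 P := by
      refine (g2.const_mul C).mono ((hZ.measurable (gridPt_mem ht htT hq.le)).aestronglyMeasurable.mul
        g2.1) (ae_of_all _ fun ω => ?_)
      rw [norm_mul, norm_mul]
      refine mul_le_mul_of_nonneg_right ?_ (norm_nonneg _)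
      rw [Real.norm_eq_abs, Real.norm_eq_abs, abs_of_nonneg hC]
      exact hZ.bounded _ _
    refine ⟨hmem, ?_⟩
    have h1 : ∫ ω, (Z (gridPt t N q) ω * G q ω) ^ 2 ∂P ≤ ∫ ω, C ^ 2 * G q ω ^ 2 ∂P :=
      integral_mono hmem.integrable_sq (g2.integrable_sq.const_mul _) fun ω => by
        simp only
        rw [mul_pow, ← sq_abs (Z _ _)]
        exact mul_le_mul_of_nonneg_right (pow_le_pow_left₀ (abs_nonneg _) (hZ.bounded _ _) 2)
          (sq_nonneg _)
    rw [integral_const_mul] at h1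
    refine h1.trans (mul_le_mul_of_nonneg_left ?_ (sq_nonneg C))
    simpa only [hG, one_pow, one_mul] using g3
  obtain ⟨p1, r1⟩ := hB.integral_weighted_covariation_sq_le (N := N) ht htT i j hZ
  obtain ⟨-, p2, r2⟩ := hB.integral_ito_sum_sq_le ht htT j (a := 0) (r := N) (N := N) (by omega)
    (w := fun q ω => Z (gridPt t N q) ω * G q ω) (fun q hq => (hZm q hq).mul (fG q hq).1)
    (fun q hq => (gZ q hq).1) (fun q hq => (gZ q hq).2)
  obtain ⟨-, p3, r3⟩ := hB.integral_ito_sum_sq_le ht htT i (a := 0) (r := N) (N := N) (by omega)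
    (w := Φ) (fun q hq => (fΦ q hq).1) (fun q hq => (fΦ q hq).2.1) (fun q hq => (fΦ q hq).2.2)
  simp only [zero_add, hNt] at p2 r2 p3 r3
  rw [← hκ] at p1 r1
  -- Diagonal fluctuations plus two Itô sums, whose integrands are the partial block sums of the
  -- other factor.
  have e : ∀ ω, ∑ k ∈ Finset.range n, (∑ r ∈ Finset.range m, Z (gridPt t N (k * m + r)) ω *
        gridIncr B t N j (k * m + r) ω) * (∑ r ∈ Finset.range m, gridIncr B t N i (k * m + r) ω) -
      ∑ q ∈ Finset.range N, Z (gridPt t N q) ω * κ =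
      ∑ q ∈ Finset.range N, Z (gridPt t N q) ω *
        (gridIncr B t N j q ω * gridIncr B t N i q ω - κ) +
      ∑ q ∈ Finset.range N, Z (gridPt t N q) ω * G q ω * gridIncr B t N j q ω +
      ∑ q ∈ Finset.range N, Φ q ω * gridIncr B t N i q ω := by
    intro ω
    rw [sum_block_mul_block (fun q => Z (gridPt t N q) ω * gridIncr B t N j q ω)
      (fun q => gridIncr B t N i q ω) n m]
    simp only [hG, hΦ, one_mul, mul_sub, Finset.sum_sub_distrib]
    rw [← hN]
    have e1 : ∀ q, Z (gridPt t N q) ω * gridIncr B t N j q ω * gridIncr B t N i q ω =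
      Z (gridPt t N q) ω * (gridIncr B t N j q ω * gridIncr B t N i q ω) := fun q => by ring
    have e2 : ∀ q, Z (gridPt t N q) ω * gridIncr B t N j q ω *
        ∑ l ∈ Finset.range (q % m), gridIncr B t N i (q / m * m + l) ω =
        (Z (gridPt t N q) ω * ∑ l ∈ Finset.range (q % m), gridIncr B t N i (q / m * m + l) ω) *
        gridIncr B t N j q ω := fun q => by ring
    simp only [e1, e2]
    ring
  simp only [e]
  have p12 := p1.add p2
  have p123 : MemLp (fun ω => ∑ q ∈ Finset.range N, Z (gridPt t N q) ω *
        (gridIncr B t N j q ω * gridIncr B t N i q ω - κ) +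
      ∑ q ∈ Finset.range N, Z (gridPt t N q) ω * G q ω * gridIncr B t N j q ω +
      ∑ q ∈ Finset.range N, Φ q ω * gridIncr B t N i q ω) 2 P := p12.add p3
  refine ⟨p123, ?_⟩
  have i1 := p1.integrable_sq
  have i2 := p2.integrable_sq
  have i3 := p3.integrable_sq
  have hle := integral_mono p123.integrable_sq (((i1.add i2).add i3).const_mul 3) fun ω => by
    simp only [Pi.add_apply]
    generalize ∑ q ∈ Finset.range N, Z (gridPt t N q) ω *
        (gridIncr B t N j q ω * gridIncr B t N i q ω - κ) = x
    generalize ∑ q ∈ Finset.range N, Z (gridPt t N q) ω * G q ω * gridIncr B t N j q ω = y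
    generalize ∑ q ∈ Finset.range N, Φ q ω * gridIncr B t N i q ω = z
    show (x + y + z) ^ 2 ≤ 3 * (x ^ 2 + y ^ 2 + z ^ 2)
    nlinarith [sq_nonneg (x - y), sq_nonneg (y - z), sq_nonneg (x - z)]
  rw [integral_const_mul, integral_add' (i1.add i2) i3, integral_add' i1 i2] at hle
  refine hle.trans ?_
  have hr1 : (N : ℝ) * (C ^ 2 * ((2 * fourthMoment + 2) * (t / N) ^ 2))
      ≤ C ^ 2 * (2 * fourthMoment + 2) * (t * (t / n)) := by
    have h1 : (N : ℝ) * (C ^ 2 * ((2 * fourthMoment + 2) * (t / N) ^ 2)) =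
        C ^ 2 * (2 * fourthMoment + 2) * ((N * (t / N)) * (t / N)) := by ring
    rw [h1, hNt]
    have := fourthMoment_nonneg
    have h2 : t / N ≤ t / n := by
      refine div_le_div_of_nonneg_left ht hn' ?_
      rw [hN]; push_cast
      nlinarith
    gcongr
  -- The diagonal contributes `2 * fourthMoment + 2`, each Itô sum 1, and the factor 3 comes from (x
  -- + y + z)² ≤ 3(x² + y² + z²).
  have h3 : 3 * (C ^ 2 * (2 * fourthMoment + 4) * t ^ 2) / n =
      3 * (C ^ 2 * (2 * fourthMoment + 2) * (t * (t / n)) + C ^ 2 * (t / n) * t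
        + C ^ 2 * (t / n) * t) := by
    field_simp; ring
  rw [h3]
  linarith

/-- A union bound with fourth moments: n events of probability O(n⁻²). Second moments would give
only O(1). -/
theorem measureReal_max_gridIncr_le (hB : IsBrownianMotionOn P T B) (ht : 0 ≤ t)
    (htT : t ≤ T) (i : Fin d) {n : ℕ} (hn : 0 < n) {δ : ℝ} (hδ : 0 < δ) :
    P.real {ω | ∃ k < n, δ < |gridIncr B t n i k ω|} ≤ fourthMoment * t ^ 2 / δ ^ 4 / n := by
  have hn' : (0 : ℝ) < n := Nat.cast_pos.2 hn
  have h1 : ∀ k ∈ Finset.range n, P.real {ω | δ < |gridIncr B t n i k ω|}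
      ≤ fourthMoment * (t / n) ^ 2 / δ ^ 4 := fun k hk => by
    have hk := Finset.mem_range.1 hk
    have h4 : ∀ x : ℝ, |x| ^ 4 = x ^ 4 := fun x => by
      rw [show (4 : ℕ) = 2 * 2 by norm_num, pow_mul, sq_abs, pow_mul]
    have hi : Integrable (fun ω => gridIncr B t n i k ω ^ 4) P :=
      ((hB.memLp_gridIncr ht htT i hk 4 (by simp)).integrable_norm_pow
        (p := 4) (by norm_num)).congr (ae_of_all _ fun ω => h4 _)
    have he : ∫ ω, gridIncr B t n i k ω ^ 4 ∂P ≤ fourthMoment * (t / n) ^ 2 := by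
      unfold gridIncr
      rw [hB.integral_coord_pow_four (gridPt_nonneg ht n k) (gridPt_mono ht n k.le_succ)
        (gridPt_mem (T := T) ht htT hk).2 i, gridPt_succ_sub]
    refine le_trans (measureReal_mono fun ω hω => ?_) (measureReal_lt_le_of_integral_le
      (fun ω => by positivity) hi he (K := δ ^ 4) (by positivity))
    simp only [mem_ofPred_eq] at hω ⊢
    have := pow_lt_pow_left₀ hω hδ.le (n := 4) (by norm_num)
    rwa [h4] at this
  have h2 : {ω | ∃ k < n, δ < |gridIncr B t n i k ω|} =
      ⋃ k ∈ Finset.range n, {ω | δ < |gridIncr B t n i k ω|} := by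
    ext ω; simp
  rw [h2]
  refine (measureReal_biUnion_finset_le _ _).trans ((Finset.sum_le_sum h1).trans (le_of_eq ?_))
  rw [Finset.sum_const, Finset.card_range, nsmul_eq_mul]
  field_simp

theorem tightSquares_coord (hB : IsBrownianMotionOn P T B) (ht : 0 ≤ t)
    (htT : t ≤ T) (i : Fin d) : TightSquares P t (fun s ω => B s ω i) := by
  intro ε hε
  refine ⟨(t + 1) / ε, by positivity, fun N => ?_⟩
  have hi : ∀ q ∈ Finset.range N, Integrable (fun ω => gridIncr B t N i q ω ^ 2) P := fun q hq =>
    (hB.memLp_gridIncr ht htT i (Finset.mem_range.1 hq) 2 (by simp)).integrable_sq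
  have h := measureReal_lt_le_of_integral_le (P := P) (g := fun ω => ∑ q ∈ Finset.range N,
    gridIncr B t N i q ω ^ 2) (c := t) (K := (t + 1) / ε)
    (fun ω => Finset.sum_nonneg fun _ _ => sq_nonneg _) (integrable_finsetSum _ hi) (by
      rw [integral_finsetSum _ hi, Finset.sum_congr rfl fun q hq =>
        hB.integral_gridIncr_sq ht htT i (Finset.mem_range.1 hq), Finset.sum_const,
        Finset.card_range, nsmul_eq_mul]
      rcases Nat.eq_zero_or_pos N with rfl | hN
      · simpa using ht
      · have : (0 : ℝ) < N := Nat.cast_pos.2 hN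
        apply le_of_eq; field_simp) (by positivity)
  refine h.trans ?_
  rw [div_div_eq_mul_div, div_le_iff₀ (by positivity)]
  nlinarith

end IsBrownianMotionOn

/-! ### Symmetric sums on nested grids -/

section Partitions

variable {t : ℝ}

/-- The partition of `[0, kt/n]` by the points of the uniform grid of `[0,t]` with `n m` steps. -/
noncomputable def gridPartition (ht : 0 ≤ t) (n k : ℕ) {m : ℕ} (hm : 0 < m) :
    TimePartition (gridPt t n k) where
  N := k * m
  pt := gridPt t (n * m)
  mono := gridPt_mono ht _
  pt_zero := gridPt_zero _
  pt_last := gridPt_mul n k hm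

theorem tendsto_mesh_gridPartition (ht : 0 ≤ t) (n k : ℕ) :
    MeshTendstoZero fun m : ℕ => gridPartition ht n k m.succ_pos := by
  intro δ hδ
  have h : Tendsto (fun m : ℕ => t / n / ((m : ℝ) + 1)) atTop (𝓝 0) :=
    tendsto_const_div_atTop_nhds_zero_nat (t / n) |>.comp (tendsto_add_atTop_nat 1) |>.congr
      fun m => by simp
  filter_upwards [h.eventually_lt_const hδ] with m hm q _
  refine lt_of_eq_of_lt ?_ hm
  simp only [gridPartition]
  rw [gridPt_succ_sub]
  push_cast
  rw [div_div]

variable {Ω : Type*} {d : ℕ} {B : ℝ → Ω → Space d}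

/-- The two partitions share the same fine points, so the difference is the sum over one block.
Replacing the average by the left endpoint leaves half the products of increments. -/
theorem stratonovichSum_gridPartition_sub (ht : 0 ≤ t) (n k : ℕ) {m : ℕ} (hm : 0 < m)
    (Z : ℝ → Ω → ℝ) (j : Fin d) (ω : Ω) :
    stratonovichSum (gridPartition ht n (k + 1) hm) Z (fun s ω => B s ω j) ω -
      stratonovichSum (gridPartition ht n k hm) Z (fun s ω => B s ω j) ω =
    ∑ r ∈ Finset.range m, Z (gridPt t (n * m) (k * m + r)) ω *
      gridIncr B t (n * m) j (k * m + r) ω +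
    1 / 2 * ∑ r ∈ Finset.range m, (Z (gridPt t (n * m) (k * m + r + 1)) ω -
      Z (gridPt t (n * m) (k * m + r)) ω) * gridIncr B t (n * m) j (k * m + r) ω := by
  simp only [stratonovichSum, gridPartition]
  rw [Nat.succ_mul, Finset.sum_range_add, add_sub_cancel_left, Finset.mul_sum,
    ← Finset.sum_add_distrib]
  refine Finset.sum_congr rfl fun r _ => ?_
  simp only [gridIncr]
  ring

theorem sum_gridIncr_block (n k : ℕ) {m : ℕ} (hm : 0 < m) (i : Fin d) (ω : Ω) :
    ∑ r ∈ Finset.range m, gridIncr B t (n * m) i (k * m + r) ω = gridIncr B t n i k ω := by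
  have := Finset.sum_range_sub (fun r => B (gridPt t (n * m) (k * m + r)) ω i) m
  simp only [gridIncr]
  refine this.trans ?_
  rw [add_zero, gridPt_mul n k hm, ← Nat.succ_mul, gridPt_mul n _ hm]

end Partitions

/-! ### Covariation with the Brownian motion -/

section Covariation

variable {Ω : Type*} [mΩ : MeasurableSpace Ω] {P : Measure Ω} [IsProbabilityMeasure P] {d : ℕ}
  {T : ℝ} {B : ℝ → Ω → Space d} {t : ℝ}

theorem IsBoundedAdapted.tendstoInMeasure_riemann {C : ℝ} {Z : ℝ → Ω → ℝ}
    (hZ : IsBoundedAdapted P T B C Z) (ht : 0 ≤ t) (htT : t ≤ T) :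
    TendstoInMeasure P (fun N ω => ∑ q ∈ Finset.range N, Z (gridPt t N q) ω * (t / N)) atTop
      (fun ω => ∫ s in (0 : ℝ)..t, Z s ω) := by
  refine tendstoInMeasure_of_tendsto_ae (fun N => ?_) ?_
  · exact Measurable.aestronglyMeasurable (Finset.measurable_fun_sum _ fun q hq =>
      (hZ.measurable (gridPt_mem ht htT (Finset.mem_range.1 hq).le)).mul_const _)
  · filter_upwards [hZ.continuous] with ω hω
    have := tendsto_riemann_sum ht (y := fun s => Z s ω) (g := fun _ => 1)
      (hω.mono (Icc_subset_Icc_right htT)) intervalIntegrable_const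
    simpa only [intervalIntegral.integral_const, gridPt_succ_sub, smul_eq_mul, mul_one] using this

/-- If sums `∑|u_k|` are tight then `∑ u_k ΔB_k` is small, since the increments of `B` are
uniformly small. -/
theorem IsBrownianMotionOn.small_sum_mul_gridIncr (hB : IsBrownianMotionOn P T B) (ht : 0 ≤ t)
    (htT : t ≤ T) (i : Fin d) {ε K : ℝ} (hε : 0 < ε) (hK : 0 < K) :
    ∀ᶠ n : ℕ in atTop, ∀ u : ℕ → Ω → ℝ,
      P.real {ω | K < ∑ k ∈ Finset.range n, |u k ω|} ≤ ε →
      SmallInProb P (ε + ε) (fun ω => ∑ k ∈ Finset.range n, u k ω * gridIncr B t n i k ω) := by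
  have hδ : 0 < ε / K := by positivity
  have h := tendsto_const_div_atTop_nhds_zero_nat (fourthMoment * t ^ 2 / (ε / K) ^ 4)
  filter_upwards [h.eventually_lt_const hε, eventually_gt_atTop 0] with n hn hn0 u hu
  exact SmallInProb.sum_mul hu ((hB.measureReal_max_gridIncr_le ht htT i hn0 hδ).trans hn.le)
    hδ.le (le_of_eq (by field_simp))

/-- By |½xy| ≤ x² + y², the block terms are dominated by the sums of squared increments of Z and B^j
on the one grid with nm steps. Hence the bound is uniform in both n and m. -/
theorem IsBrownianMotionOn.tight_covariation (hB : IsBrownianMotionOn P T B) (ht : 0 ≤ t)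
    (htT : t ≤ T) (j : Fin d) {Z : ℝ → Ω → ℝ} (hZ : TightSquares P t Z) {ε : ℝ} (hε : 0 < ε) :
    ∃ K > 0, ∀ n m : ℕ, P.real {ω | K < ∑ k ∈ Finset.range n, |1 / 2 * ∑ r ∈ Finset.range m,
      (Z (gridPt t (n * m) (k * m + r + 1)) ω - Z (gridPt t (n * m) (k * m + r)) ω) *
        gridIncr B t (n * m) j (k * m + r) ω|} ≤ ε := by
  obtain ⟨K₁, hK₁, h₁⟩ := hZ (ε / 2) (by positivity)
  obtain ⟨K₂, hK₂, h₂⟩ := hB.tightSquares_coord ht htT j (ε / 2) (by positivity)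
  refine ⟨K₁ + K₂, by positivity, fun n m => ?_⟩
  refine (measureReal_mono (s₂ := {ω | K₁ < ∑ q ∈ Finset.range (n * m),
      (Z (gridPt t (n * m) (q + 1)) ω - Z (gridPt t (n * m) q) ω) ^ 2} ∪
    {ω | K₂ < ∑ q ∈ Finset.range (n * m), (B (gridPt t (n * m) (q + 1)) ω j -
      B (gridPt t (n * m) q) ω j) ^ 2}) fun ω hω => ?_).trans
    ((measureReal_union_le _ _).trans ((add_le_add (h₁ _) (h₂ _)).trans_eq (by ring)))
  by_contra hcon
  simp only [mem_union, mem_ofPred_eq, not_or, not_lt] at hcon hω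
  have h3 : ∑ k ∈ Finset.range n, |1 / 2 * ∑ r ∈ Finset.range m,
      (Z (gridPt t (n * m) (k * m + r + 1)) ω - Z (gridPt t (n * m) (k * m + r)) ω) *
        gridIncr B t (n * m) j (k * m + r) ω| ≤ ∑ q ∈ Finset.range (n * m),
      ((Z (gridPt t (n * m) (q + 1)) ω - Z (gridPt t (n * m) q) ω) ^ 2 +
      (B (gridPt t (n * m) (q + 1)) ω j - B (gridPt t (n * m) q) ω j) ^ 2) := by
    rw [sum_range_mul_eq]
    refine Finset.sum_le_sum fun k _ => ?_
    rw [Finset.mul_sum]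
    refine (Finset.abs_sum_le_sum_abs _ _).trans (Finset.sum_le_sum fun r _ => ?_)
    simp only [gridIncr]
    generalize Z (gridPt t (n * m) (k * m + r + 1)) ω - Z (gridPt t (n * m) (k * m + r)) ω = x
    generalize B (gridPt t (n * m) (k * m + r + 1)) ω j - B (gridPt t (n * m) (k * m + r)) ω j = y
    rw [abs_le]
    constructor <;> nlinarith [sq_nonneg (x + y), sq_nonneg (x - y)]
  rw [Finset.sum_add_distrib] at h3
  linarith [hcon.1, hcon.2]

/-- The covariation of `B^i` with a process `Y` that is the sum of a drift and of Stratonovich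
integrals of processes `Z j` against `B^j`. -/
theorem tendstoInMeasure_covariation (hB : IsBrownianMotionOn P T B) (ht : 0 ≤ t)
    (htT : t ≤ T) (i : Fin d) {Y D : ℝ → Ω → ℝ} {Z : Fin d → ℝ → Ω → ℝ} {C b y₀ : ℝ}
    (hZ : ∀ j, IsBoundedAdapted P T B C (Z j)) (hZt : ∀ j, TightSquares P t (Z j))
    (hD : ∀ᵐ ω ∂P, ∀ n : ℕ, ∑ k ∈ Finset.range n,
      |D (gridPt t n (k + 1)) ω - D (gridPt t n k) ω| ≤ b)
    (hY : ∀ s ∈ Icc 0 t, ∃ S : Fin d → Ω → ℝ,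
      (∀ j, IsStratonovichIntegral P s (Z j) (fun s ω => B s ω j) (S j)) ∧
      ∀ᵐ ω ∂P, Y s ω = y₀ + D s ω + ∑ j, S j ω) :
    TendstoInMeasure P (fun n ω => ∑ k ∈ Finset.range n,
      (Y (gridPt t n (k + 1)) ω - Y (gridPt t n k) ω) * gridIncr B t n i k ω) atTop
      (fun ω => ∫ s in (0 : ℝ)..t, Z i s ω) := by
  rw [tendstoInMeasure_iff_small]
  intro ε hε
  have hC0 : 0 ≤ max C 0 := le_max_right _ _
  have hZ' : ∀ j, IsBoundedAdapted P T B (max C 0) (Z j) := fun j =>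
    ⟨(hZ j).adapted, fun t ω => ((hZ j).bounded t ω).trans (le_max_left _ _), (hZ j).continuous⟩
  -- The budget is (2d + 3)η: one each for the drift, the Stratonovich approximation and the Riemann
  -- sum, and d each for the product and Itô errors.
  set η : ℝ := ε / (2 * d + 4) with hη
  have hη0 : 0 < η := by positivity
  have hη2 : 0 < η / 2 := by positivity
  have hdrift : ∀ᶠ n : ℕ in atTop, SmallInProb P η (fun ω => ∑ k ∈ Finset.range n,
      (D (gridPt t n (k + 1)) ω - D (gridPt t n k) ω) * gridIncr B t n i k ω) := by
    filter_upwards [hB.small_sum_mul_gridIncr ht htT i hη2 (K := |b| + 1) (by positivity)] with n hn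
    refine (hn (fun k ω => D (gridPt t n (k + 1)) ω - D (gridPt t n k) ω) ?_).mono (by linarith)
    refine le_of_eq_of_le ?_ hη2.le
    rw [measureReal_eq_zero_iff]
    refine measure_mono_null (fun ω hω => ?_) (ae_iff.1 hD)
    simp only [mem_ofPred_eq] at hω ⊢
    intro hb
    linarith [hb n, le_abs_self b]
  have hcov : ∀ j, ∀ᶠ n : ℕ in atTop, ∀ m : ℕ, SmallInProb P η (fun ω => ∑ k ∈ Finset.range n,
      (1 / 2 * ∑ r ∈ Finset.range m, (Z j (gridPt t (n * m) (k * m + r + 1)) ω -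
        Z j (gridPt t (n * m) (k * m + r)) ω) * gridIncr B t (n * m) j (k * m + r) ω) *
        gridIncr B t n i k ω) := fun j => by
    obtain ⟨K, hK, h⟩ := hB.tight_covariation ht htT j (hZt j) hη2
    filter_upwards [hB.small_sum_mul_gridIncr ht htT i hη2 hK] with n hn m
    exact (hn _ (h n m)).mono (by linarith)
  have hito : ∀ᶠ n : ℕ in atTop, ∀ j, ∀ m > 0, SmallInProb P η (fun ω => ∑ k ∈ Finset.range n,
      (∑ r ∈ Finset.range m, Z j (gridPt t (n * m) (k * m + r)) ω *
        gridIncr B t (n * m) j (k * m + r) ω) *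
      (∑ r ∈ Finset.range m, gridIncr B t (n * m) i (k * m + r) ω) -
      ∑ q ∈ Finset.range (n * m), Z j (gridPt t (n * m) q) ω *
        (if j = i then t / (n * m : ℕ) else 0)) := by
    have h := tendsto_const_div_atTop_nhds_zero_nat
      (3 * ((max C 0) ^ 2 * (2 * fourthMoment + 4) * t ^ 2))
    filter_upwards [h.eventually_lt_const (u := η ^ 3) (by positivity), eventually_gt_atTop 0]
      with n hn hn0 j m hm
    obtain ⟨h1, h2⟩ := hB.integral_block_covariation_sq_le ht htT i j hn0 hm hC0 (hZ' j)
    exact small_of_integral_sq_le hη0 h1 (h2.trans hn.le)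
  -- The coarse n is fixed here, with bounds valid for all m. Only then is m taken large, depending
  -- on n, so that the finitely many Stratonovich integrals and the Riemann sum are well
  -- approximated.
  filter_upwards [hdrift, eventually_all.2 hcov, hito, eventually_gt_atTop 0]
    with n hn1 hn2 hn3 hn0
  choose S hS hYS using fun k : ℕ => fun hk : k ≤ n =>
    hY (gridPt t n k) ⟨gridPt_nonneg ht n k, gridPt_le ht hk⟩
  have hSk : ∀ k (hk : k ≤ n) j, TendstoInMeasure P (fun m : ℕ =>
      stratonovichSum (gridPartition ht n k m.succ_pos) (Z j) (fun s ω => B s ω j)) atTop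
      (S k hk j) := fun k hk j => hS k hk j _ (tendsto_mesh_gridPartition ht n k)
  have hstrat : TendstoInMeasure P (fun (m : ℕ) ω => ∑ k ∈ (Finset.range n).attach, (∑ j,
      (stratonovichSum (gridPartition ht n (k.1 + 1) m.succ_pos) (Z j) (fun s ω => B s ω j) ω -
      stratonovichSum (gridPartition ht n k.1 m.succ_pos) (Z j) (fun s ω => B s ω j) ω)) *
      gridIncr B t n i k ω) atTop
      (fun ω => ∑ k ∈ (Finset.range n).attach,
        (∑ j, (S (k.1 + 1) (Finset.mem_range.1 k.2) j ω -
        S k.1 (Finset.mem_range.1 k.2).le j ω)) * gridIncr B t n i k ω) := by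
    refine tendstoInMeasure_sum fun k _ => tendstoInMeasure_mul_const (tendstoInMeasure_sum
      fun j _ => tendstoInMeasure_sub (hSk _ _ j) (hSk _ _ j)) ?_
    exact ((hB.stronglyMeasurable_gridIncr ht htT i (Finset.mem_range.1 k.2)).mono
      ((gridFiltration P T B ht n).le _)).measurable
  have hriem : TendstoInMeasure P (fun (m : ℕ) ω => ∑ q ∈ Finset.range (n * (m + 1)),
      Z i (gridPt t (n * (m + 1)) q) ω * (t / (n * (m + 1) : ℕ))) atTop
      (fun ω => ∫ s in (0 : ℝ)..t, Z i s ω) :=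
    ((hZ i).tendstoInMeasure_riemann ht htT).comp (ns := fun m : ℕ => n * (m + 1))
      (tendsto_atTop_mono (fun m => m.le_succ.trans (Nat.le_mul_of_pos_left _ hn0)) tendsto_id)
  rw [tendstoInMeasure_iff_small] at hstrat hriem
  obtain ⟨m, hm1, hm2⟩ := ((hstrat η hη0).and (hriem η hη0)).exists
  have hm3 := SmallInProb.sum (s := Finset.univ) fun j _ => hn2 j (m + 1)
  have hm4 := SmallInProb.sum (s := Finset.univ) fun j _ => hn3 j (m + 1) m.succ_pos
  have hm1' : SmallInProb P η (fun ω => -1 * (∑ k ∈ (Finset.range n).attach, (∑ j,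
      (stratonovichSum (gridPartition ht n (k.1 + 1) m.succ_pos) (Z j) (fun s ω => B s ω j) ω -
      stratonovichSum (gridPartition ht n k.1 m.succ_pos) (Z j) (fun s ω => B s ω j) ω)) *
      gridIncr B t n i k ω - ∑ k ∈ (Finset.range n).attach,
        (∑ j, (S (k.1 + 1) (Finset.mem_range.1 k.2) j ω -
        S k.1 (Finset.mem_range.1 k.2).le j ω)) * gridIncr B t n i k ω)) :=
    hm1.of_abs_le (ae_of_all _ fun ω => by rw [abs_mul]; simp)
  have htot := ((((hn1.add hm1').add hm3).add hm4).add hm2)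
  rw [Finset.card_univ, Fintype.card_fin] at htot
  refine (htot.mono ?_).congr ?_
  · have : η * (2 * d + 4) = ε := by rw [hη]; field_simp
    nlinarith
  · have hYS' : ∀ᵐ ω ∂P, ∀ k (hk : k ≤ n), Y (gridPt t n k) ω =
        y₀ + D (gridPt t n k) ω + ∑ j, S k hk j ω :=
      ae_all_iff.2 fun k => ae_all_iff.2 fun hk => hYS k hk
    filter_upwards [hYS'] with ω hω
    rw [← Finset.sum_attach (Finset.range n) (fun k => (Y (gridPt t n (k + 1)) ω -
      Y (gridPt t n k) ω) * gridIncr B t n i k ω)]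
    have e1 : ∀ k : {x // x ∈ Finset.range n}, (Y (gridPt t n (k.1 + 1)) ω -
        Y (gridPt t n k.1) ω) * gridIncr B t n i k ω =
        (D (gridPt t n (k.1 + 1)) ω - D (gridPt t n k.1) ω) * gridIncr B t n i k ω +
        (∑ j, (S (k.1 + 1) (Finset.mem_range.1 k.2) j ω -
          S k.1 (Finset.mem_range.1 k.2).le j ω)) * gridIncr B t n i k ω := fun k => by
      rw [hω _ (Finset.mem_range.1 k.2).le, hω _ (Nat.succ_le_of_lt (Finset.mem_range.1 k.2)),
        Finset.sum_sub_distrib]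
      ring
    simp only [e1, Finset.sum_add_distrib]
    rw [Finset.sum_attach (Finset.range n) (fun k => (D (gridPt t n (k + 1)) ω -
      D (gridPt t n k) ω) * gridIncr B t n i k ω)]
    have e2 : ∑ k ∈ (Finset.range n).attach, (∑ j,
        (stratonovichSum (gridPartition ht n (k.1 + 1) m.succ_pos) (Z j) (fun s ω => B s ω j) ω -
        stratonovichSum (gridPartition ht n k.1 m.succ_pos) (Z j) (fun s ω => B s ω j) ω)) *
        gridIncr B t n i k ω =
        ∑ j, ∑ k ∈ Finset.range n, (∑ r ∈ Finset.range (m + 1),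
          Z j (gridPt t (n * (m + 1)) (k * (m + 1) + r)) ω *
            gridIncr B t (n * (m + 1)) j (k * (m + 1) + r) ω) *
          (∑ r ∈ Finset.range (m + 1), gridIncr B t (n * (m + 1)) i (k * (m + 1) + r) ω) +
        ∑ j, ∑ k ∈ Finset.range n, (1 / 2 * ∑ r ∈ Finset.range (m + 1),
          (Z j (gridPt t (n * (m + 1)) (k * (m + 1) + r + 1)) ω -
            Z j (gridPt t (n * (m + 1)) (k * (m + 1) + r)) ω) *
            gridIncr B t (n * (m + 1)) j (k * (m + 1) + r) ω) * gridIncr B t n i k ω := by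
      rw [Finset.sum_attach (Finset.range n) (fun k => (∑ j,
        (stratonovichSum (gridPartition ht n (k + 1) m.succ_pos) (Z j) (fun s ω => B s ω j) ω -
        stratonovichSum (gridPartition ht n k m.succ_pos) (Z j) (fun s ω => B s ω j) ω)) *
        gridIncr B t n i k ω), ← Finset.sum_add_distrib]
      simp only [stratonovichSum_gridPartition_sub, sum_gridIncr_block n _ m.succ_pos,
        Finset.sum_mul]
      rw [Finset.sum_comm]
      refine Finset.sum_congr rfl fun j _ => ?_
      rw [← Finset.sum_add_distrib]
      refine Finset.sum_congr rfl fun k _ => ?_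
      rw [add_mul, Finset.sum_mul]
    -- Distinct coordinates of B have zero covariation, so only j = i survives.
    have e3 : ∑ j, ∑ q ∈ Finset.range (n * (m + 1)), Z j (gridPt t (n * (m + 1)) q) ω *
        (if j = i then t / (n * (m + 1) : ℕ) else 0) =
        ∑ q ∈ Finset.range (n * (m + 1)), Z i (gridPt t (n * (m + 1)) q) ω *
          (t / (n * (m + 1) : ℕ)) := by
      rw [Finset.sum_eq_single i]
      · simp
      · intro j _ hj; simp [hj]
      · simp
    rw [e2, Finset.sum_sub_distrib, e3]
    ring

end Covariation

/-! ### From convergence in probability to convergence of means -/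

section WeakConvergence

variable {Ω : Type*} {mΩ : MeasurableSpace Ω} {P : Measure Ω} [IsFiniteMeasure P]

/-- A sequence that is bounded in `L²` and tends to `0` in probability tends to `0` weakly. -/
theorem tendsto_integral_mul_of_tendstoInMeasure {F : Ω → ℝ} {g : ℕ → Ω → ℝ} {M : ℝ}
    (hF : MemLp F 2 P) (hg : ∀ n, MemLp (g n) 2 P) (hM : ∀ n, ∫ ω, g n ω ^ 2 ∂P ≤ M)
    (h : TendstoInMeasure P g atTop (fun _ => 0)) :
    Tendsto (fun n => ∫ ω, F ω * g n ω ∂P) atTop (𝓝 0) := by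
  rw [tendstoInMeasure_iff_small] at h
  simp only [sub_zero] at h
  set a := ∫ ω, |F ω| ∂P with ha
  have ha0 : 0 ≤ a := integral_nonneg fun _ => abs_nonneg _
  have hFi : Integrable F P := hF.integrable (by norm_num)
  rw [Metric.tendsto_atTop]
  intro ε hε
  set η := ε / (a + √M + 1) with hη
  have hden : 0 < a + √M + 1 := by positivity
  have hη0 : 0 < η := by positivity
  -- Absolute continuity of the L² norm of F. Where g_n is large, a set of probability at most δ,
  -- Cauchy–Schwarz applies; elsewhere |g_n| ≤ η.
  obtain ⟨δ, hδ, hδF⟩ := hF.eLpNorm_indicator_le (by norm_num) (by simp) hη0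
  obtain ⟨N, hN⟩ := eventually_atTop.1 (h (min η δ) (lt_min hη0 hδ))
  refine ⟨N, fun n hn => ?_⟩
  -- A measurable representative makes the exceptional set A measurable.
  set f : Ω → ℝ := (hg n).1.mk with hf
  have hfm : StronglyMeasurable f := (hg n).1.stronglyMeasurable_mk
  have hfg : g n =ᵐ[P] f := (hg n).1.ae_eq_mk
  have hf2 : MemLp f 2 P := (hg n).ae_eq hfg
  have hsmall := (hN n hn).congr (f := f) hfg.symm
  set A := {ω | min η δ < |f ω|} with hA
  have hAm : MeasurableSet A := measurableSet_lt measurable_const hfm.measurable.abs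
  have hPA : P A ≤ ENNReal.ofReal δ := by
    rw [← ofReal_measureReal]
    exact ENNReal.ofReal_le_ofReal (le_trans hsmall (min_le_right _ _))
  have hFA := hF.indicator hAm
  have h1 := hδF A hAm hPA
  rw [eLpNorm_two_eq_ofReal_sqrt hFA, ENNReal.ofReal_le_ofReal_iff hη0.le] at h1
  have h2 := abs_integral_mul_le (hFA.norm) (hf2.norm)
  simp only [Real.norm_eq_abs, sq_abs] at h1 h2
  have h3 : ∫ ω, f ω ^ 2 ∂P ≤ M := by
    refine le_trans (le_of_eq (integral_congr_ae ?_)) (hM n)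
    filter_upwards [hfg] with ω hω
    rw [hω]
  have h4 : |∫ ω, |A.indicator F ω| * |f ω| ∂P| ≤ η * √M :=
    h2.trans (mul_le_mul h1 (Real.sqrt_le_sqrt h3) (Real.sqrt_nonneg _) hη0.le)
  have hi : Integrable (fun ω => |A.indicator F ω| * |f ω|) P := hFA.norm.integrable_mul hf2.norm
  have h5 : ∫ ω, |F ω * f ω| ∂P ≤ ∫ ω, (η * |F ω| + |A.indicator F ω| * |f ω|) ∂P := by
    refine integral_mono (hF.integrable_mul hf2).norm ((hFi.norm.const_mul η).add hi)
      fun ω => ?_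
    simp only [abs_mul]
    by_cases hω : ω ∈ A
    · rw [indicator_of_mem hω]
      have := mul_nonneg hη0.le (abs_nonneg (F ω))
      linarith
    · rw [indicator_of_notMem hω, abs_zero, zero_mul, add_zero, mul_comm]
      have : |f ω| ≤ min η δ := not_lt.1 hω
      exact mul_le_mul_of_nonneg_right (this.trans (min_le_left _ _)) (abs_nonneg _)
  rw [integral_add (f := fun ω => η * |F ω|) (hFi.norm.const_mul η) hi, integral_const_mul] at h5
  have h6 : ∫ ω, F ω * g n ω ∂P = ∫ ω, F ω * f ω ∂P := by
    refine integral_congr_ae ?_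
    filter_upwards [hfg] with ω hω
    rw [hω]
  rw [Real.dist_0_eq_abs, h6]
  have h7 : |∫ ω, F ω * f ω ∂P| ≤ η * a + η * √M :=
    (abs_integral_le_integral_abs).trans (h5.trans (add_le_add le_rfl ((le_abs_self _).trans h4)))
  have h8 : η * (a + √M + 1) = ε := by rw [hη]; field_simp
  linarith

end WeakConvergence

/-! ### Means of Itô and Stratonovich integrals against a stochastic exponential -/

section Expectation

theorem intervalIntegrable_coord {d : ℕ} {T t : ℝ} {h : ℝ → Space d}
    (hh : MemLp h 2 (timeMeasure T)) (ht : 0 ≤ t) (htT : t ≤ T) (i : Fin d) :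
    IntervalIntegrable (fun s => h s i) volume 0 t := by
  rw [intervalIntegrable_iff_integrableOn_Icc_of_le ht]
  have h1 : MemLp (fun s => h s i) 2 (timeMeasure T) := hh.mono
    ((EuclideanSpace.proj (𝕜 := ℝ) i).continuous.comp_aestronglyMeasurable hh.1)
    (ae_of_all _ fun s => PiLp.norm_apply_le _ i)
  exact IntegrableOn.mono_set (h1.integrable (by norm_num)) (Icc_subset_Icc_right htT)

theorem stratonovichSum_gridPartition_eq {Ω : Type*} {d : ℕ} {B : ℝ → Ω → Space d} {t : ℝ}
    (ht : 0 ≤ t) {n : ℕ} (hn : 0 < n) (Y : ℝ → Ω → ℝ) (i : Fin d) (ω : Ω) : stratonovichSum (gridPartition ht 1 1 hn) Y (fun s ω => B s ω i) ω =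
    ∑ q ∈ Finset.range n, Y (gridPt t n q) ω * gridIncr B t n i q ω +
    1 / 2 * ∑ q ∈ Finset.range n, (Y (gridPt t n (q + 1)) ω - Y (gridPt t n q) ω) *
      gridIncr B t n i q ω := by
  simp only [stratonovichSum, gridPartition, one_mul]
  rw [Finset.mul_sum, ← Finset.sum_add_distrib]
  refine Finset.sum_congr rfl fun r _ => ?_
  simp only [gridIncr]
  ring

variable {Ω : Type*} [mΩ : MeasurableSpace Ω] {P : Measure Ω} {d : ℕ}
  {T : ℝ} {B : ℝ → Ω → Space d} {t : ℝ}

theorem IsBoundedAdapted.continuousOn_integral {C : ℝ} {Y : ℝ → Ω → ℝ}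
    (hY : IsBoundedAdapted P T B C Y) {F : Ω → ℝ} (hF : Integrable F P) :
    ContinuousOn (fun s => ∫ ω, F ω * Y s ω ∂P) (Icc 0 T) := by
  refine continuousOn_of_dominated (bound := fun ω => |F ω| * C) (fun s hs => ?_) (fun s _ => ?_)
    (hF.norm.mul_const C) ?_
  · exact hF.1.mul (hY.measurable hs).aestronglyMeasurable
  · refine ae_of_all _ fun ω => ?_
    rw [norm_mul]
    exact mul_le_mul_of_nonneg_left (hY.bounded s ω) (norm_nonneg _)
  · filter_upwards [hY.continuous] with ω hω
    exact continuousOn_const.mul hω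

theorem tendsto_integral_riemann_sum {F : Ω → ℝ} (hF : Integrable F P) (ht : 0 ≤ t)
    (htT : t ≤ T) {C : ℝ} {Z : ℝ → Ω → ℝ} (hZ : IsBoundedAdapted P T B C Z) :
    Tendsto (fun n : ℕ => ∫ ω, F ω * ∑ q ∈ Finset.range n, Z (gridPt t n q) ω * (t / n) ∂P) atTop
      (𝓝 (∫ s in (0 : ℝ)..t, ∫ ω, F ω * Z s ω ∂P)) := by
  have h := tendsto_riemann_sum ht ((hZ.continuousOn_integral hF).mono
    (Icc_subset_Icc_right htT)) (g := fun _ => 1) intervalIntegrable_const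
  simp only [intervalIntegral.integral_const, gridPt_succ_sub, smul_eq_mul, mul_one] at h
  refine h.congr fun n => ?_
  simp only [Finset.mul_sum]
  have hi : ∀ q ∈ Finset.range n, Integrable (fun ω => F ω * (Z (gridPt t n q) ω * (t / n))) P :=
    fun q hq => by
      have := (hF.mul_bdd (c := C) (hZ.measurable (gridPt_mem ht htT
        (Finset.mem_range.1 hq).le)).aestronglyMeasurable
        (ae_of_all _ fun ω => hZ.bounded _ ω)).mul_const (t / n)
      refine this.congr (ae_of_all _ fun ω => ?_)
      simp only; ring
  rw [integral_finsetSum _ hi]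
  refine Finset.sum_congr rfl fun q _ => ?_
  rw [← integral_mul_const]
  congr with ω; ring

variable [IsProbabilityMeasure P]

/-- The mean of the Itô sums against a stochastic exponential. -/
theorem tendsto_integral_ito_sum {h : ℝ → Space d} {F : Ω → ℝ}
    (hF : IsStochasticExponential P T B h F) (hB : IsBrownianMotionOn P T B) (ht : 0 ≤ t)
    (htT : t ≤ T) (i : Fin d) {C : ℝ} {Y : ℝ → Ω → ℝ} (hY : IsBoundedAdapted P T B C Y) :
    Tendsto (fun n : ℕ => ∫ ω, F ω * ∑ q ∈ Finset.range n, Y (gridPt t n q) ω *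
      gridIncr B t n i q ω ∂P) atTop
      (𝓝 (∫ s in (0 : ℝ)..t, (∫ ω, F ω * Y s ω ∂P) * h s i)) := by
  have hT := ht.trans htT
  have hF2 := hF.memLp_two hT hB
  refine (tendsto_riemann_sum ht ((hY.continuousOn_integral (hF2.integrable (by norm_num))).mono
    (Icc_subset_Icc_right htT)) (intervalIntegrable_coord hF.1 ht htT i)).congr fun n => ?_
  simp only [Finset.mul_sum]
  have hi : ∀ q ∈ Finset.range n, Integrable (fun ω => F ω * (Y (gridPt t n q) ω *
      gridIncr B t n i q ω)) P := fun q hq => by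
    have hq := Finset.mem_range.1 hq
    refine hF2.integrable_mul (q := 2) (g := fun ω => Y (gridPt t n q) ω * gridIncr B t n i q ω) ?_
    refine ((hB.memLp_gridIncr ht htT i hq 2 (by simp)).const_mul C).mono
      ((hY.measurable (gridPt_mem ht htT hq.le)).aestronglyMeasurable.mul
      (hB.memLp_gridIncr ht htT i hq 2 (by simp)).1) (ae_of_all _ fun ω => ?_)
    rw [norm_mul, norm_mul]
    exact mul_le_mul_of_nonneg_right ((hY.bounded _ _).trans (le_abs_self _)) (norm_nonneg _)
  rw [integral_finsetSum _ hi]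
  refine Finset.sum_congr rfl fun q hq => ?_
  have hq := Finset.mem_range.1 hq
  exact (hF.integral_mul_increment hT hB (gridPt_nonneg ht n q) (gridPt_mono ht n q.le_succ)
    (gridPt_mem (T := T) ht htT hq).2 (hY.adapted _ (gridPt_mem ht htT hq.le))
    (hY.bounded _) i).symm

/-- The mean of a bounded sum of Stratonovich integrals against a stochastic exponential. -/
theorem integral_mul_stratonovich {h : ℝ → Space d} {F : Ω → ℝ}
    (hF : IsStochasticExponential P T B h F) (hB : IsBrownianMotionOn P T B) (ht : 0 ≤ t)
    (htT : t ≤ T) {C b : ℝ} {Y Z : Fin d → ℝ → Ω → ℝ} {S : Fin d → Ω → ℝ}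
    (hY : ∀ i, IsBoundedAdapted P T B C (Y i)) (hZ : ∀ i, IsBoundedAdapted P T B C (Z i))
    (hS : ∀ i, IsStratonovichIntegral P t (Y i) (fun s ω => B s ω i) (S i))
    (hcov : ∀ i, TendstoInMeasure P (fun n ω => ∑ k ∈ Finset.range n,
      (Y i (gridPt t n (k + 1)) ω - Y i (gridPt t n k) ω) * gridIncr B t n i k ω) atTop
      (fun ω => ∫ s in (0 : ℝ)..t, Z i s ω))
    (hb : ∀ᵐ ω ∂P, |∑ i, S i ω| ≤ b) :
    ∫ ω, F ω * ∑ i, S i ω ∂P = (∑ i, ∫ s in (0 : ℝ)..t, (∫ ω, F ω * Y i s ω ∂P) * h s i) +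
      1 / 2 * ∑ i, ∫ s in (0 : ℝ)..t, ∫ ω, F ω * Z i s ω ∂P := by
  have hT := ht.trans htT
  have hF2 := hF.memLp_two hT hB
  have hFi : Integrable F P := hF2.integrable (by norm_num)
  -- `gridPartition ht 1 1` partitions [0, `gridPt t 1 1`]; this equality identifies its endpoint
  -- with t.
  have ht1 : gridPt t 1 1 = t := gridPt_last one_pos
  have hstrat : ∀ i, TendstoInMeasure P (fun n : ℕ => stratonovichSum
      (gridPartition ht 1 1 n.succ_pos) (Y i) (fun s ω => B s ω i)) atTop (S i) := fun i => by
    have h1 : IsStratonovichIntegral P (gridPt t 1 1) (Y i) (fun s ω => B s ω i) (S i) := by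
      rw [ht1]; exact hS i
    exact h1 _ (tendsto_mesh_gridPartition ht 1 1)
  have hshift : ∀ {f : ℕ → Ω → ℝ} {g : Ω → ℝ}, TendstoInMeasure P f atTop g →
      TendstoInMeasure P (fun n => f (n + 1)) atTop g := fun hf => hf.comp (tendsto_add_atTop_nat 1)
  set It : Fin d → ℕ → Ω → ℝ := fun i n ω => ∑ q ∈ Finset.range n, Y i (gridPt t n q) ω *
      gridIncr B t n i q ω with hIt
  set Ri : Fin d → ℕ → Ω → ℝ := fun i n ω => ∑ q ∈ Finset.range n, Z i (gridPt t n q) ω * (t / n)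
    with hRi
  set R : Ω → ℝ := fun ω => ∑ i, S i ω with hR
  -- The symmetric sums minus half the products of increments are Itô sums. Adding half the bounded
  -- Riemann sums, which have the same limit as the products, recovers S_i with approximants bounded
  -- in L².
  have hconv : ∀ i, TendstoInMeasure P (fun n ω => It i (n + 1) ω + Ri i (n + 1) ω * (1 / 2)) atTop
      (S i) := fun i => by
    have h1 := tendstoInMeasure_mul_const (hshift (hcov i)) (c := fun _ => (1 / 2 : ℝ))
      measurable_const
    have h2 := tendstoInMeasure_mul_const (hshift ((hZ i).tendstoInMeasure_riemann ht htT))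
      (c := fun _ => (1 / 2 : ℝ)) measurable_const
    have h3 := tendstoInMeasure_add (tendstoInMeasure_sub (hstrat i) h1) h2
    refine h3.congr (fun n => ae_of_all _ fun ω => ?_) (ae_of_all _ fun ω => ?_)
    · simp only [stratonovichSum_gridPartition_eq, hIt, hRi]
      ring
    · ring
  have hSm : ∀ i, AEStronglyMeasurable (S i) P := fun i =>
    (hstrat i).aestronglyMeasurable fun n => Measurable.aestronglyMeasurable <| by
      simp only
      refine Finset.measurable_fun_sum _ fun q hq => ?_
      have hq : q < 1 * (n + 1) := Finset.mem_range.1 hq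
      have m1 := (hY i).measurable (gridPt_mem (N := 1 * (n + 1)) ht htT hq.le)
      have m2 := (hY i).measurable (gridPt_mem (N := 1 * (n + 1)) ht htT hq)
      have m3 := ((hB.stronglyMeasurable_gridIncr (N := 1 * (n + 1)) ht htT i hq).mono
        ((gridFiltration P T B ht _).le _)).measurable
      exact ((m1.add m2).div_const 2).mul m3
  -- Only the total over i is known to be bounded, so the limit is taken for the sum and not
  -- coordinatewise.
  have hRL : MemLp R 2 P := MemLp.of_bound
    (Finset.aestronglyMeasurable_fun_sum _ fun i _ => hSm i) b hb
  have hItL : ∀ i n, MemLp (It i n) 2 P ∧ ∫ ω, It i n ω ^ 2 ∂P ≤ C ^ 2 * t := fun i n => by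
    obtain ⟨-, h1, h2⟩ := hB.integral_ito_sum_sq_le (N := n) ht htT i (a := 0) (r := n) (by omega)
      (w := fun q => Y i (gridPt t n q)) (c := C ^ 2)
      (fun q hq => (hY i).adapted _ (gridPt_mem ht htT hq.le))
      (fun q hq => (hY i).memLp (gridPt_mem ht htT hq.le) 2) (fun q hq => by
        have h6 : ∫ ω, Y i (gridPt t n q) ω ^ 2 ∂P ≤ ∫ _, C ^ 2 ∂P :=
          integral_mono ((hY i).memLp (gridPt_mem ht htT hq.le) 2).integrable_sq
            (integrable_const _) fun ω => by
              simp only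
              rw [← sq_abs]
              exact pow_le_pow_left₀ (abs_nonneg _) ((hY i).bounded _ _) 2
        simpa using h6)
    simp only [zero_add] at h1 h2
    refine ⟨h1, h2.trans (mul_le_mul_of_nonneg_left ?_ (sq_nonneg C))⟩
    rcases Nat.eq_zero_or_pos n with rfl | hn
    · simpa using ht
    · have : (0 : ℝ) < n := Nat.cast_pos.2 hn
      apply le_of_eq; field_simp
  have hRib : ∀ i n ω, |Ri i n ω| ≤ |C| * t := fun i n ω => by
    refine (Finset.abs_sum_le_sum_abs _ _).trans ?_
    have h1 : ∀ q ∈ Finset.range n, |Z i (gridPt t n q) ω * (t / n)| ≤ |C| * (t / n) := fun q _ => by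
      have h0 : 0 ≤ t / n := by positivity
      rw [abs_mul, abs_of_nonneg h0]
      exact mul_le_mul_of_nonneg_right (((hZ i).bounded _ _).trans (le_abs_self C)) h0
    refine (Finset.sum_le_sum h1).trans ?_
    rw [Finset.sum_const, Finset.card_range, nsmul_eq_mul]
    rcases Nat.eq_zero_or_pos n with rfl | hn
    · simp; positivity
    · have : (0 : ℝ) < n := Nat.cast_pos.2 hn
      apply le_of_eq; field_simp
  have hRiL : ∀ i n, MemLp (Ri i n) 2 P := fun i n => MemLp.of_bound
    (Measurable.aestronglyMeasurable (Finset.measurable_fun_sum _ fun q hq =>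
      ((hZ i).measurable (gridPt_mem ht htT (Finset.mem_range.1 hq).le)).mul_const _)) _
    (ae_of_all _ fun ω => hRib i n ω)
  set g : ℕ → Ω → ℝ := fun n ω => ∑ i, (It i (n + 1) ω + Ri i (n + 1) ω * (1 / 2)) - R ω with hg
  have hgL : ∀ n, MemLp (g n) 2 P := fun n =>
    (memLp_finsetSum _ fun i _ => (hItL i (n + 1)).1.add ((hRiL i (n + 1)).mul_const _)).sub hRL
  have hg0 : TendstoInMeasure P g atTop (fun _ => 0) := by
    have h1 := tendstoInMeasure_sum (s := Finset.univ) fun i _ => hconv i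
    have h2 : TendstoInMeasure P (fun (_ : ℕ) => R) atTop R :=
      tendstoInMeasure_of_tendsto_ae (fun _ => hRL.1) (ae_of_all _ fun _ => tendsto_const_nhds)
    refine (tendstoInMeasure_sub h1 h2).congr_right (ae_of_all _ fun ω => ?_)
    simp [hR]
  have hgM : ∀ n, ∫ ω, g n ω ^ 2 ∂P ≤
      2 * (d * ∑ _i : Fin d, (2 * (C ^ 2 * t) + (|C| * t) ^ 2)) + 2 * b ^ 2 := fun n => by
    have hpt : ∀ᵐ ω ∂P, g n ω ^ 2 ≤
        2 * (d * ∑ i, (2 * It i (n + 1) ω ^ 2 + (|C| * t) ^ 2)) + 2 * b ^ 2 := by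
      filter_upwards [hb] with ω hω
      have h1 := sq_sum_le_card_mul_sum_sq (s := Finset.univ)
        (f := fun i => It i (n + 1) ω + Ri i (n + 1) ω * (1 / 2))
      rw [Finset.card_univ, Fintype.card_fin] at h1
      have h2 : ∑ i, (It i (n + 1) ω + Ri i (n + 1) ω * (1 / 2)) ^ 2 ≤
          ∑ i, (2 * It i (n + 1) ω ^ 2 + (|C| * t) ^ 2) := by
        refine Finset.sum_le_sum fun i _ => ?_
        have h3 := pow_le_pow_left₀ (abs_nonneg _) (hRib i (n + 1) ω) 2
        rw [sq_abs] at h3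
        nlinarith [sq_nonneg (It i (n + 1) ω - Ri i (n + 1) ω * (1 / 2)),
          sq_nonneg (Ri i (n + 1) ω)]
      have h4 : R ω ^ 2 ≤ b ^ 2 := by
        rw [← sq_abs]; exact pow_le_pow_left₀ (abs_nonneg _) hω 2
      have h5 := mul_le_mul_of_nonneg_left h2 (Nat.cast_nonneg (α := ℝ) d)
      simp only [hg]
      generalize ∑ i, (It i (n + 1) ω + Ri i (n + 1) ω * (1 / 2)) = x at *
      nlinarith [sq_nonneg (x + R ω)]
    have hi : ∀ i ∈ Finset.univ, Integrable (fun ω => 2 * It i (n + 1) ω ^ 2 + (|C| * t) ^ 2) P :=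
      fun i _ => ((hItL i (n + 1)).1.integrable_sq.const_mul 2).add (integrable_const _)
    refine (integral_mono_ae (hgL n).integrable_sq ((((integrable_finsetSum _ hi).const_mul
      (d : ℝ)).const_mul 2).add (integrable_const _)) hpt).trans ?_
    simp only [Pi.add_apply]
    rw [integral_add (((integrable_finsetSum _ hi).const_mul (d : ℝ)).const_mul 2)
      (integrable_const _), integral_const_mul, integral_const_mul, integral_finsetSum _ hi]
    simp only [integral_const, probReal_univ, one_smul]
    gcongr with i
    rw [integral_add ((hItL i (n + 1)).1.integrable_sq.const_mul 2) (integrable_const _),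
      integral_const_mul]
    simp only [integral_const, probReal_univ, one_smul]
    gcongr
    exact (hItL i (n + 1)).2
  have hlim := tendsto_integral_mul_of_tendstoInMeasure hF2 hgL hgM hg0
  have hlimI : ∀ i, Tendsto (fun n => ∫ ω, F ω * It i (n + 1) ω ∂P) atTop
      (𝓝 (∫ s in (0 : ℝ)..t, (∫ ω, F ω * Y i s ω ∂P) * h s i)) := fun i =>
    (tendsto_integral_ito_sum hF hB ht htT i (hY i)).comp (tendsto_add_atTop_nat 1)
  have hlimR : ∀ i, Tendsto (fun n => ∫ ω, F ω * Ri i (n + 1) ω ∂P) atTop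
      (𝓝 (∫ s in (0 : ℝ)..t, ∫ ω, F ω * Z i s ω ∂P)) := fun i =>
    (tendsto_integral_riemann_sum hFi ht htT (hZ i)).comp (tendsto_add_atTop_nat 1)
  have hlim2 := ((tendsto_finsetSum Finset.univ fun i _ => hlimI i).add
    ((tendsto_finsetSum Finset.univ fun i _ => hlimR i).const_mul (1 / 2))).sub_const
    (∫ ω, F ω * R ω ∂P)
  have hfin := tendsto_nhds_unique hlim (hlim2.congr fun n => ?_)
  · linarith
  · have i1 : ∀ i, Integrable (fun ω => F ω * It i (n + 1) ω) P := fun i =>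
      hF2.integrable_mul (hItL i (n + 1)).1
    have i2 : ∀ i, Integrable (fun ω => F ω * Ri i (n + 1) ω) P := fun i =>
      hF2.integrable_mul (hRiL i (n + 1))
    have i3 : Integrable (fun ω => F ω * R ω) P := hF2.integrable_mul hRL
    have e : ∀ ω, F ω * g n ω = ((∑ i, F ω * It i (n + 1) ω) +
        1 / 2 * ∑ i, F ω * Ri i (n + 1) ω) - F ω * R ω := fun ω => by
      simp only [hg, mul_sub, Finset.mul_sum, ← Finset.sum_add_distrib]
      congr 1
      exact Finset.sum_congr rfl fun i _ => by ring
    have s1 := integrable_finsetSum Finset.univ fun i _ => i1 i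
    have s2 := (integrable_finsetSum Finset.univ fun i _ => i2 i).const_mul (1 / 2)
    simp only [e]
    rw [integral_sub (f := fun ω => (∑ i, F ω * It i (n + 1) ω) +
        1 / 2 * ∑ i, F ω * Ri i (n + 1) ω) (s1.add s2) i3, integral_add s1 s2,
      integral_const_mul, integral_finsetSum _ fun i _ => i1 i,
      integral_finsetSum _ fun i _ => i2 i]

end Expectation

/-! ### Test functions and their derivatives -/

section TestFunctions

variable {d : ℕ} {φ : Space d → ℝ}

theorem IsTestFunction.pderiv (hφ : IsTestFunction φ) (i : Fin d) :
    IsTestFunction (pderiv i φ) :=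
  ⟨(hφ.1.fderiv_right (m := (⊤ : ℕ∞)) (by simp)).clm_apply contDiff_const,
    hφ.2.fderiv_apply ℝ _⟩

theorem IsTestFunction.continuous (hφ : IsTestFunction φ) : Continuous φ := hφ.1.continuous

theorem IsTestFunction.integrable (hφ : IsTestFunction φ) : Integrable φ :=
  hφ.continuous.integrable_of_hasCompactSupport hφ.2

theorem IsTestFunction.memLp (hφ : IsTestFunction φ) : MemLp φ 2 volume :=
  hφ.continuous.memLp_of_hasCompactSupport hφ.2

theorem IsTestFunction.continuous_fderiv (hφ : IsTestFunction φ) : Continuous (fderiv ℝ φ) :=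
  hφ.1.continuous_fderiv (by simp)

theorem fderiv_apply_eq_sum (φ : Space d → ℝ) (x v : Space d) :
    fderiv ℝ φ x v = ∑ i, v i * pderiv i φ x := by
  conv_lhs => rw [← (EuclideanSpace.basisFun (Fin d) ℝ).sum_repr v]
  simp [pderiv]

end TestFunctions

/-! ### Fubini and space-time integrals -/

section Fubini

/-- Fubini's theorem for the pairing of a bounded random field with an integrable kernel. -/
theorem integral_mul_integral_swap {Ω Q : Type*} [MeasurableSpace Ω] [MeasurableSpace Q]
    {P : Measure Ω} [SFinite P] {κ : Measure Q} [SFinite κ] {g : Ω → Q → ℝ} {U : ℝ}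
    (hg : AEStronglyMeasurable (fun p : Ω × Q => g p.1 p.2) (P.prod κ))
    (hU : ∀ᵐ p ∂P.prod κ, |g p.1 p.2| ≤ U) {F : Ω → ℝ} (hF : Integrable F P) {k : Q → ℝ}
    (hk : Integrable k κ) :
    Integrable (fun q => (∫ ω, g ω q * F ω ∂P) * k q) κ ∧
      Integrable (fun ω => F ω * ∫ q, g ω q * k q ∂κ) P ∧
      ∫ ω, F ω * ∫ q, g ω q * k q ∂κ ∂P = ∫ q, (∫ ω, g ω q * F ω ∂P) * k q ∂κ := by
  have h1 : Integrable (fun p : Ω × Q => g p.1 p.2 * (F p.1 * k p.2)) (P.prod κ) :=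
    (hF.mul_prod hk).bdd_mul hg hU
  have e : ∀ q, (∫ ω, g ω q * F ω ∂P) * k q = ∫ ω, g ω q * (F ω * k q) ∂P := fun q => by
    rw [← integral_mul_const]
    congr with ω; ring
  have e' : ∀ ω, F ω * ∫ q, g ω q * k q ∂κ = ∫ q, g ω q * (F ω * k q) ∂κ := fun ω => by
    rw [← integral_const_mul]
    congr with q; ring
  simp only [e, e']
  exact ⟨h1.integral_prod_right, h1.integral_prod_left,
    integral_integral_swap (f := fun ω q => g ω q * (F ω * k q)) h1⟩

theorem ae_integrable_mul_of_ae_bound {Ω Q : Type*} [MeasurableSpace Ω] [MeasurableSpace Q]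
    {P : Measure Ω} [SFinite P] {κ : Measure Q} [SFinite κ] {g : Ω → Q → ℝ} {U : ℝ}
    (hg : AEStronglyMeasurable (fun p : Ω × Q => g p.1 p.2) (P.prod κ))
    (hU : ∀ᵐ p ∂P.prod κ, |g p.1 p.2| ≤ U) :
    ∀ᵐ ω ∂P, (∀ᵐ q ∂κ, |g ω q| ≤ U) ∧ ∀ k : Q → ℝ, Integrable k κ →
      Integrable (fun q => g ω q * k q) κ ∧ |∫ q, g ω q * k q ∂κ| ≤ U * ∫ q, |k q| ∂κ := by
  filter_upwards [hg.prodMk_left, Measure.ae_ae_of_ae_prod hU] with ω h1 h2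
  refine ⟨h2, fun k hk => ⟨hk.bdd_mul h1 h2, ?_⟩⟩
  rw [← integral_const_mul]
  refine abs_integral_le_integral_abs.trans (integral_mono_ae (hk.bdd_mul h1 h2).abs
    (hk.abs.const_mul U) ?_)
  filter_upwards [h2] with q hq
  rw [abs_mul]
  exact mul_le_mul_of_nonneg_right hq (abs_nonneg _)

/-- Exchanging the order of the first two variables on a triple product. -/
theorem measurePreserving_prod_prod_swap {α β γ : Type*} [MeasurableSpace α] [MeasurableSpace β]
    [MeasurableSpace γ] (μ : Measure α) (ν : Measure β) (κ : Measure γ) [SFinite μ] [SFinite ν]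
    [SFinite κ] : MeasurePreserving (fun p : β × α × γ => (p.2.1, p.1, p.2.2))
      (ν.prod (μ.prod κ)) (μ.prod (ν.prod κ)) :=
  (measurePreserving_prodAssoc μ ν κ).comp
    ((Measure.measurePreserving_swap.prod (MeasurePreserving.id κ)).comp
      ((measurePreserving_prodAssoc ν μ κ).symm MeasurableEquiv.prodAssoc))

variable {d : ℕ} {T : ℝ}

/-- A space-time integral up to time `t` is an iterated integral. -/
theorem intervalIntegral_integral_eq {t : ℝ} (ht : 0 ≤ t) (htT : t ≤ T) {f : ℝ → Space d → ℝ}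
    (hf : Integrable (fun p : ℝ × Space d => f p.1 p.2) (timeSpaceMeasure T d)) :
    ∫ s in (0 : ℝ)..t, ∫ x, f s x = ∫ p, f p.1 p.2 ∂timeSpaceMeasure t d := by
  have hle : timeSpaceMeasure t d ≤ timeSpaceMeasure T d :=
    Measure.prod_mono (Measure.restrict_mono (Icc_subset_Icc_right htT) le_rfl) le_rfl
  rw [integral_prod _ (hf.mono_measure hle), intervalIntegral.integral_of_le ht,
    integral_Icc_eq_integral_Ioc]

theorem integral_integral_add {t : ℝ} (ht : 0 ≤ t) (htT : t ≤ T) {f g : ℝ → Space d → ℝ}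
    (hf : Integrable (fun p : ℝ × Space d => f p.1 p.2) (timeSpaceMeasure T d))
    (hg : Integrable (fun p : ℝ × Space d => g p.1 p.2) (timeSpaceMeasure T d)) :
    (∫ s in (0 : ℝ)..t, ∫ x, f s x) + (∫ s in (0 : ℝ)..t, ∫ x, g s x) =
      ∫ s in (0 : ℝ)..t, ∫ x, (f s x + g s x) := by
  have hle : timeSpaceMeasure t d ≤ timeSpaceMeasure T d :=
    Measure.prod_mono (Measure.restrict_mono (Icc_subset_Icc_right htT) le_rfl) le_rfl
  rw [intervalIntegral_integral_eq ht htT hf, intervalIntegral_integral_eq ht htT hg,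
    intervalIntegral_integral_eq ht htT (f := fun s x => f s x + g s x) (hf.add hg),
    integral_add (hf.mono_measure hle) (hg.mono_measure hle)]

/-- An indefinite integral has variation at most the integral of a dominating function, whatever the
grid. -/
theorem sum_abs_intervalIntegral_sub_le {t : ℝ} (ht : 0 ≤ t) (htT : t ≤ T) {g κ : ℝ → ℝ}
    (hg : Integrable g (timeMeasure T)) (hκ : Integrable κ (timeMeasure T))
    (h : ∀ᵐ s ∂timeMeasure T, |g s| ≤ κ s) (n : ℕ) :
    ∑ k ∈ Finset.range n, |(∫ s in (0 : ℝ)..gridPt t n (k + 1), g s) -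
      ∫ s in (0 : ℝ)..gridPt t n k, g s| ≤ ∫ s in (0 : ℝ)..t, κ s := by
  have hint (f : ℝ → ℝ) (hf : Integrable f (timeMeasure T)) {r s : ℝ} (hr : r ∈ Icc 0 T)
      (hs : s ∈ Icc 0 T) : IntervalIntegrable f volume r s :=
    (IntegrableOn.mono_set hf (uIcc_subset_Icc hr hs)).intervalIntegrable
  have hκ0 : 0 ≤ᵐ[timeMeasure T] κ := h.mono fun s hs => (abs_nonneg _).trans hs
  have h0 : (0 : ℝ) ∈ Icc 0 T := ⟨le_rfl, ht.trans htT⟩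
  rcases Nat.eq_zero_or_pos n with rfl | hn
  · rw [Finset.range_zero, Finset.sum_empty]
    refine intervalIntegral.integral_nonneg_of_ae_restrict ht ?_
    exact ae_restrict_of_ae_restrict_of_subset (Icc_subset_Icc_right htT) hκ0
  have hmem : ∀ {k}, k ≤ n → gridPt t n k ∈ Icc 0 T := fun hk => gridPt_mem ht htT hk
  have h1 : ∑ k ∈ Finset.range n, ∫ s in gridPt t n k..gridPt t n (k + 1), κ s =
      ∫ s in (0 : ℝ)..t, κ s := by
    rw [intervalIntegral.sum_integral_adjacent_intervals fun k hk =>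
      hint κ hκ (hmem hk.le) (hmem hk), gridPt_zero, gridPt_last hn]
  rw [← h1]
  refine Finset.sum_le_sum fun k hk => ?_
  have hk := Finset.mem_range.1 hk
  rw [intervalIntegral.integral_interval_sub_left (hint g hg h0 (hmem hk)) (hint g hg h0 (hmem hk.le))]
  refine (intervalIntegral.abs_integral_le_integral_abs (gridPt_mono ht n k.le_succ)).trans ?_
  refine intervalIntegral.integral_mono_ae_restrict (gridPt_mono ht n k.le_succ)
    (hint g hg (hmem hk.le) (hmem hk)).abs (hint κ hκ (hmem hk.le) (hmem hk)) ?_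
  exact ae_restrict_of_ae_restrict_of_subset
    (Icc_subset_Icc (hmem hk.le).1 (hmem hk).2) h

end Fubini

/-! ### Integrability of the drift kernels -/

section Kernels

variable {d : ℕ} {T : ℝ} {φ : Space d → ℝ}

/-- The kernel vanishes off the compact support of φ; on [0,T] times that support the measure is
finite, so L² gives L¹, and ∇φ is bounded. -/
theorem MemL2Loc.integrable_fderiv {b : ℝ → Space d → Space d} (hb : MemL2Loc T b)
    (hφ : IsTestFunction φ) :
    Integrable (fun p : ℝ × Space d => fderiv ℝ φ p.2 (b p.1 p.2)) (timeSpaceMeasure T d) := by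
  have hK : IsCompact (tsupport φ) := hφ.2
  have hsupp : Function.support (fun p : ℝ × Space d => fderiv ℝ φ p.2 (b p.1 p.2)) ⊆
      univ ×ˢ tsupport φ := fun p hp => by
    refine ⟨mem_univ _, support_fderiv_subset ℝ (f := φ) fun h0 => hp ?_⟩
    simp only [h0, zero_apply]
  rw [← integrableOn_iff_integrable_of_support_subset hsupp, IntegrableOn,
    ← Measure.prod_restrict, Measure.restrict_univ]
  have : IsFiniteMeasure (volume.restrict (tsupport φ)) := ⟨by simpa using hK.measure_lt_top⟩
  have hbi := (hb _ hK).integrable (by norm_num)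
  obtain ⟨M, hM⟩ := hφ.continuous_fderiv.bounded_above_of_compact_support (hφ.2.fderiv ℝ)
  have hm : AEStronglyMeasurable (fun p : ℝ × Space d => fderiv ℝ φ p.2 (b p.1 p.2))
      ((timeMeasure T).prod (volume.restrict (tsupport φ))) :=
    (isBoundedBilinearMap_apply (𝕜 := ℝ) (E := Space d) (F := ℝ)).continuous.comp_aestronglyMeasurable
      ((hφ.continuous_fderiv.comp continuous_snd).aestronglyMeasurable.prodMk hbi.1)
  refine (hbi.norm.const_mul M).mono' hm (ae_of_all _ fun p => ?_)
  exact (ContinuousLinearMap.le_opNorm _ _).trans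
    (mul_le_mul_of_nonneg_right (hM _) (norm_nonneg _))

theorem MemL1Linfty.integrable_mul {g : ℝ → Space d → ℝ} (hg : MemL1Linfty T g)
    (hφ : IsTestFunction φ) :
    Integrable (fun p : ℝ × Space d => φ p.2 * g p.1 p.2) (timeSpaceMeasure T d) := by
  obtain ⟨hm, γ, hγ, hle⟩ := hg
  refine (hγ.mul_prod hφ.integrable.abs).mono'
    ((hφ.continuous.comp continuous_snd).aestronglyMeasurable.mul hm) ?_
  filter_upwards [hle] with p hp
  rw [norm_mul, mul_comm]
  exact mul_le_mul_of_nonneg_right hp (abs_nonneg _)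

end Kernels

/-! ### Pairings of a bounded random field with test functions -/

section BoundedField

variable {Ω : Type*} [MeasurableSpace Ω] {P : Measure Ω} [IsProbabilityMeasure P] {d : ℕ}
  {T U : ℝ} {u : Ω → ℝ → Space d → ℝ}

theorem integral_mul_drift
    (hum : AEStronglyMeasurable (fun p : Ω × ℝ × Space d => u p.1 p.2.1 p.2.2)
      (P.prod (timeSpaceMeasure T d)))
    (huU : ∀ᵐ p ∂P.prod (timeSpaceMeasure T d), |u p.1 p.2.1 p.2.2| ≤ U)
    {F : Ω → ℝ} (hF : Integrable F P) {k : ℝ → Space d → ℝ}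
    (hk : Integrable (fun p : ℝ × Space d => k p.1 p.2) (timeSpaceMeasure T d)) {t : ℝ}
    (ht : 0 ≤ t) (htT : t ≤ T) :
    Integrable (fun ω => F ω * ∫ s in (0 : ℝ)..t, ∫ x, u ω s x * k s x) P ∧
    ∫ ω, F ω * (∫ s in (0 : ℝ)..t, ∫ x, u ω s x * k s x) ∂P =
      ∫ s in (0 : ℝ)..t, ∫ x, meanAgainst P u F s x * k s x := by
  have hle : timeSpaceMeasure t d ≤ timeSpaceMeasure T d :=
    Measure.prod_mono (Measure.restrict_mono (Icc_subset_Icc_right htT) le_rfl) le_rfl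
  have hle' : P.prod (timeSpaceMeasure t d) ≤ P.prod (timeSpaceMeasure T d) :=
    Measure.prod_mono le_rfl hle
  rw [intervalIntegral_integral_eq ht htT (f := fun s x => meanAgainst P u F s x * k s x)
    (integral_mul_integral_swap (g := fun ω (q : ℝ × Space d) => u ω q.1 q.2) hum huU hF hk).1]
  obtain ⟨-, h1, h2⟩ := (integral_mul_integral_swap (g := fun ω (q : ℝ × Space d) => u ω q.1 q.2)
    (hum.mono_measure hle') (ae_mono hle' huU) hF (hk.mono_measure hle))
  have e : (fun ω => F ω * ∫ s in (0 : ℝ)..t, ∫ x, u ω s x * k s x) =ᵐ[P]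
      fun ω => F ω * ∫ p, u ω p.1 p.2 * k p.1 p.2 ∂timeSpaceMeasure t d := ?_
  · exact ⟨h1.congr e.symm, (integral_congr_ae e).trans h2⟩
  filter_upwards [ae_integrable_mul_of_ae_bound (g := fun ω (q : ℝ × Space d) => u ω q.1 q.2)
    hum huU] with ω hω
  rw [intervalIntegral_integral_eq ht htT (f := fun s x => u ω s x * k s x) (hω.2 _ hk).1]

/-- Almost every path of the drift has variation at most a deterministic constant, since |u| ≤ U and
the kernel is not random. -/
theorem ae_drift_bounds
    (hum : AEStronglyMeasurable (fun p : Ω × ℝ × Space d => u p.1 p.2.1 p.2.2)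
      (P.prod (timeSpaceMeasure T d)))
    (huU : ∀ᵐ p ∂P.prod (timeSpaceMeasure T d), |u p.1 p.2.1 p.2.2| ≤ U)
    {k : ℝ → Space d → ℝ}
    (hk : Integrable (fun p : ℝ × Space d => k p.1 p.2) (timeSpaceMeasure T d)) {t : ℝ}
    (ht : 0 ≤ t) (htT : t ≤ T) :
    ∀ᵐ ω ∂P, ∀ n, ∑ q ∈ Finset.range n,
      |(∫ s in (0 : ℝ)..gridPt t n (q + 1), ∫ x, u ω s x * k s x) -
        ∫ s in (0 : ℝ)..gridPt t n q, ∫ x, u ω s x * k s x| ≤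
      ∫ s in (0 : ℝ)..t, U * ∫ x, |k s x| := by
  filter_upwards [ae_integrable_mul_of_ae_bound (g := fun ω (q : ℝ × Space d) => u ω q.1 q.2)
    hum huU] with ω hω n
  refine sum_abs_intervalIntegral_sub_le ht htT (hω.2 _ hk).1.integral_prod_left
    (hk.abs.integral_prod_left.const_mul U) ?_ n
  filter_upwards [Measure.ae_ae_of_ae_prod hω.1, hk.prod_right_ae, (hω.2 _ hk).1.prod_right_ae]
    with s h1 h2 h3
  rw [← integral_const_mul]
  refine abs_integral_le_integral_abs.trans (integral_mono_ae h3.abs (h2.abs.const_mul U) ?_)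
  filter_upwards [h1] with x hx
  rw [abs_mul]
  exact mul_le_mul_of_nonneg_right hx (abs_nonneg _)

theorem ae_slice
    (hum : AEStronglyMeasurable (fun p : Ω × ℝ × Space d => u p.1 p.2.1 p.2.2)
      (P.prod (timeSpaceMeasure T d)))
    (huU : ∀ᵐ p ∂P.prod (timeSpaceMeasure T d), |u p.1 p.2.1 p.2.2| ≤ U) :
    ∀ᵐ t ∂timeMeasure T,
      AEStronglyMeasurable (fun q : Ω × Space d => u q.1 t q.2) (P.prod volume) ∧
      ∀ᵐ q ∂P.prod (volume : Measure (Space d)), |u q.1 t q.2| ≤ U := by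
  have hmp := measurePreserving_prod_prod_swap P (timeMeasure T) (volume : Measure (Space d))
  filter_upwards [(hum.comp_measurePreserving hmp).prodMk_left,
    Measure.ae_ae_of_ae_prod (hmp.quasiMeasurePreserving.ae huU)] with t h1 h2
  exact ⟨h1, h2⟩

/-- A semimartingale version of the pairing of a bounded field with an integrable function can be
chosen bounded and adapted. -/
theorem IsSemimartingaleVersion.exists_isBoundedAdapted {B : ℝ → Ω → Space d} (hT : 0 < T)
    (hU : 0 ≤ U)
    (hum : AEStronglyMeasurable (fun p : Ω × ℝ × Space d => u p.1 p.2.1 p.2.2)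
      (P.prod (timeSpaceMeasure T d)))
    (huU : ∀ᵐ p ∂P.prod (timeSpaceMeasure T d), |u p.1 p.2.1 p.2.2| ≤ U)
    {ψ : Space d → ℝ} (hψ : Integrable ψ) {X : ℝ → Ω → ℝ}
    (hX : IsSemimartingaleVersion P T B u ψ X) {C : ℝ} (hC : U * ∫ x, |ψ x| ≤ C) :
    ∃ Y, IsSemimartingaleVersion P T B u ψ Y ∧ IsBoundedAdapted P T B C Y := by
  obtain ⟨M, A, hM, hA, hXMA⟩ := hX.semimartingale
  have hC0 : 0 ≤ C := (mul_nonneg hU (integral_nonneg fun _ => abs_nonneg _)).trans hC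
  have hbound : ∀ᵐ t ∂timeMeasure T, ∀ᵐ ω ∂P, |X t ω| ≤ C := by
    filter_upwards [ae_slice hum huU, hX.modification] with t ht1 ht2
    filter_upwards [ae_integrable_mul_of_ae_bound (g := fun ω x => u ω t x) ht1.1 ht1.2, ht2]
      with ω h1 h2
    rw [h2]
    exact (h1.2 ψ hψ).2.trans hC
  -- The bound is known only for almost every time, with an exceptional event depending on the time.
  -- A countable dense set of good times merges these events, and continuity of the paths extends
  -- the bound to [0,T].
  have hdense : ∃ D ⊆ Icc 0 T, D.Countable ∧ Icc 0 T ⊆ closure D ∧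
      ∀ t ∈ D, ∀ᵐ ω ∂P, |X t ω| ≤ C := by
    rw [ae_restrict_iff' measurableSet_Icc] at hbound
    have h1 := (Measure.dense_of_ae hbound).open_subset_closure_inter (isOpen_Ioo (a := 0) (b := T))
    obtain ⟨D, hD, hDc, hDd⟩ := TopologicalSpace.IsSeparable.exists_countable_dense_subset
      (TopologicalSpace.IsSeparable.of_separableSpace
        (Ioo 0 T ∩ {t | t ∈ Icc 0 T → ∀ᵐ ω ∂P, |X t ω| ≤ C}))
    refine ⟨D, fun t ht => Ioo_subset_Icc_self (hD ht).1, hDc, ?_, fun t ht => ?_⟩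
    · rw [← closure_Ioo hT.ne]
      exact closure_minimal (h1.trans (closure_minimal hDd isClosed_closure)) isClosed_closure
    · exact (hD ht).2 (Ioo_subset_Icc_self (hD ht).1)
  obtain ⟨D, hDT, hDc, hDd, hDb⟩ := hdense
  have hall : ∀ᵐ ω ∂P, ∀ t ∈ Icc 0 T, |X t ω| ≤ C := by
    filter_upwards [(ae_ball_iff hDc).2 hDb, hX.continuous] with ω h1 h2 t ht
    have hcl := h2.preimage_isClosed_of_isClosed isClosed_Icc (isClosed_Icc (a := -C) (b := C))
    have hsub : D ⊆ Icc 0 T ∩ (fun t => X t ω) ⁻¹' Icc (-C) C := fun s hs =>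
      ⟨hDT hs, abs_le.1 (h1 s hs)⟩
    exact abs_le.2 (closure_minimal hsub hcl (hDd ht)).2
  -- Built from M + A, which is adapted by definition, and truncated to be bounded for every ω.
  -- Almost surely it equals X on [0,T].
  set Y : ℝ → Ω → ℝ := fun t ω => truncate C (M t.toNNReal ω + A t.toNNReal ω) with hY
  have hYX : ∀ᵐ ω ∂P, ∀ t ∈ Icc 0 T, Y t ω = X t ω := by
    filter_upwards [hall, hXMA] with ω h1 h2 t ht
    have h3 := h2 t.toNNReal (by rw [Real.coe_toNNReal _ ht.1]; exact ht.2)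
    rw [Real.coe_toNNReal _ ht.1] at h3
    simp only [hY]
    rw [← h3, truncate_eq_self (h1 t ht)]
  have hYc : ∀ᵐ ω ∂P, ContinuousOn (fun t => Y t ω) (Icc 0 T) := by
    filter_upwards [hYX, hX.continuous] with ω h1 h2
    exact h2.congr h1
  refine ⟨Y, ⟨hYc, ?_, M, A, hM, hA, ?_⟩, fun t _ => ?_, fun t ω => abs_truncate_le hC0 _, hYc⟩
  · filter_upwards [hX.modification, ae_restrict_mem measurableSet_Icc] with t h1 ht
    filter_upwards [h1, hYX] with ω h2 h3
    rw [h3 t ht, h2]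
  · filter_upwards [hYX, hXMA] with ω h1 h2 t ht
    rw [h1 t ⟨t.2, ht⟩, h2 t ht]
  · exact (continuous_truncate _).comp_stronglyMeasurable
      ((hM.adapted t.toNNReal).add (hA.adapted t.toNNReal))

theorem continuousOn_integral_mul_of_memLp {W : ℝ → Lp ℝ 2 (volume : Measure (Space d))}
    {s : Set ℝ} (hW : ContinuousOn W s) {ψ : Space d → ℝ} (hψ : MemLp ψ 2 volume) :
    ContinuousOn (fun t => ∫ x, W t x * ψ x) s := by
  have h1 : ContinuousOn (fun t => inner ℝ (hψ.toLp ψ) (W t)) s := continuousOn_const.inner hW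
  refine h1.congr fun t _ => ?_
  simp only [L2.inner_def]
  refine integral_congr_ae ?_
  filter_upwards [hψ.coeFn_toLp] with x hx
  rw [hx]
  rfl

/-- The mean of the continuous version of a pairing is the pairing of the continuous version of the
mean. -/
theorem integral_mul_version_eq {B : ℝ → Ω → Space d} (hT : 0 < T)
    (hum : AEStronglyMeasurable (fun p : Ω × ℝ × Space d => u p.1 p.2.1 p.2.2)
      (P.prod (timeSpaceMeasure T d)))
    (huU : ∀ᵐ p ∂P.prod (timeSpaceMeasure T d), |u p.1 p.2.1 p.2.2| ≤ U)
    {F : Ω → ℝ} (hF : Integrable F P) {W : ℝ → Lp ℝ 2 (volume : Measure (Space d))}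
    (hW : IsContL2Version T (meanAgainst P u F) W) {ψ : Space d → ℝ} (hψ : IsTestFunction ψ)
    {X : ℝ → Ω → ℝ} {C : ℝ} (hX : IsSemimartingaleVersion P T B u ψ X)
    (hXb : IsBoundedAdapted P T B C X) {t : ℝ} (ht : t ∈ Icc 0 T) :
    ∫ ω, F ω * X t ω ∂P = ∫ x, W t x * ψ x := by
  -- Both sides are continuous in t, so agreement at almost every time suffices, and there it is
  -- Fubini.
  refine Measure.eqOn_Icc_of_ae_eq volume hT.ne ?_ (hXb.continuousOn_integral hF)
    (continuousOn_integral_mul_of_memLp hW.continuousOn hψ.memLp) ht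
  filter_upwards [ae_slice hum huU, hX.modification, hW.eq_ae] with s h1 h2 h3
  have h4 := (integral_mul_integral_swap (g := fun ω x => u ω s x) h1.1 h1.2 hF hψ.integrable).2.2
  have h5 : ∫ x, W s x * ψ x = ∫ x, (∫ ω, u ω s x * F ω ∂P) * ψ x := by
    refine integral_congr_ae ?_
    filter_upwards [h3] with x hx
    rw [hx]; rfl
  rw [h5, ← h4]
  refine integral_congr_ae ?_
  filter_upwards [h2] with ω hω
  rw [hω]

end BoundedField

/-! ### The averaged equation in terms of continuous versions -/

section Solution

variable {Ω : Type*} [MeasurableSpace Ω] {P : Measure Ω} {d : ℕ}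
  {T : ℝ} {B : ℝ → Ω → Space d} {b : ℝ → Space d → Space d} {divb : ℝ → Space d → ℝ}
  {u₀ : Space d → ℝ} {u : Ω → ℝ → Space d → ℝ}

theorem IsQuasiregularWeakSolution.ae_le (hu : IsQuasiregularWeakSolution P T B b divb u₀ u) :
    ∀ᵐ p ∂P.prod (timeSpaceMeasure T d), |u p.1 p.2.1 p.2.2| ≤
      lpNorm (fun p : Ω × ℝ × Space d => u p.1 p.2.1 p.2.2) ∞ (P.prod (timeSpaceMeasure T d)) :=
  ae_le_lpNorm_exponent_top hu.memLp_top

variable [IsProbabilityMeasure P]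

theorem IsQuasiregularWeakSolution.exists_isBoundedAdapted (hT : 0 < T)
    (hu : IsQuasiregularWeakSolution P T B b divb u₀ u) {ψ : Space d → ℝ}
    (hψ : IsTestFunction ψ) :
    ∃ C, ∀ C' ≥ C, ∃ X, IsSemimartingaleVersion P T B u ψ X ∧ IsBoundedAdapted P T B C' X := by
  obtain ⟨X, hX⟩ := hu.exists_version ψ hψ
  exact ⟨_, fun C' hC' => hX.exists_isBoundedAdapted hT lpNorm_nonneg hu.memLp_top.1 hu.ae_le
    hψ.integrable hC'⟩

theorem integrable_drift_kernel (hb : MemL2Loc T b) (hdivb : MemL1Linfty T divb)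
    {φ : Space d → ℝ} (hφ : IsTestFunction φ) :
    Integrable (fun p : ℝ × Space d => fderiv ℝ φ p.2 (b p.1 p.2) + φ p.2 * divb p.1 p.2)
      (timeSpaceMeasure T d) :=
  (hb.integrable_fderiv hφ).add (hdivb.integrable_mul hφ)

/-- The defining equation, with the two drift terms joined. -/
theorem IsQuasiregularWeakSolution.equation_drift
    (hu : IsQuasiregularWeakSolution P T B b divb u₀ u) (hb : MemL2Loc T b)
    (hdivb : MemL1Linfty T divb) {φ : Space d → ℝ} (hφ : IsTestFunction φ)
    {X : ℝ → Ω → ℝ} {Y : Fin d → ℝ → Ω → ℝ} (hX : IsSemimartingaleVersion P T B u φ X)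
    (hY : ∀ i, IsSemimartingaleVersion P T B u (pderiv i φ) (Y i)) {t : ℝ} (ht : t ∈ Icc 0 T) :
    ∃ S : Fin d → Ω → ℝ,
      (∀ i, IsStratonovichIntegral P t (Y i) (fun s ω => B s ω i) (S i)) ∧
      ∀ᵐ ω ∂P, X t ω = (∫ x, u₀ x * φ x) + (∫ s in (0 : ℝ)..t, ∫ x, u ω s x *
        (fderiv ℝ φ x (b s x) + φ x * divb s x)) + ∑ i, S i ω := by
  obtain ⟨S, hS, hSX⟩ := hu.equation φ hφ X Y hX hY t ht
  refine ⟨S, hS, ?_⟩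
  filter_upwards [hSX, ae_integrable_mul_of_ae_bound
    (g := fun ω (q : ℝ × Space d) => u ω q.1 q.2) hu.memLp_top.1 hu.ae_le] with ω h1 h2
  have h3 := integral_integral_add ht.1 ht.2
    (f := fun s x => u ω s x * fderiv ℝ φ x (b s x)) (g := fun s x => u ω s x * (φ x * divb s x))
    (h2.2 _ (hb.integrable_fderiv hφ)).1 (h2.2 _ (hdivb.integrable_mul hφ)).1
  have h4 : ∀ s x, divb s x * u ω s x * φ x = u ω s x * (φ x * divb s x) := fun s x => by ring
  simp only [h4] at h1
  simp only [mul_add]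
  rw [h1, ← h3]
  ring

/-- The covariation of a pairing with a coordinate of the Brownian motion. -/
theorem IsQuasiregularWeakSolution.tendstoInMeasure_covariation
    (hu : IsQuasiregularWeakSolution P T B b divb u₀ u) (hB : IsBrownianMotionOn P T B)
    (hb : MemL2Loc T b) (hdivb : MemL1Linfty T divb) {φ : Space d → ℝ} (hφ : IsTestFunction φ)
    {X : ℝ → Ω → ℝ} {Y : Fin d → ℝ → Ω → ℝ} (hX : IsSemimartingaleVersion P T B u φ X)
    (hY : ∀ i, IsSemimartingaleVersion P T B u (pderiv i φ) (Y i)) {C : ℝ}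
    (hYb : ∀ i, IsBoundedAdapted P T B C (Y i)) {t : ℝ} (ht : t ∈ Icc 0 T) (i : Fin d) :
    TendstoInMeasure P (fun n ω => ∑ k ∈ Finset.range n,
      (X (gridPt t n (k + 1)) ω - X (gridPt t n k) ω) * gridIncr B t n i k ω) atTop
      (fun ω => ∫ s in (0 : ℝ)..t, Y i s ω) := by
  have hD := ae_drift_bounds (k := fun s x => fderiv ℝ φ x (b s x) + φ x * divb s x)
    hu.memLp_top.1 hu.ae_le (integrable_drift_kernel hb hdivb hφ) ht.1 ht.2
  refine _root_.tendstoInMeasure_covariation (y₀ := ∫ x, u₀ x * φ x) (D := fun t ω =>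
    ∫ s in (0 : ℝ)..t, ∫ x, u ω s x * (fderiv ℝ φ x (b s x) + φ x * divb s x)) hB ht.1 ht.2 i hYb
    (fun j => (hY j).semimartingale.tightSquares ht.1 ht.2) hD fun s hs => ?_
  exact hu.equation_drift hb hdivb hφ hX hY ⟨hs.1, hs.2.trans ht.2⟩

/-- The mean of a weak solution against a stochastic exponential, tested against `φ`, in terms of
the continuous versions of the pairings with the second derivatives of `φ`. -/
theorem IsQuasiregularWeakSolution.integral_mul_version
    (hu : IsQuasiregularWeakSolution P T B b divb u₀ u) (hT : 0 < T)
    (hB : IsBrownianMotionOn P T B) (hb : MemL2Loc T b) (hdivb : MemL1Linfty T divb)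
    {h : ℝ → Space d} {F : Ω → ℝ} (hF : IsStochasticExponential P T B h F)
    {W : ℝ → Lp ℝ 2 (volume : Measure (Space d))}
    (hW : IsContL2Version T (meanAgainst P u F) W) {φ : Space d → ℝ} (hφ : IsTestFunction φ)
    {t : ℝ} (ht : t ∈ Icc 0 T) :
    ∫ x, W t x * φ x = (∫ x, u₀ x * φ x) +
      (∫ s in (0 : ℝ)..t, ∫ x, meanAgainst P u F s x *
        (fderiv ℝ φ x (b s x) + φ x * divb s x)) +
      (∑ i, ∫ s in (0 : ℝ)..t, (∫ x, W s x * pderiv i φ x) * h s i) +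
      1 / 2 * ∑ i, ∫ s in (0 : ℝ)..t, ∫ x, W s x * pderiv i (pderiv i φ) x := by
  have hF1 : Integrable F P := (hF.memLp_two hT.le hB).integrable (by norm_num)
  have hum := hu.memLp_top.1
  obtain ⟨U, huU⟩ : ∃ U, ∀ᵐ p ∂P.prod (timeSpaceMeasure T d), |u p.1 p.2.1 p.2.2| ≤ U :=
    ⟨_, hu.ae_le⟩
  obtain ⟨c, hc⟩ := hu.exists_isBoundedAdapted hT hφ
  choose c₁ hc₁ using fun i => hu.exists_isBoundedAdapted hT (hφ.pderiv i)
  choose c₂ hc₂ using fun i j => hu.exists_isBoundedAdapted hT ((hφ.pderiv i).pderiv j)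
  -- One bound for the versions paired with φ and with all its first and second derivatives.
  obtain ⟨C, hC⟩ : ∃ C, c ≤ C ∧ (∀ i, c₁ i ≤ C) ∧ ∀ i j, c₂ i j ≤ C := by
    obtain ⟨a₁, h₁⟩ := (Set.finite_range c₁).bddAbove
    obtain ⟨a₂, h₂⟩ := (Set.finite_range fun p : Fin d × Fin d => c₂ p.1 p.2).bddAbove
    exact ⟨max c (max a₁ a₂), le_max_left _ _,
      fun i => (h₁ (mem_range_self i)).trans (by simp),
      fun i j => (h₂ (mem_range_self (i, j))).trans (by simp)⟩
  obtain ⟨X, hXv, hX⟩ := hc C hC.1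
  choose Y hYv hY using fun i => hc₁ i C (hC.2.1 i)
  choose Z hZv hZ using fun i j => hc₂ i j C (hC.2.2 i j)
  -- The second use of the equation, with ∂_iφ as test function: the covariation of Y^i with B^i
  -- selects ∂_i∂_iφ.
  have hcov : ∀ i, TendstoInMeasure P (fun n ω => ∑ k ∈ Finset.range n,
      (Y i (gridPt t n (k + 1)) ω - Y i (gridPt t n k) ω) * gridIncr B t n i k ω) atTop
      (fun ω => ∫ s in (0 : ℝ)..t, Z i i s ω) := fun i =>
    hu.tendstoInMeasure_covariation hB hb hdivb (hφ.pderiv i) (hYv i) (hZv i) (hZ i) ht i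
  obtain ⟨S, hS, hSX⟩ := hu.equation_drift hb hdivb hφ hXv hYv ht
  set D : Ω → ℝ := fun ω => ∫ s in (0 : ℝ)..t, ∫ x, u ω s x *
    (fderiv ℝ φ x (b s x) + φ x * divb s x) with hD
  set y₀ : ℝ := ∫ x, u₀ x * φ x
  have hk := integrable_drift_kernel hb hdivb hφ
  obtain ⟨hDi, hDm⟩ := integral_mul_drift (k := fun s x => fderiv ℝ φ x (b s x) +
    φ x * divb s x) hum huU hF1 hk ht.1 ht.2
  have hDb := ae_drift_bounds (k := fun s x => fderiv ℝ φ x (b s x) +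
    φ x * divb s x) hum huU hk ht.1 ht.2
  set β : ℝ := ∫ s in (0 : ℝ)..t, U * ∫ x, |fderiv ℝ φ x (b s x) + φ x * divb s x|
  have hSb : ∀ᵐ ω ∂P, |∑ i, S i ω| ≤ C + |y₀| + β := by
    filter_upwards [hSX, hDb] with ω h1 h2
    -- The grid with a single step bounds the total drift over [0,t]. Boundedness of X then bounds
    -- the sum of the Stratonovich integrals.
    have h3 := h2 1
    rw [Finset.sum_range_one, zero_add, gridPt_last one_pos, gridPt_zero,
      intervalIntegral.integral_same, sub_zero] at h3
    have h4 : ∑ i, S i ω = X t ω - y₀ - D ω := by rw [h1]; ring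
    rw [h4]
    exact (abs_sub _ _).trans (add_le_add ((abs_sub _ _).trans
      (add_le_add (hX.bounded t ω) le_rfl)) h3)
  have hstr := integral_mul_stratonovich hF hB ht.1 ht.2 hY (fun i => hZ i i) hS hcov hSb
  have hXi : Integrable (fun ω => F ω * X t ω) P :=
    hF1.mul_bdd (hX.measurable ht).aestronglyMeasurable (ae_of_all _ fun ω => hX.bounded t ω)
  have hsplit : ∫ ω, F ω * ∑ i, S i ω ∂P = ∫ ω, F ω * X t ω ∂P - y₀ - ∫ ω, F ω * D ω ∂P := by
    have h1 : ∫ ω, F ω * ∑ i, S i ω ∂P = ∫ ω, (F ω * X t ω - F ω * y₀ - F ω * D ω) ∂P := by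
      refine integral_congr_ae ?_
      filter_upwards [hSX] with ω hω
      rw [hω]; ring
    rw [h1, integral_sub (f := fun ω => F ω * X t ω - F ω * y₀) (hXi.sub (hF1.mul_const _)) hDi,
      integral_sub hXi (hF1.mul_const _), integral_mul_const, hF.integral_eq_one hT.le hB, one_mul]
  have hmean : ∀ {ψ : Space d → ℝ} {Q : ℝ → Ω → ℝ}, IsTestFunction ψ →
      IsSemimartingaleVersion P T B u ψ Q → IsBoundedAdapted P T B C Q →
      ∀ s ∈ Icc 0 T, ∫ ω, F ω * Q s ω ∂P = ∫ x, W s x * ψ x := fun hψ hQv hQ s hs =>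
    integral_mul_version_eq hT hum huU hF1 hW hψ hQv hQ hs
  have hsub : uIcc 0 t ⊆ Icc 0 T := by
    rw [uIcc_of_le ht.1]; exact Icc_subset_Icc_right ht.2
  have e1 : ∀ i, ∫ s in (0 : ℝ)..t, (∫ ω, F ω * Y i s ω ∂P) * h s i =
      ∫ s in (0 : ℝ)..t, (∫ x, W s x * pderiv i φ x) * h s i := fun i =>
    intervalIntegral.integral_congr fun s hs => by
      simp only [hmean (hφ.pderiv i) (hYv i) (hY i) s (hsub hs)]
  have e2 : ∀ i, ∫ s in (0 : ℝ)..t, ∫ ω, F ω * Z i i s ω ∂P =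
      ∫ s in (0 : ℝ)..t, ∫ x, W s x * pderiv i (pderiv i φ) x := fun i =>
    intervalIntegral.integral_congr fun s hs => by
      simp only [hmean ((hφ.pderiv i).pderiv i) (hZv i i) (hZ i i) s (hsub hs)]
  simp only [e1, e2] at hstr
  rw [← hmean hφ hXv hX t ht, ← hDm]
  linarith

end Solution

/-! ### Rewriting the first and second order terms through V and its weak gradient -/

section Gradient

variable {d : ℕ} {T : ℝ} {V : ℝ → Space d → ℝ} {W : ℝ → Lp ℝ 2 (volume : Measure (Space d))}
  {φ : Space d → ℝ} {t : ℝ}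

theorem IsContL2Version.sum_integral_mul_eq (hW : IsContL2Version T V W) {h : ℝ → Space d}
    (hh : MemLp h 2 (timeMeasure T)) (hφ : IsTestFunction φ) (ht : t ∈ Icc 0 T) :
    ∑ i, ∫ s in (0 : ℝ)..t, (∫ x, W s x * pderiv i φ x) * h s i =
      ∫ s in (0 : ℝ)..t, ∫ x, V s x * fderiv ℝ φ x (h s) := by
  have hint : ∀ i ∈ Finset.univ, IntervalIntegrable
      (fun s => (∫ x, W s x * pderiv i φ x) * h s i) volume 0 t := fun i _ => by
    refine (intervalIntegrable_coord hh ht.1 ht.2 i).continuousOn_mul ((continuousOn_integral_mul_of_memLp hW.continuousOn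
      (hφ.pderiv i).memLp).mono ?_)
    rw [uIcc_of_le ht.1]; exact Icc_subset_Icc_right ht.2
  rw [← intervalIntegral.integral_finsetSum hint]
  refine intervalIntegral.integral_congr_ae_restrict ?_
  rw [uIoc_of_le ht.1]
  refine ae_restrict_of_ae_restrict_of_subset
    (Ioc_subset_Icc_self.trans (Icc_subset_Icc_right ht.2)) ?_
  filter_upwards [hW.eq_ae] with s hs
  have h1 : ∫ x, V s x * fderiv ℝ φ x (h s) = ∫ x, ∑ i, W s x * pderiv i φ x * h s i := by
    refine integral_congr_ae ?_
    filter_upwards [hs] with x hx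
    rw [hx, fderiv_apply_eq_sum, Finset.mul_sum]
    exact Finset.sum_congr rfl fun i _ => by ring
  rw [h1, integral_finsetSum (f := fun i x => W s x * pderiv i φ x * h s i) _ fun i _ =>
    ((Lp.memLp (W s)).integrable_mul (hφ.pderiv i).memLp).mul_const (h s i)]
  exact Finset.sum_congr rfl fun i _ => (integral_mul_const _ _).symm

/-- The definition of the weak gradient, applied to the test function ∂_iφ, moves one derivative
onto V at almost every time. -/
theorem IsL2H1With.sum_integral_pderiv_eq {G : ℝ → Space d → Space d} (hG : IsL2H1With T V G)
    (hW : IsContL2Version T V W) (hφ : IsTestFunction φ) (ht : t ∈ Icc 0 T) :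
    ∑ i, ∫ s in (0 : ℝ)..t, ∫ x, W s x * pderiv i (pderiv i φ) x =
      - ∫ s in (0 : ℝ)..t, ∫ x, fderiv ℝ φ x (G s x) := by
  have hGi : ∀ i, Integrable (fun p : ℝ × Space d => G p.1 p.2 i * pderiv i φ p.2)
      (timeSpaceMeasure T d) := fun i => by
    have h1 : MemLp (fun p : ℝ × Space d => G p.1 p.2 i) 2 (timeSpaceMeasure T d) :=
      hG.memLp_grad.mono ((EuclideanSpace.proj (𝕜 := ℝ) i).continuous.comp_aestronglyMeasurable
        hG.memLp_grad.1) (ae_of_all _ fun s => PiLp.norm_apply_le _ i)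
    exact h1.integrable_mul ((hφ.pderiv i).memLp.comp_snd (timeMeasure T))
  have hsub : Ioc 0 t ⊆ Icc 0 T := Ioc_subset_Icc_self.trans (Icc_subset_Icc_right ht.2)
  have e : ∀ i, ∫ s in (0 : ℝ)..t, ∫ x, W s x * pderiv i (pderiv i φ) x =
      ∫ s in (0 : ℝ)..t, - ∫ x, G s x i * pderiv i φ x := fun i => by
    refine intervalIntegral.integral_congr_ae_restrict ?_
    rw [uIoc_of_le ht.1]
    refine ae_restrict_of_ae_restrict_of_subset hsub ?_
    filter_upwards [hW.eq_ae, hG.weak_grad _ (hφ.pderiv i) i] with s h1 h2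
    rw [← h2]
    refine integral_congr_ae ?_
    filter_upwards [h1] with x hx
    rw [hx]
  simp only [e, intervalIntegral.integral_neg, Finset.sum_neg_distrib]
  congr 1
  rw [← intervalIntegral.integral_finsetSum fun i _ => by
    rw [intervalIntegrable_iff_integrableOn_Icc_of_le ht.1]
    exact IntegrableOn.mono_set (hGi i).integral_prod_left (Icc_subset_Icc_right ht.2)]
  refine intervalIntegral.integral_congr_ae_restrict ?_
  rw [uIoc_of_le ht.1]
  refine ae_restrict_of_ae_restrict_of_subset hsub ?_
  filter_upwards [ae_all_iff.2 fun i => (hGi i).prod_right_ae] with s hs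
  simp only [fderiv_apply_eq_sum]
  rw [integral_finsetSum _ fun i _ => hs i]

end Gradient

/-! ### The parabolic equation -/

theorem lemma2p6 {Ω : Type*} [MeasurableSpace Ω] (P : Measure Ω) [IsProbabilityMeasure P]
    (d : ℕ) (T : ℝ) (hT : 0 < T)
    (B : ℝ → Ω → Space d) (hB : IsBrownianMotionOn P T B)
    (b : ℝ → Space d → Space d) (hb : MemL2Loc T b)
    (divb : ℝ → Space d → ℝ) (hdiv : HasWeakDiv T b divb) (hdivb : MemL1Linfty T divb)
    (u₀ : Space d → ℝ) (hu₀ : MemLp u₀ 2 volume) (hu₀' : MemLp u₀ ∞ volume)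
    (u : Ω → ℝ → Space d → ℝ) (hu : IsQuasiregularWeakSolution P T B b divb u₀ u)
    (h : ℝ → Space d) (F : Ω → ℝ) (hF : IsStochasticExponential P T B h F) :
    IsParabolicWeakSolution T b divb h u₀ (meanAgainst P u F) := by
  have hFX : F ∈ stochasticExponentials P T B := ⟨h, hF⟩
  obtain ⟨G, hG⟩ := hu.mean_H1 F hFX
  obtain ⟨W, hW⟩ := hu.mean_cont F hFX
  have key : ∀ φ : Space d → ℝ, IsTestFunction φ → ∀ t ∈ Icc 0 T,
      ∫ x, W t x * φ x = (∫ x, u₀ x * φ x)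
        + (∫ s in (0 : ℝ)..t, ∫ x, meanAgainst P u F s x *
          (fderiv ℝ φ x (b s x) + φ x * divb s x))
        + (∫ s in (0 : ℝ)..t, ∫ x, meanAgainst P u F s x * fderiv ℝ φ x (h s))
        - 1 / 2 * ∫ s in (0 : ℝ)..t, ∫ x, fderiv ℝ φ x (G s x) := fun φ hφ t ht => by
    rw [hu.integral_mul_version hT hB hb hdivb hF hW hφ ht, hW.sum_integral_mul_eq hF.1 hφ ht,
      hG.sum_integral_pderiv_eq hW hφ ht]
    ring
  -- At t = 0 all time integrals vanish. This yields the initial condition by the fundamental lemma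
  -- of the calculus of variations, and allows u₀ to be replaced by W(0) in the identity.
  have hzero : ∀ φ : Space d → ℝ, IsTestFunction φ → ∫ x, W 0 x * φ x = ∫ x, u₀ x * φ x :=
    fun φ hφ => by simpa using key φ hφ 0 ⟨le_rfl, hT.le⟩
  refine ⟨G, W, hG, hW, ?_, fun φ hφ t ht => ?_⟩
  · refine ae_eq_of_integral_contDiff_smul_eq ((Lp.memLp (W 0)).locallyIntegrable (by norm_num))
      (hu₀.locallyIntegrable (by norm_num)) fun φ h1 h2 => ?_
    simpa only [smul_eq_mul, mul_comm] using hzero φ ⟨h1, h2⟩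
  · rw [hzero φ hφ]
    exact key φ hφ t ht
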